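/- Manifolds are smooth, finite-dimensional, Hausdorff and without boundary. Let $N$ be a paracompact manifold and let $(\mathbf G\stackrel{\rho}{\to}\mathbf H,\ \jmath:\mathbf H\to\mathrm{Aut}(\mathbf G))$ be a crossed module of (finite-dimensional) Lie groups: $\rho(h(g))=h\rho(g)h^{-1}$ and $\rho(g)(g')=gg'g^{-1}$, where $h(g):=\jmath(h)(g)$ is smooth in $(h,g)$. **Cohomology.** A non-Abelian $1$-cocycle on an open cover $\mathcal U=(U_i)_{i\in I}$ of $N$ consists of smooth maps $\lambda_{ij}:U_i\cap U_j\to\mathbf H$ and $\mathbf g_{ijk}:U_i\cap U_j\cap U_k\to\mathbf G$ with $$\rho(\mathbf g_{ijk})\lambda_{ik}=\lambda_{ij}\lambda_{jk},\qquad \mathbf g_{ijk}\mathbf g_{ikl}=\lambda_{ij}(\mathbf g_{jkl})\,\mathbf g_{ijl},\qquad \mathbf g_{iij}=e .$$ Smooth maps $r_i:U_i\to\mathbf H$, $\mathbf v_{ij}:U_i\cap U_j\to\mathbf G$ relate $(\lambda,\mathbf g)$ to $(\lambda',\mathbf g')$ if $$\lambda'_{ij}=\rho(\mathbf v_{ij})\,r_i\lambda_{ij}r_j^{-1},\qquad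 \mathbf g'_{ijk}\mathbf v_{ik}=\lambda'_{ij}(\mathbf v_{jk})\,\mathbf v_{ij}\,r_i(\mathbf g_{ijk}).$$ $H^1(\mathbf G\to\mathbf H)$ is the set of cocycles on all open covers of $N$, two cocycles being identified if their pull-backs to some common refinement of their covers are so related. **Gerbes.** For a surjective submersion $q:M\to N$ let $N[q]=M\times_NM\rightrightarrows M$ be the pull-back of the groupoid $N\rightrightarrows N$. In a groupoid, $xy$ is defined when the target of $x$ is the source of $y$. A $\mathbf G\to\mathbf H$-extension over $N\rightrightarrows N$ is a quadruple $(q,\ \phi:\mathcal R\to N[q],\ \pi:P\to M,\ \chi)$ where $q:M\to N$ is a surjective submersion; $\mathcal R\rightrightarrows M$ is a Lie groupoid and $\phi$ a groupoid morphism over $\mathrm{id}_M$ which is a surjective submersion and whose kernel $K$ is a locally trivial bundle of Lie groups with fibre $\mathbf G$; $P$ is a principal (right) $\mathbf H$-bundle over $M$ with a left action of $\mathcal R$ commuting with that of $\mathbf H$; and $\chi$ is a smooth map over $M$ from $P$ to the band, the bundle of Lie group isomorphisms $\mathbf G\to K_m$ ($m\in M$), such that for all composable $r\in\mathcal R$,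 $p\in P$ and all $h\in\mathbf H$, $g\in\mathbf G$ $$\chi(r\cdot p\cdot h)(g)=r\;\chi(p)(h(g))\;r^{-1},\qquad p\cdot\rho(g)=\chi(p)(g)\cdot p .$$ Two extensions with bases $q:M\to N$, $q':M'\to N$ are Morita equivalent (over the identity of $N\rightrightarrows N$) if there are a manifold $M''$ and surjective submersions $p:M''\to M$, $p':M''\to M'$ with $q\circ p=q'\circ p'$ such that the pull-backs of the two extensions along $p$ and $p'$ are isomorphic as $\mathbf G\to\mathbf H$-extensions of $N[q\circ p]=N[q'\circ p']$, over the identity of this groupoid and of $\mathbf H$. A $\mathbf G\to\mathbf H$-gerbe over $N\rightrightarrows N$ is a Morita equivalence class of such extensions. **Theorem.** There is a one-to-one correspondence between $H^1(\mathbf G\to\mathbf H)$ and the $\mathbf G\to\mathbf H$-gerbes over $N\rightrightarrows N$. It sends the class of a cocycle $(\lambda,\mathbf g)$ on $\mathcal U$ to the class of its adapted extension (which exists for every cocycle), i.e. the extension with $M=\coprod_iU_i$, $\mathcal R=\mathbf G\times\coprod_{i,j}U_i\cap U_j$, $P=\coprod_iU_i\times\mathbf H$, the evident projections and $$(g,x_{ij})(g',x_{jk})=(g\,\lambda_{ij}(g')\,\mathbf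 g_{ijk},x_{ik}),\quad (g,x_{ij})\cdot(x_j,h)=(x_i,\rho(g)\lambda_{ij}h),$$ $$(x_i,h)\cdot h'=(x_i,hh'),\quad \chi(x_i,h)(g)=(h(g),x_{ii}).$$ -/

import Mathlib

/-!
# Crossed-module valued non-Abelian cohomology and gerbes over a manifold

Conventions. Manifolds are finite-dimensional, smooth, Hausdorff and without boundary. The product
`x • y` of arrows is defined when the target of `x` is the source of `y`. Partially defined maps
are written as total functions, all of whose axioms are restricted to the domain of definition;
smoothness on a fibred product is `ContMDiffOn` on the corresponding subset of the product. The
subsets concerned are embedded submanifolds (fibred products along submersions), and for those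
`ContMDiffOn` is smoothness for the submanifold structure.
-/

open Set TopologicalSpace
open scoped Manifold ContDiff

universe u

namespace CrossedGerbe

/-- A smooth manifold, bundled: finite-dimensional, Hausdorff, without boundary. -/
structure SmoothMfd : Type (u + 1) where
  carrier : Type u
  modelVec : Type
  modelSpace : Type
  [normed : NormedAddCommGroup modelVec]
  [normedSpace : NormedSpace ℝ modelVec]
  [finDim : FiniteDimensional ℝ modelVec]
  [modelTop : TopologicalSpace modelSpace]
  model : ModelWithCorners ℝ modelVec modelSpace
  [boundaryless : model.Boundaryless]
  [top : TopologicalSpace carrier]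
  [charted : ChartedSpace modelSpace carrier]
  [smooth : IsManifold model ∞ carrier]
  [t2 : T2Space carrier]

instance : CoeSort SmoothMfd.{u} (Type u) := ⟨SmoothMfd.carrier⟩

attribute [instance] SmoothMfd.normed SmoothMfd.normedSpace SmoothMfd.finDim SmoothMfd.modelTop
  SmoothMfd.boundaryless SmoothMfd.top SmoothMfd.charted SmoothMfd.smooth SmoothMfd.t2

/-- A Lie groupoid `arrows ⇉ M`. -/
structure LieGroupoid (M : SmoothMfd.{u}) : Type (u + 1) where
  arrows : SmoothMfd.{u}
  src : arrows → M
  tgt : arrows → M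
  unit : M → arrows
  mul : arrows → arrows → arrows
  inv : arrows → arrows
  src_submersion : Manifold.IsSubmersion arrows.model M.model ∞ src
  tgt_submersion : Manifold.IsSubmersion arrows.model M.model ∞ tgt
  unit_smooth : ContMDiff M.model arrows.model ∞ unit
  mul_smooth : ContMDiffOn (arrows.model.prod arrows.model) arrows.model ∞
    (fun z : arrows × arrows => mul z.1 z.2) {z | tgt z.1 = src z.2}
  inv_smooth : ContMDiff arrows.model arrows.model ∞ inv
  src_unit : ∀ m, src (unit m) = m
  tgt_unit : ∀ m, tgt (unit m) = m
  src_mul : ∀ x y, tgt x = src y → src (mul x y) = src x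
  tgt_mul : ∀ x y, tgt x = src y → tgt (mul x y) = tgt y
  mul_assoc : ∀ x y z, tgt x = src y → tgt y = src z → mul (mul x y) z = mul x (mul y z)
  unit_mul : ∀ x, mul (unit (src x)) x = x
  mul_unit : ∀ x, mul x (unit (tgt x)) = x
  src_inv : ∀ x, src (inv x) = tgt x
  tgt_inv : ∀ x, tgt (inv x) = src x
  mul_inv : ∀ x, mul x (inv x) = unit (src x)
  inv_mul : ∀ x, mul (inv x) x = unit (tgt x)

section Groups

variable {EG HG : Type} [NormedAddCommGroup EG] [NormedSpace ℝ EG] [TopologicalSpace HG]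
  (IG : ModelWithCorners ℝ EG HG) (G : Type u) [Group G] [TopologicalSpace G] [ChartedSpace HG G]
  {EH HH : Type} [NormedAddCommGroup EH] [NormedSpace ℝ EH] [TopologicalSpace HH]
  (IH : ModelWithCorners ℝ EH HH) (H : Type u) [Group H] [TopologicalSpace H] [ChartedSpace HH H]

/-- A crossed module of Lie groups `ρ : G → H`, with (left) action `j` of `H` on `G` by
automorphisms. That `j : H → Aut G` is smooth means that the action map `H × G → G` is. -/
structure LieCrossedModule where
  ρ : G →* H
  j : H →* MulAut G
  ρ_smooth : ContMDiff IG IH ∞ ρ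
  j_smooth : ContMDiff (IH.prod IG) IG ∞ (fun z : H × G => j z.1 z.2)
  equivariance : ∀ (h : H) (g : G), ρ (j h g) = h * ρ g * h⁻¹
  peiffer : ∀ g g' : G, j (ρ g) g' = g * g' * g⁻¹

/-- A (right) principal `H`-bundle `proj : total → M` over the Lie groupoid `Γ ⇉ M`: an ordinary
principal `H`-bundle with a commuting left action of `Γ`. The product `smul r x` is defined when
`tgt r = proj x`. -/
structure PrincipalBundle {M : SmoothMfd.{u}} (Γ : LieGroupoid M) : Type (u + 1) where
  total : SmoothMfd.{u}
  proj : total → M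
  act : total → H → total
  smul : Γ.arrows → total → total
  proj_smooth : ContMDiff total.model M.model ∞ proj
  act_smooth : ContMDiff (total.model.prod IH) total.model ∞
    (fun z : total × H => act z.1 z.2)
  proj_act : ∀ x h, proj (act x h) = proj x
  act_one : ∀ x, act x 1 = x
  act_mul : ∀ x h h', act x (h * h') = act (act x h) h'
  locally_trivial : ∀ m : M, ∃ (V : Set M) (τ : PartialEquiv (M × H) total),
    IsOpen V ∧ m ∈ V ∧ τ.source = V ×ˢ univ ∧ τ.target = proj ⁻¹' V ∧
    ContMDiffOn (M.model.prod IH) total.model ∞ τ τ.source ∧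
    ContMDiffOn total.model (M.model.prod IH) ∞ τ.symm τ.target ∧
    (∀ x ∈ V, ∀ h, proj (τ (x, h)) = x) ∧
    (∀ x ∈ V, ∀ h h', τ (x, h * h') = act (τ (x, h)) h')
  smul_smooth : ContMDiffOn (Γ.arrows.model.prod total.model) total.model ∞
    (fun z : Γ.arrows × total => smul z.1 z.2) {z | Γ.tgt z.1 = proj z.2}
  proj_smul : ∀ r x, Γ.tgt r = proj x → proj (smul r x) = Γ.src r
  mul_smul : ∀ r r' x, Γ.tgt r = Γ.src r' → Γ.tgt r' = proj x →
    smul (Γ.mul r r') x = smul r (smul r' x)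
  unit_smul : ∀ x, smul (Γ.unit (proj x)) x = x
  smul_act : ∀ r x h, Γ.tgt r = proj x → act (smul r x) h = smul r (act x h)

/-- `f` is an element over `m` of the band: a Lie group isomorphism from `G` to the
fibre over `m` of the kernel (the isotropy group of `Γ` at `m`). -/
structure IsBandElement {M : SmoothMfd.{u}} (Γ : LieGroupoid M) (m : M)
    (f : G → Γ.arrows) : Prop where
  mem : ∀ g, Γ.src (f g) = m ∧ Γ.tgt (f g) = m
  map_mul : ∀ g g', f (g * g') = Γ.mul (f g) (f g')
  smooth : ContMDiff IG Γ.arrows.model ∞ f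
  inverse : ∃ k : Γ.arrows → G,
    ContMDiffOn Γ.arrows.model IG ∞ k {r | Γ.src r = m ∧ Γ.tgt r = m} ∧
    (∀ g, k (f g) = g) ∧ ∀ r, Γ.src r = m → Γ.tgt r = m → f (k r) = r

variable {EN HN : Type} [NormedAddCommGroup EN] [NormedSpace ℝ EN] [TopologicalSpace HN]
  (IN : ModelWithCorners ℝ EN HN) {N : Type u} [TopologicalSpace N] [ChartedSpace HN N]

/-- `Γ ⇉ M` is a Lie groupoid `G`-extension of the pull-back `N[q] = M ×_N M ⇉ M` of the trivial
groupoid `N ⇉ N`. An arrow of `N[q]` is the pair of its source and target, so a groupoid morphism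
`φ : Γ → N[q]` over the identity of `M` can only be `φ r = (src r, tgt r)`, and its kernel is
`{r | src r = tgt r}`. The fields say that `φ` takes values in `N[q]`, is surjective, is a
submersion (it has a smooth local section through every point `r` of `Γ`), and that the kernel
is a locally trivial bundle of groups with fibre `G`. -/
structure IsGExtension {M : SmoothMfd.{u}} (q : M → N) (Γ : LieGroupoid M) : Prop where
  maps_to : ∀ r, q (Γ.src r) = q (Γ.tgt r)
  surjective : ∀ m m', q m = q m' → ∃ r, Γ.src r = m ∧ Γ.tgt r = m'
  submersion : ∀ r, ∃ (W : Set (M × M)) (σ : M × M → Γ.arrows),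
    IsOpen W ∧ (Γ.src r, Γ.tgt r) ∈ W ∧ σ (Γ.src r, Γ.tgt r) = r ∧
    ContMDiffOn (M.model.prod M.model) Γ.arrows.model ∞ σ (W ∩ {z | q z.1 = q z.2}) ∧
    ∀ z ∈ W, q z.1 = q z.2 → Γ.src (σ z) = z.1 ∧ Γ.tgt (σ z) = z.2
  kernel_locally_trivial : ∀ m : M, ∃ (V : Set M) (τ : PartialEquiv (M × G) Γ.arrows),
    IsOpen V ∧ m ∈ V ∧ τ.source = V ×ˢ univ ∧
    τ.target = {r | Γ.src r = Γ.tgt r ∧ Γ.src r ∈ V} ∧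
    ContMDiffOn (M.model.prod IG) Γ.arrows.model ∞ τ τ.source ∧
    ContMDiffOn Γ.arrows.model (M.model.prod IG) ∞ τ.symm τ.target ∧
    (∀ x ∈ V, ∀ g, Γ.src (τ (x, g)) = x) ∧
    (∀ x ∈ V, ∀ g g', τ (x, g * g') = Γ.mul (τ (x, g)) (τ (x, g')))

variable {IG G IH H}

variable (N) in
/-- A Lie groupoid `G → H`-extension `(q, Γ → N[q], P → M, χ)` over the trivial groupoid `N ⇉ N`.
The band carries the smooth structure given by local trivialisations of the kernel, so that `χ` is
smooth if and only if both `(x, g) ↦ χ(x)(g)` and `(x, k) ↦ χ(x)⁻¹(k)` are. -/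
structure Extension (X : LieCrossedModule IG G IH H) : Type (u + 1) where
  base : SmoothMfd.{u}
  q : base → N
  q_surjective : Function.Surjective q
  q_submersion : Manifold.IsSubmersion base.model IN ∞ q
  R : LieGroupoid base
  isGExtension : IsGExtension IG G q R
  P : PrincipalBundle IH H R
  chi : P.total → G → R.arrows
  chi_mem_band : ∀ x, IsBandElement IG G R (P.proj x) (chi x)
  chi_smooth : ContMDiff (P.total.model.prod IG) R.arrows.model ∞
    (fun z : P.total × G => chi z.1 z.2)
  chi_inv_smooth : ∃ k : P.total × R.arrows → G,
    ContMDiffOn (P.total.model.prod R.arrows.model) IG ∞ k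
      {z | R.src z.2 = P.proj z.1 ∧ R.tgt z.2 = P.proj z.1} ∧
    ∀ x g, k (x, chi x g) = g
  /-- `χ` is a morphism of principal bundles over the identity of `R`, along `j : H → Aut G`. -/
  chi_morphism : ∀ r x h g, R.tgt r = P.proj x →
    chi (P.act (P.smul r x) h) g = R.mul (R.mul r (chi x (X.j h g))) (R.inv r)
  act_rho : ∀ x g, P.act x (X.ρ g) = P.smul (chi x g) x

namespace Extension

variable {IN} {X : LieCrossedModule IG G IH H}

/-! The pull-back `(q ∘ p, R[p] → N[q ∘ p], p^*P → M', χ[p])` of an extension along `p : M' → M`: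
the underlying subsets of products, and the operations on them. -/

section Pullback

variable (E : Extension IN N X) {M' : SmoothMfd.{u}} (p : M' → E.base)

/-- `R[p] = M' ×_M R ×_M M'`. -/
def pullArrows : Set (M' × E.R.arrows × M') :=
  {z | E.R.src z.2.1 = p z.1 ∧ E.R.tgt z.2.1 = p z.2.2}

/-- `(x, r, y) • (y, r', z) = (x, r r', z)`. -/
def pullMul (z w : M' × E.R.arrows × M') : M' × E.R.arrows × M' :=
  (z.1, E.R.mul z.2.1 w.2.1, w.2.2)

/-- `p^*P = P ×_M M'`. -/
def pullTotal : Set (E.P.total × M') := {w | E.P.proj w.1 = p w.2}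

/-- `(n, r, n') • (x, n') = (r • x, n)`. -/
def pullSmul (z : M' × E.R.arrows × M') (w : E.P.total × M') : E.P.total × M' :=
  (E.P.smul z.2.1 w.1, z.1)

/-- `(x, n) • h = (x • h, n)`. -/
def pullAct (w : E.P.total × M') (h : H) : E.P.total × M' := (E.P.act w.1 h, w.2)

/-- `χ[p](x, n)(g) = (n, χ(x)(g), n)`. -/
def pullChi (w : E.P.total × M') (g : G) : M' × E.R.arrows × M' := (w.2, E.chi w.1 g, w.2)

end Pullback

/-- The pull-backs of `E` along `p : M' → M` and of `E'` along `p' : M' → M₁` are isomorphic as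
`G → H`-extensions of `N[q ∘ p] = N[q' ∘ p']`, by an isomorphism `(Φ, Ψ)` (over the identity
of `N[q ∘ p]`, `M'` and `H`). -/
def PullbackIsomorphic (E E' : Extension IN N X) {M' : SmoothMfd.{u}} (p : M' → E.base)
    (p' : M' → E'.base) : Prop :=
  ∃ (Φ : PartialEquiv (M' × E.R.arrows × M') (M' × E'.R.arrows × M'))
    (Ψ : PartialEquiv (E.P.total × M') (E'.P.total × M')),
    Φ.source = E.pullArrows p ∧ Φ.target = E'.pullArrows p' ∧
    ContMDiffOn (M'.model.prod (E.R.arrows.model.prod M'.model))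
      (M'.model.prod (E'.R.arrows.model.prod M'.model)) ∞ Φ Φ.source ∧
    ContMDiffOn (M'.model.prod (E'.R.arrows.model.prod M'.model))
      (M'.model.prod (E.R.arrows.model.prod M'.model)) ∞ Φ.symm Φ.target ∧
    (∀ z ∈ Φ.source, (Φ z).1 = z.1 ∧ (Φ z).2.2 = z.2.2) ∧
    (∀ z ∈ Φ.source, ∀ w ∈ Φ.source, z.2.2 = w.1 →
      Φ (E.pullMul z w) = E'.pullMul (Φ z) (Φ w)) ∧
    Ψ.source = E.pullTotal p ∧ Ψ.target = E'.pullTotal p' ∧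
    ContMDiffOn (E.P.total.model.prod M'.model) (E'.P.total.model.prod M'.model) ∞ Ψ Ψ.source ∧
    ContMDiffOn (E'.P.total.model.prod M'.model) (E.P.total.model.prod M'.model) ∞
      Ψ.symm Ψ.target ∧
    (∀ w ∈ Ψ.source, (Ψ w).2 = w.2) ∧
    (∀ z ∈ Φ.source, ∀ w ∈ Ψ.source, ∀ h : H, z.2.2 = w.2 →
      Ψ (E.pullAct (E.pullSmul z w) h) = E'.pullAct (E'.pullSmul (Φ z) (Ψ w)) h) ∧
    (∀ w ∈ Ψ.source, ∀ g : G, E'.pullChi (Ψ w) g = Φ (E.pullChi w g))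

/-- Morita equivalence over the identity of `N ⇉ N`. -/
def MoritaEquivalent (E E' : Extension IN N X) : Prop :=
  ∃ (M' : SmoothMfd.{u}) (p : M' → E.base) (p' : M' → E'.base),
    Function.Surjective p ∧ Manifold.IsSubmersion M'.model E.base.model ∞ p ∧
    Function.Surjective p' ∧ Manifold.IsSubmersion M'.model E'.base.model ∞ p' ∧
    (∀ x, E.q (p x) = E'.q (p' x)) ∧ PullbackIsomorphic E E' p p'

end Extension

variable (N) in
/-- `G → H`-gerbes over `N ⇉ N`: extensions up to Morita equivalence. -/
def Gerbe (X : LieCrossedModule IG G IH H) : Type (u + 1) :=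
  Quot (Extension.MoritaEquivalent : Extension IN N X → Extension IN N X → Prop)

variable {IN} in
/-- The gerbe defined by an extension. -/
def Extension.gerbe {X : LieCrossedModule IG G IH H} (E : Extension IN N X) :
    Gerbe IN N X := Quot.mk _ E

/-- A non-Abelian `1`-cocycle `(λ, 𝐠)` with respect to the open cover `U`: families of
smooth maps `lam i j : U i ∩ U j → H` and `gg i j k : U i ∩ U j ∩ U k → G` (their values elsewhere
are irrelevant). -/
structure Cocycle (X : LieCrossedModule IG G IH H) {ι : Type u} (U : ι → Opens N) where
  lam : ι → ι → N → H
  gg : ι → ι → ι → N → G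
  lam_smooth : ∀ i j, ContMDiffOn IN IH ∞ (lam i j) (U i ∩ U j)
  gg_smooth : ∀ i j k, ContMDiffOn IN IG ∞ (gg i j k) (U i ∩ U j ∩ U k)
  rho_gg : ∀ i j k, ∀ x ∈ (U i ∩ U j ∩ U k : Set N),
    X.ρ (gg i j k x) * lam i k x = lam i j x * lam j k x
  gg_gg : ∀ i j k l, ∀ x ∈ (U i ∩ U j ∩ U k ∩ U l : Set N),
    gg i j k x * gg i k l x = X.j (lam i j x) (gg j k l x) * gg i j l x
  gg_self : ∀ i j, ∀ x ∈ (U i ∩ U j : Set N), gg i i j x = 1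

namespace Cocycle

variable {IN} {X : LieCrossedModule IG G IH H} {ι κ : Type u} {U : ι → Opens N}
  {V : κ → Opens N}

/-- The pull-back of a cocycle along a refinement `(V, σ)` of `U`. -/
def pullback (c : Cocycle IN X U) (σ : κ → ι) (hσ : ∀ k, V k ≤ U (σ k)) : Cocycle IN X V where
  lam i j := c.lam (σ i) (σ j)
  gg i j k := c.gg (σ i) (σ j) (σ k)
  lam_smooth _ _ := (c.lam_smooth _ _).mono fun _ hx => ⟨hσ _ hx.1, hσ _ hx.2⟩
  gg_smooth _ _ _ := (c.gg_smooth _ _ _).mono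
    fun _ hx => ⟨⟨hσ _ hx.1.1, hσ _ hx.1.2⟩, hσ _ hx.2⟩
  rho_gg _ _ _ x hx := c.rho_gg _ _ _ x ⟨⟨hσ _ hx.1.1, hσ _ hx.1.2⟩, hσ _ hx.2⟩
  gg_gg _ _ _ _ x hx := c.gg_gg _ _ _ _ x
    ⟨⟨⟨hσ _ hx.1.1.1, hσ _ hx.1.1.2⟩, hσ _ hx.1.2⟩, hσ _ hx.2⟩
  gg_self _ _ x hx := c.gg_self _ _ x ⟨hσ _ hx.1, hσ _ hx.2⟩

/-- Some `1`-coboundary `(r, v)`, with `r i : U i → H` and `v i j : U i ∩ U j → G`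
smooth, relates the cocycles `c` and `c'`. -/
def Related (c c' : Cocycle IN X U) : Prop :=
  ∃ (r : ι → N → H) (v : ι → ι → N → G),
    (∀ i, ContMDiffOn IN IH ∞ (r i) (U i)) ∧
    (∀ i j, ContMDiffOn IN IG ∞ (v i j) (U i ∩ U j)) ∧
    (∀ i j, ∀ x ∈ (U i ∩ U j : Set N),
      c'.lam i j x = X.ρ (v i j x) * r i x * c.lam i j x * (r j x)⁻¹) ∧
    (∀ i j k, ∀ x ∈ (U i ∩ U j ∩ U k : Set N),
      c'.gg i j k x * v i k x =
        X.j (c'.lam i j x) (v j k x) * v i j x * X.j (r i x) (c.gg i j k x))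

end Cocycle

variable (N) in
/-- A cocycle together with the open cover of `N` on which it is defined. -/
structure CoverCocycle (X : LieCrossedModule IG G IH H) : Type (u + 1) where
  ι : Type u
  U : ι → Opens N
  isOpenCover : IsOpenCover U
  cocycle : Cocycle IN X U

variable {IN} in
/-- Two cocycles, on two covers of `N`, become related by a coboundary after pull-back to some
common refinement. -/
def CoverCocycle.Cohomologous {X : LieCrossedModule IG G IH H}
    (c c' : CoverCocycle IN N X) : Prop :=
  ∃ (κ : Type u) (V : κ → Opens N) (σ : κ → c.ι) (σ' : κ → c'.ι)
    (hσ : ∀ k, V k ≤ c.U (σ k)) (hσ' : ∀ k, V k ≤ c'.U (σ' k)),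
    IsOpenCover V ∧ (c.cocycle.pullback σ hσ).Related (c'.cocycle.pullback σ' hσ')

variable (N) in
/-- The `G → H`-valued non-Abelian `1`-cohomology of `N`. -/
def NonabelianH1 (X : LieCrossedModule IG G IH H) : Type (u + 1) :=
  Quot (CoverCocycle.Cohomologous : CoverCocycle IN N X → CoverCocycle IN N X → Prop)

variable {IN} in
/-- The cohomology class of a cocycle. -/
def CoverCocycle.cohomologyClass {X : LieCrossedModule IG G IH H} (c : CoverCocycle IN N X) :
    NonabelianH1 IN N X := Quot.mk _ c

variable {IN} in
/-- An identification of the extension `E` with the adapted extension of the Čech groupoid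
`N[U]` given by the cocycle `c = (λ, 𝐠)`: of its base with `∐ U i` over `N`, of `R` with
`G × ∐ U i ∩ U j` and of `P` with `∐ U i × H`. Write `x_i = pt i x`, `(g, x_ij) = arr i j (g, x)`
and `(x_i, h) = tot i (x, h)`; the structure maps are
`(g, x_ij) • (g', x_jk) = (g λ_ij(g') 𝐠_ijk, x_ik)`, `(g, x_ij) • (x_j, h) = (x_i, ρ(g) λ_ij h)`,
`(x_i, h) • h' = (x_i, h h')` and `χ(x_i, h)(g) = (h(g), x_ii)`. -/
structure AdaptedIdentification {X : LieCrossedModule IG G IH H} (c : CoverCocycle IN N X)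
    (E : Extension IN N X) where
  pt : c.ι → PartialEquiv N E.base
  arr : c.ι → c.ι → PartialEquiv (G × N) E.R.arrows
  tot : c.ι → PartialEquiv (N × H) E.P.total
  pt_source : ∀ i, (pt i).source = c.U i
  pt_target_open : ∀ i, IsOpen (pt i).target
  pt_target_partition : ∀ m, ∃! i, m ∈ (pt i).target
  pt_smooth : ∀ i, ContMDiffOn IN E.base.model ∞ (pt i) (pt i).source
  pt_symm_smooth : ∀ i, ContMDiffOn E.base.model IN ∞ (pt i).symm (pt i).target
  q_pt : ∀ i, ∀ x ∈ c.U i, E.q (pt i x) = x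
  arr_source : ∀ i j, (arr i j).source = univ ×ˢ (c.U i ∩ c.U j : Set N)
  arr_target : ∀ i j, (arr i j).target =
    {r | E.R.src r ∈ (pt i).target ∧ E.R.tgt r ∈ (pt j).target}
  arr_smooth : ∀ i j, ContMDiffOn (IG.prod IN) E.R.arrows.model ∞ (arr i j) (arr i j).source
  arr_symm_smooth : ∀ i j,
    ContMDiffOn E.R.arrows.model (IG.prod IN) ∞ (arr i j).symm (arr i j).target
  src_arr : ∀ i j g, ∀ x ∈ (c.U i ∩ c.U j : Set N), E.R.src (arr i j (g, x)) = pt i x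
  tgt_arr : ∀ i j g, ∀ x ∈ (c.U i ∩ c.U j : Set N), E.R.tgt (arr i j (g, x)) = pt j x
  arr_mul : ∀ i j k g g', ∀ x ∈ (c.U i ∩ c.U j ∩ c.U k : Set N),
    E.R.mul (arr i j (g, x)) (arr j k (g', x)) =
      arr i k (g * X.j (c.cocycle.lam i j x) g' * c.cocycle.gg i j k x, x)
  tot_source : ∀ i, (tot i).source = (c.U i : Set N) ×ˢ univ
  tot_target : ∀ i, (tot i).target = E.P.proj ⁻¹' (pt i).target
  tot_smooth : ∀ i, ContMDiffOn (IN.prod IH) E.P.total.model ∞ (tot i) (tot i).source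
  tot_symm_smooth : ∀ i, ContMDiffOn E.P.total.model (IN.prod IH) ∞ (tot i).symm (tot i).target
  proj_tot : ∀ i h, ∀ x ∈ c.U i, E.P.proj (tot i (x, h)) = pt i x
  tot_act : ∀ i h h', ∀ x ∈ c.U i, E.P.act (tot i (x, h)) h' = tot i (x, h * h')
  arr_smul : ∀ i j g h, ∀ x ∈ (c.U i ∩ c.U j : Set N),
    E.P.smul (arr i j (g, x)) (tot j (x, h)) = tot i (x, X.ρ g * c.cocycle.lam i j x * h)
  chi_tot : ∀ i h g, ∀ x ∈ c.U i, E.chi (tot i (x, h)) g = arr i i (X.j h g, x)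

variable {IN} in
/-- `E` is (a copy of) the adapted extension of the Čech groupoid defined by the cocycle `c`. -/
def Extension.IsAdaptedTo {X : LieCrossedModule IG G IH H} (E : Extension IN N X)
    (c : CoverCocycle IN N X) : Prop :=
  Nonempty (AdaptedIdentification c E)

end Groups

end CrossedGerbe

/-! The two sides are compared by choosing frames. Given an extension, choose sections `s i : U i →
P` over `N`, and arrows `a i j` of `R` joining the point under `s i` to the point under `s j`. The
group `H` acts simply transitively on the fibres of `P`, so `a_ij • s_j = s_i • λ_ij` for a unique
`λ_ij`; `χ(s_i)` identifies `G` with the isotropy group, so `a_ij a_jk = χ(s_i)(𝐠_ijk) a_ik` for a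
unique `𝐠_ijk`. The compatibility of products with the action and the associativity of `R` are then
the cocycle identities. `LocalData E c` records frames of `E` with cocycle `c`, and the theorem is a
set of statements about it.

Existence (`Extension.exists_localData`): every extension has local data. Arrows `a_ij` exist at
first only near each point of `U i ∩ U j`; paracompactness gives a refinement on which they exist on
whole double intersections (`exists_refinement_of_local_on_inter`).

Uniqueness (`CoverCocycle.cohomologous_of_localData`): two frames of one extension differ by
elements of `H` on sections and of `G` on arrows, once the base points have been made equal by
moving along arrows; these elements form a coboundary. Conversely a coboundary changes frames
(`LocalData.exists_of_related`).

Morita invariance (`LocalData.exists_of_moritaEquivalent`): after refinement, frames lift to the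
common pull-back, cross the isomorphism and descend.

Recognition (`LocalData.moritaEquivalent`): relative to frames, each arrow is uniquely `χ(s_i)(g)
a_ij`, and all structure maps in the coordinate `g` are given by the cocycle alone
(`Extension.mul_normal_form`). Hence an extension with local data for `c` becomes isomorphic to the
adapted extension of `c` on a suitable common pull-back.

The adapted extension has the frames `s_i = (x_i, 1)`, `a_ij = (1, x_ij)`, so the passages between
cocycles and extensions are inverse to each other. -/

namespace CrossedGerbe

open Filter Topology Manifold

set_option linter.unusedSectionVars false

/-! ### Submersions: local sections and invariance under local diffeomorphisms -/

section Submersion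

variable {E H E' H' F E₁ H₁ : Type*}
  [NormedAddCommGroup E] [NormedSpace ℝ E] [TopologicalSpace H] {I : ModelWithCorners ℝ E H}
  [NormedAddCommGroup E'] [NormedSpace ℝ E'] [TopologicalSpace H'] {J : ModelWithCorners ℝ E' H'}
  [NormedAddCommGroup E₁] [NormedSpace ℝ E₁] [TopologicalSpace H₁] {I₁ : ModelWithCorners ℝ E₁ H₁}
  [NormedAddCommGroup F] [NormedSpace ℝ F]
  {M N M₁ : Type*} [TopologicalSpace M] [ChartedSpace H M] [TopologicalSpace N] [ChartedSpace H' N]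
  [TopologicalSpace M₁] [ChartedSpace H₁ M₁]

/-- A submersion has a smooth local section through every point. -/
theorem exists_local_section_of_isSubmersionAt [I.Boundaryless] {f : M → N} {x : M}
    (h : IsSubmersionAt I J ∞ f x) :
    ∃ (V : Set N) (s : N → M), IsOpen V ∧ f x ∈ V ∧ s (f x) = x ∧ ContMDiffOn J I ∞ s V ∧
      ∀ y ∈ V, f (s y) = y := by
  set φ := h.domChart.extend I
  set ψ := h.codChart.extend J
  -- In the charts `f` is a linear projection. Freezing the complementary coordinate at its value at
  -- `x` gives a section through `x`.
  set c := (h.equiv (φ x)).2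
  set g : N → E := fun y => h.equiv.symm (ψ y, c)
  have hx : x ∈ φ.source := by simpa [φ] using h.mem_domChart_source
  have hfx : f x ∈ h.codChart.source := h.mem_codChart_source
  have hw : ∀ e ∈ φ.target, ψ (f (φ.symm e)) = (h.equiv e).1 := fun e he => h.writtenInCharts he
  have hgx : g (f x) = φ x := by
    have := hw (φ x) (φ.map_source hx)
    rw [φ.left_inv hx] at this
    simp [g, c, this]
  have hg : ContMDiffOn J 𝓘(ℝ, E) ∞ g h.codChart.source := by
    have h1 : ContMDiffOn J 𝓘(ℝ, E') ∞ ψ h.codChart.source :=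
      h.codChart.contMDiffOn_extend h.codChart_mem_maximalAtlas
    have h2 : ContDiff ℝ ∞ fun v : E' => h.equiv.symm (v, c) :=
      h.equiv.symm.contDiff.comp (contDiff_id.prodMk contDiff_const)
    exact h2.contMDiff.comp_contMDiffOn h1
  -- Without boundary, the target of an extended chart is open in the model vector space.
  have hopen : IsOpen φ.target := by
    simp only [φ, h.domChart.extend_target, I.range_eq_univ, inter_univ]
    exact h.domChart.open_target.preimage I.continuous_symm
  refine ⟨h.codChart.source ∩ g ⁻¹' φ.target, φ.symm ∘ g,
    hg.continuousOn.isOpen_inter_preimage h.codChart.open_source hopen,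
    ⟨hfx, by simpa [hgx] using φ.map_source hx⟩, by simp [hgx, φ.left_inv hx], ?_, ?_⟩
  · have h1 : ContMDiffOn 𝓘(ℝ, E) I ∞ φ.symm φ.target := by
      have := contMDiffOn_extend_symm (I := I) h.domChart_mem_maximalAtlas
      rwa [← h.domChart.extend_target'] at this
    exact h1.comp (hg.mono inter_subset_left) fun y hy => hy.2
  · rintro y ⟨hy, hgy⟩
    have h1 := hw (g y) hgy
    have h2 : f (φ.symm (g y)) ∈ ψ.source := by
      rw [h.codChart.extend_source]
      refine h.source_subset_preimage_source ?_
      have := φ.map_target hgy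
      rwa [h.domChart.extend_source] at this
    have h3 : y ∈ ψ.source := by rwa [h.codChart.extend_source]
    refine ψ.injOn h2 h3 ?_
    rw [h1]; simp [g]

/-- The transition between the model spaces of two boundaryless models with isomorphic model
vector spaces. -/
noncomputable def modelHomeomorph (I : ModelWithCorners ℝ E H) [I.Boundaryless]
    (I₁ : ModelWithCorners ℝ E₁ H₁) [I₁.Boundaryless] (L : E ≃L[ℝ] E₁) : H ≃ₜ H₁ :=
  (I.toHomeomorph.trans L.toHomeomorph).trans I₁.toHomeomorph.symm

theorem contMDiff_modelHomeomorph [I.Boundaryless] [I₁.Boundaryless] (L : E ≃L[ℝ] E₁) :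
    ContMDiff I I₁ ∞ (modelHomeomorph I I₁ L) := by
  have h1 : ContMDiff 𝓘(ℝ, E₁) I₁ ∞ I₁.symm := by
    have := I₁.contMDiffOn_symm (n := ∞)
    rwa [I₁.range_eq_univ, contMDiffOn_univ] at this
  exact h1.comp (L.contDiff.contMDiff.comp I.contMDiff)

theorem contMDiff_modelHomeomorph_symm [I.Boundaryless] [I₁.Boundaryless] (L : E ≃L[ℝ] E₁) :
    ContMDiff I₁ I ∞ (modelHomeomorph I I₁ L).symm := by
  have h1 : ContMDiff 𝓘(ℝ, E) I ∞ I.symm := by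
    have := I.contMDiffOn_symm (n := ∞)
    rwa [I.range_eq_univ, contMDiffOn_univ] at this
  exact h1.comp (L.symm.contDiff.contMDiff.comp I₁.contMDiff)

/-- The chart of `M₁` obtained from a chart of `M` and a partial diffeomorphism `e`. -/
noncomputable def pullChart [I.Boundaryless] [I₁.Boundaryless] (e : OpenPartialHomeomorph M₁ M)
    (L : E ≃L[ℝ] E₁) (φ : OpenPartialHomeomorph M H) : OpenPartialHomeomorph M₁ H₁ :=
  (e.trans φ).trans (modelHomeomorph I I₁ L).toOpenPartialHomeomorph

/-- A chart lies in the maximal atlas as soon as it and its inverse are smooth; here both are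
compositions of smooth maps. -/
theorem pullChart_mem_maximalAtlas [I.Boundaryless] [I₁.Boundaryless] [IsManifold I₁ ∞ M₁]
    (e : OpenPartialHomeomorph M₁ M) (he : ContMDiffOn I₁ I ∞ e e.source)
    (he' : ContMDiffOn I I₁ ∞ e.symm e.target) (L : E ≃L[ℝ] E₁)
    {φ : OpenPartialHomeomorph M H} (hφ : φ ∈ IsManifold.maximalAtlas I ∞ M) :
    pullChart (I := I) (I₁ := I₁) e L φ ∈ IsManifold.maximalAtlas I₁ ∞ M₁ := by
  refine OpenPartialHomeomorph.mem_maximalAtlas_of_contMDiffOn _ ?_ ?_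
  · refine (contMDiff_modelHomeomorph L).comp_contMDiffOn
      ((contMDiffOn_of_mem_maximalAtlas hφ).comp (he.mono ?_) ?_)
    · intro x hx; simp [pullChart] at hx; exact hx.1
    · intro x hx; simp [pullChart] at hx; exact hx.2
  · refine he'.comp ((contMDiffOn_symm_of_mem_maximalAtlas hφ).comp
      (contMDiff_modelHomeomorph_symm L).contMDiffOn ?_) ?_
    · intro x hx; simp [pullChart] at hx; exact hx.1
    · intro x hx; simp [pullChart] at hx; exact hx.2

theorem pullChart_extend [I.Boundaryless] [I₁.Boundaryless] (e : OpenPartialHomeomorph M₁ M)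
    (L : E ≃L[ℝ] E₁) (φ : OpenPartialHomeomorph M H) (x : M₁) :
    (pullChart (I := I) (I₁ := I₁) e L φ).extend I₁ x = L (φ.extend I (e x)) := by
  have : I₁ (I₁.symm (L (I (φ (e x))))) = L (I (φ (e x))) :=
    I₁.right_inv (by rw [I₁.range_eq_univ]; trivial)
  exact this

theorem pullChart_extend_symm [I.Boundaryless] [I₁.Boundaryless] (e : OpenPartialHomeomorph M₁ M)
    (L : E ≃L[ℝ] E₁) (φ : OpenPartialHomeomorph M H) (v : E₁) :
    ((pullChart (I := I) (I₁ := I₁) e L φ).extend I₁).symm v =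
      e.symm ((φ.extend I).symm (L.symm v)) := by
  have : I₁ (I₁.symm v) = v := I₁.right_inv (by rw [I₁.range_eq_univ]; trivial)
  change e.symm (φ.symm (I.symm (L.symm (I₁ (I₁.symm v))))) = _
  rw [this]; rfl

theorem mem_pullChart_extend_target [I.Boundaryless] [I₁.Boundaryless]
    {e : OpenPartialHomeomorph M₁ M} {L : E ≃L[ℝ] E₁} {φ : OpenPartialHomeomorph M H} {v : E₁}
    (hv : v ∈ ((pullChart (I := I) (I₁ := I₁) e L φ).extend I₁).target) :
    L.symm v ∈ (φ.extend I).target ∧ (φ.extend I).symm (L.symm v) ∈ e.target := by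
  have : I₁ (I₁.symm v) = v := I₁.right_inv (by rw [I₁.range_eq_univ]; trivial)
  rw [OpenPartialHomeomorph.extend_target] at hv
  have h := hv.1
  simp only [pullChart, OpenPartialHomeomorph.trans_target, mem_preimage, mem_inter_iff,
    Homeomorph.toOpenPartialHomeomorph_target, mem_univ, true_and] at h
  have h' : (modelHomeomorph I I₁ L).symm (I₁.symm v) = I.symm (L.symm v) := by
    change I.symm (L.symm (I₁ (I₁.symm v))) = _
    rw [this]
  have h2 : (modelHomeomorph I I₁ L).toOpenPartialHomeomorph.symm (I₁.symm v)
    = I.symm (L.symm v) := h'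
  rw [h2] at h
  exact ⟨by rw [OpenPartialHomeomorph.extend_target, I.range_eq_univ]; exact ⟨h.1, trivial⟩, h.2⟩

/-- The composition of a local diffeomorphism and a submersion is a submersion. -/
theorem isSubmersionAtOfComplement_comp_partialDiffeo [I.Boundaryless] [I₁.Boundaryless]
    [IsManifold I₁ ∞ M₁] {f : M → N} {x : M₁}
    (e : OpenPartialHomeomorph M₁ M) (he : ContMDiffOn I₁ I ∞ e e.source)
    (he' : ContMDiffOn I I₁ ∞ e.symm e.target) (L : E ≃L[ℝ] E₁) (hx : x ∈ e.source)
    (h : IsSubmersionAtOfComplement F I J ∞ f (e x)) :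
    IsSubmersionAtOfComplement F I₁ J ∞ (f ∘ e) x := by
  -- In the transported chart, `f ∘ e` has the coordinate expression of `f` precomposed with
  -- `L.symm`, so the complement `F` is unchanged.
  refine IsSubmersionAtOfComplement.mk_of_continuousAt
    (h.contMDiffAt.continuousAt.comp (e.continuousAt hx)) (L.symm.trans h.equiv)
    (pullChart (I := I) (I₁ := I₁) e L h.domChart) h.codChart ?_ h.mem_codChart_source
    (pullChart_mem_maximalAtlas e he he' L h.domChart_mem_maximalAtlas)
    h.codChart_mem_maximalAtlas ?_
  · simpa [pullChart, hx] using h.mem_domChart_source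
  · intro v hv
    obtain ⟨h1, h2⟩ := mem_pullChart_extend_target hv
    have := h.writtenInCharts h1
    simp only [Function.comp_apply] at this ⊢
    rw [pullChart_extend_symm, e.right_inv h2, this]
    rfl

/-- A continuous map is a submersion if its composition with a local diffeomorphism is. -/
theorem isSubmersionAtOfComplement_of_partialDiffeo_comp {E₂ H₂ N₁ : Type*}
    [NormedAddCommGroup E₂] [NormedSpace ℝ E₂] [TopologicalSpace H₂] {J₁ : ModelWithCorners ℝ E₂ H₂}
    [TopologicalSpace N₁] [ChartedSpace H₂ N₁] [J.Boundaryless] [J₁.Boundaryless]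
    [IsManifold J₁ ∞ N₁] {f : M → N₁} {x : M} (hf : ContinuousAt f x)
    (e : OpenPartialHomeomorph N₁ N) (he : ContMDiffOn J₁ J ∞ e e.source)
    (he' : ContMDiffOn J J₁ ∞ e.symm e.target) (L : E' ≃L[ℝ] E₂) (hx : f x ∈ e.source)
    (h : IsSubmersionAtOfComplement F I J ∞ (e ∘ f) x) :
    IsSubmersionAtOfComplement F I J₁ ∞ f x := by
  refine IsSubmersionAtOfComplement.mk_of_continuousAt hf
    (h.equiv.trans (L.prodCongr (ContinuousLinearEquiv.refl ℝ F)))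
    h.domChart (pullChart (I := J) (I₁ := J₁) e L h.codChart) h.mem_domChart_source ?_
    h.domChart_mem_maximalAtlas
    (pullChart_mem_maximalAtlas e he he' L h.codChart_mem_maximalAtlas) ?_
  · simpa [pullChart, hx] using h.mem_codChart_source
  · intro v hv
    have := h.writtenInCharts hv
    simp only [Function.comp_apply] at this ⊢
    rw [pullChart_extend, this]
    simp

/-- The projection of a product is a submersion. -/
theorem isSubmersionOfComplement_fst [IsManifold I ∞ M] [IsManifold J ∞ N] :
    IsSubmersionOfComplement E' (I.prod J) I ∞ (Prod.fst : M × N → M) := by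
  rintro ⟨x, y⟩
  refine IsSubmersionAtOfComplement.mk_of_continuousAt continuous_fst.continuousAt
    (ContinuousLinearEquiv.refl ℝ _) ((chartAt H x).prod (chartAt H' y)) (chartAt H x)
    (by simp) (by simp) (IsManifold.mem_maximalAtlas_prod (IsManifold.chart_mem_maximalAtlas x)
      (IsManifold.chart_mem_maximalAtlas y)) (IsManifold.chart_mem_maximalAtlas x) ?_
  rw [OpenPartialHomeomorph.extend_prod]
  rintro ⟨v, w⟩ hv
  have : v ∈ ((chartAt H x).extend I).target := hv.1
  exact ((chartAt H x).extend I).right_inv this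

end Submersion

/-! ### Refinement of covers adapted to double intersections -/

/-- In a paracompact Hausdorff space, an open cover such that a property of subsets holds locally
on the intersections of its members has a refinement on the intersections of whose members the
property holds. -/
theorem exists_refinement_of_local_on_inter {N ι : Type*} [TopologicalSpace N] [T2Space N]
    [ParacompactSpace N] {U : ι → Opens N} (hU : IsOpenCover U) (Good : ι → ι → Set N → Prop)
    (mono : ∀ i j s t, s ⊆ t → Good i j t → Good i j s)
    (local_good : ∀ i j, ∀ x ∈ (U i ∩ U j : Set N), ∃ V, IsOpen V ∧ x ∈ V ∧ Good i j V) :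
    ∃ (V : N → Opens N) (σ : N → ι), (∀ x, x ∈ V x) ∧ (∀ x, V x ≤ U (σ x)) ∧
      ∀ x y, ((V x : Set N) ∩ V y).Nonempty → Good (σ x) (σ y) (V x ∩ V y) := by
  -- Two shrinkings: `closure (v i) ⊆ u i ⊆ U i` with `u` locally finite. The gap between `v` and
  -- `u` leaves, near each point, finitely many conditions, each of which is met or vacuous.
  obtain ⟨u, uo, uc, uf, uU⟩ := precise_refinement (fun i => (U i : Set N)) (fun i => (U i).2)
    hU.iSup_set_eq_univ
  obtain ⟨v, vc, vo, vu⟩ := exists_iUnion_eq_closure_subset uo uf.point_finite uc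
  have hσ : ∀ x, ∃ i, x ∈ v i := fun x => by simpa using (vc ▸ mem_univ x : x ∈ ⋃ i, v i)
  choose σ hσ using hσ
  have key : ∀ x, ∃ V : Set N, IsOpen V ∧ x ∈ V ∧ V ⊆ v (σ x) ∧
      ∀ i, (V ∩ v i).Nonempty → Good (σ x) i V := by
    intro x
    obtain ⟨T, hT, hfin⟩ := uf x
    have h1 : ∀ᶠ s in (𝓝 x).smallSets, ∀ i ∈ {i | (u i ∩ T).Nonempty},
        (s ∩ v i).Nonempty → Good (σ x) i s := by
      refine (eventually_all_finite hfin).2 fun i _ => ?_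
      -- A point of `closure (v i)` lies in `U i`, where `local_good` applies; any other point has a
      -- neighbourhood missing `v i`.
      by_cases hx : x ∈ closure (v i)
      · obtain ⟨V, hV, hxV, hgood⟩ := local_good (σ x) i x
          ⟨uU _ (vu _ (subset_closure (hσ x))), uU _ (vu _ hx)⟩
        exact eventually_smallSets.2 ⟨V, hV.mem_nhds hxV, fun t ht _ => mono _ _ _ _ ht hgood⟩
      · refine eventually_smallSets.2 ⟨(closure (v i))ᶜ,
          isClosed_closure.isOpen_compl.mem_nhds hx, fun t ht hne => ?_⟩
        obtain ⟨y, hy, hyv⟩ := hne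
        exact absurd (subset_closure hyv) (ht hy)
    obtain ⟨s, hs, hs'⟩ := eventually_smallSets.1 h1
    obtain ⟨V, hV, hVo, hxV⟩ := mem_nhds_iff.1
      (inter_mem (inter_mem hs hT) ((vo (σ x)).mem_nhds (hσ x)))
    refine ⟨V, hVo, hxV, fun y hy => (hV hy).2, fun i hi => hs' V (fun y hy => (hV hy).1.1) i ?_ hi⟩
    obtain ⟨y, hy, hyv⟩ := hi
    exact ⟨y, vu i (subset_closure hyv), (hV hy).1.2⟩
  choose V hVo hxV hVv hgood using key
  refine ⟨fun x => ⟨V x, hVo x⟩, σ, hxV, fun x y hy => uU _ (vu _ (subset_closure (hVv x hy))),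
    fun x y hne => mono _ _ _ _ inter_subset_left (hgood x (σ y) ?_)⟩
  -- Since `V y ⊆ v (σ y)`, a set `V x` that meets `V y` also meets `v (σ y)`, so it is good for `σ
  -- y`.
  exact hne.mono (inter_subset_inter_right _ (hVv y))

/-! ### Locally constant indices -/

section LocConst

variable {Z Z' D D' : Type*} [TopologicalSpace Z] [TopologicalSpace Z']

/-- The function `d` is locally constant on `s`. -/
def LocConstOn (d : Z → D) (s : Set Z) : Prop := ∀ z ∈ s, ∀ᶠ z' in 𝓝[s] z, d z' = d z

theorem LocConstOn.comp {d : Z' → D} {t : Set Z'} (hd : LocConstOn d t) {f : Z → Z'} {s : Set Z}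
    (hf : ContinuousOn f s) (hst : MapsTo f s t) : LocConstOn (fun z => d (f z)) s := fun z hz =>
  (tendsto_nhdsWithin_iff.2 ⟨hf z hz, eventually_mem_nhdsWithin.mono fun _ h => hst h⟩).eventually
    (hd (f z) (hst hz))

theorem LocConstOn.prodMk {d : Z → D} {d' : Z → D'} {s : Set Z} (h : LocConstOn d s)
    (h' : LocConstOn d' s) : LocConstOn (fun z => (d z, d' z)) s := fun z hz => by
  filter_upwards [h z hz, h' z hz] with z' h1 h2
  rw [h1, h2]

theorem LocConstOn.map {d : Z → D} {s : Set Z} (h : LocConstOn d s) (f : D → D') :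
    LocConstOn (fun z => f (d z)) s := fun z hz => (h z hz).mono fun _ h => congrArg f h

theorem LocConstOn.congr {d d' : Z → D} {s : Set Z} (h : LocConstOn d s) (h' : EqOn d' d s) :
    LocConstOn d' s := fun z hz => by
  filter_upwards [h z hz, self_mem_nhdsWithin] with z' h1 h2
  rw [h' hz, h' h2, h1]

theorem LocConstOn.of_subset_fibre {d : Z → D} {s : Set Z} {k : D} (h : ∀ z ∈ s, d z = k) :
    LocConstOn d s := fun z hz => by
  filter_upwards [self_mem_nhdsWithin] with z' h2
  rw [h z hz, h z' h2]

variable {E H E' H' : Type*}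
  [NormedAddCommGroup E] [NormedSpace ℝ E] [TopologicalSpace H] {I : ModelWithCorners ℝ E H}
  [NormedAddCommGroup E'] [NormedSpace ℝ E'] [TopologicalSpace H'] {J : ModelWithCorners ℝ E' H'}
  [ChartedSpace H Z] [ChartedSpace H' Z']

/-- Smoothness may be checked with a locally constant index kept fixed. -/
theorem LocConstOn.contMDiffOn {d : Z → D} {s : Set Z} (hd : LocConstOn d s) {f : Z → Z'}
    (hf : ∀ k, ContMDiffOn I J ∞ f (s ∩ {z | d z = k})) : ContMDiffOn I J ∞ f s := fun z hz =>
  (hf (d z) z ⟨hz, rfl⟩).mono_of_mem_nhdsWithin (inter_mem self_mem_nhdsWithin (hd z hz))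

end LocConst

/-! ### Disjoint unions of open sets as manifolds -/

section Sheets

/-- A set, considered as a discrete space. -/
def DiscreteIndex (κ : Type u) : Type u := κ

instance (κ : Type u) : TopologicalSpace (DiscreteIndex κ) := ⊥

instance (κ : Type u) : DiscreteTopology (DiscreteIndex κ) := ⟨rfl⟩

/-- The index set is a manifold modelled on the zero space, so `∐ W k` becomes an open submanifold
of a product. Its model vector space is `E × PUnit` instead of `E`, whence the changes of model in
the results on submersions. -/
noncomputable instance (κ : Type u) : ChartedSpace PUnit.{1} (DiscreteIndex κ) :=
  ChartedSpace.ofDiscreteTopology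

instance (κ : Type u) : IsManifold 𝓘(ℝ, PUnit.{1}) ∞ (DiscreteIndex κ) :=
  IsManifold.of_discreteTopology ∞

variable {E H : Type} [NormedAddCommGroup E] [NormedSpace ℝ E] [FiniteDimensional ℝ E]
  [TopologicalSpace H] (I : ModelWithCorners ℝ E H) [I.Boundaryless]
  {Y : Type u} [TopologicalSpace Y] [ChartedSpace H Y] [IsManifold I ∞ Y] [T2Space Y]
  {κ : Type u}

/-- The disjoint union of a family of open sets, as an open subset of a product with a discrete
space. -/
def sheetOpens {Y : Type u} [TopologicalSpace Y] (W : κ → Opens Y) :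
    Opens (Y × DiscreteIndex κ) :=
  ⟨{w | w.1 ∈ W w.2}, by
    have : {w : Y × DiscreteIndex κ | w.1 ∈ W w.2} =
        ⋃ k : DiscreteIndex κ, (W k : Set Y) ×ˢ {k} := by
      ext ⟨y, k⟩
      simp only [mem_ofPred_eq, mem_iUnion, mem_prod, mem_singleton_iff, SetLike.mem_coe]
      exact ⟨fun h => ⟨k, h, rfl⟩, fun ⟨_, h, e⟩ => e ▸ h⟩
    rw [this]
    exact isOpen_iUnion fun k => (W k).2.prod (isOpen_discrete _)⟩

/-- The manifold `∐ W k`. -/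
noncomputable def sheets (W : κ → Opens Y) : SmoothMfd.{u} where
  carrier := sheetOpens W
  modelVec := E × PUnit.{1}
  modelSpace := ModelProd H PUnit.{1}
  model := I.prod 𝓘(ℝ, PUnit.{1})

variable {I} {W : κ → Opens Y}

namespace sheets

/-- The point `y_k` of `∐ W k`. -/
def mk (k : κ) (y : Y) (h : y ∈ W k) : sheets I W := ⟨(y, k), h⟩

/-- The projection `y_k ↦ y`. -/
def pt (w : sheets I W) : Y := w.1.1

/-- The index `k` of `y_k`. -/
def idx (w : sheets I W) : κ := w.1.2

theorem pt_mem (w : sheets I W) : pt w ∈ W (idx w) := w.2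

@[simp] theorem pt_mk (k : κ) (y : Y) (h : y ∈ W k) : pt (mk (I := I) k y h) = y := rfl

@[simp] theorem idx_mk (k : κ) (y : Y) (h : y ∈ W k) : idx (mk (I := I) k y h) = k := rfl

theorem ext {w w' : sheets I W} (h : pt w = pt w') (h' : idx w = idx w') : w = w' :=
  Subtype.ext (Prod.ext h h')

theorem contMDiff_pt : ContMDiff (sheets I W).model I ∞ (pt : sheets I W → Y) :=
  (contMDiff_fst (I := I) (J := 𝓘(ℝ, PUnit.{1})) (M := Y) (N := DiscreteIndex κ)).comp
    (contMDiff_subtype_val (I := I.prod 𝓘(ℝ, PUnit.{1})) (U := sheetOpens W))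

theorem continuous_index :
    Continuous (Y := DiscreteIndex κ) fun w : sheets I W => idx w := by
  exact (continuous_snd (X := Y) (Y := DiscreteIndex κ)).comp
    (continuous_subtype_val (p := (· ∈ sheetOpens W)))

theorem locConst_idx : LocConstOn (idx : sheets I W → κ) univ := fun w _ => by
  rw [nhdsWithin_univ]
  exact continuous_index.continuousAt.eventually
    ((isOpen_discrete (α := DiscreteIndex κ) {idx w}).mem_nhds rfl)

theorem isOpen_fibre (k : κ) : IsOpen {w : sheets I W | idx w = k} :=
  (isOpen_discrete (α := DiscreteIndex κ) {k}).preimage continuous_index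

variable {E' H' : Type*} [NormedAddCommGroup E'] [NormedSpace ℝ E'] [TopologicalSpace H']
  {J : ModelWithCorners ℝ E' H'} {Z : Type*} [TopologicalSpace Z] [ChartedSpace H' Z]

/-- The component in the discrete factor is smooth because it is locally constant. -/
theorem contMDiffOn_of_pt {f : Z → sheets I W} {s : Set Z}
    (hidx : LocConstOn (fun z => idx (f z)) s)
    (hf : ContMDiffOn J I ∞ (fun z => pt (f z)) s) : ContMDiffOn J (sheets I W).model ∞ f s := by
  intro z hz
  refine (ContMDiffWithinAt.subtypeVal_comp_iff (I := J) (I' := I.prod 𝓘(ℝ, PUnit.{1}))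
    (sheetOpens W) f s z).1 ?_
  have h2 : ContMDiffWithinAt J 𝓘(ℝ, PUnit.{1}) ∞
      (fun z => (idx (f z) : DiscreteIndex κ)) s z :=
    (contMDiffWithinAt_const (c := (idx (f z) : DiscreteIndex κ))).congr_of_eventuallyEq
      (hidx z hz) rfl
  exact (hf z hz).prodMk h2

/-- The point `y_k`, with value `d` outside `W k`. -/
noncomputable def mkD (d : sheets I W) (k : κ) (y : Y) : sheets I W :=
  open Classical in if h : y ∈ W k then mk k y h else d

theorem mkD_eq (d : sheets I W) {k : κ} {y : Y} (h : y ∈ W k) : mkD d k y = mk k y h :=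
  dif_pos h

theorem pt_mkD (d : sheets I W) {k : κ} {y : Y} (h : y ∈ W k) : pt (mkD d k y) = y := by
  rw [mkD_eq d h, pt_mk]

theorem idx_mkD (d : sheets I W) {k : κ} {y : Y} (h : y ∈ W k) : idx (mkD d k y) = k := by
  rw [mkD_eq d h, idx_mk]

/-- The sheet of index `k`, as an open partial homeomorphism to `Y`. -/
noncomputable def sheet (d : sheets I W) (k : κ) : OpenPartialHomeomorph (sheets I W) Y where
  toFun := pt
  invFun := mkD d k
  source := {w | idx w = k}
  target := W k
  map_source' w hw := by
    obtain rfl : idx w = k := hw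
    exact pt_mem w
  map_target' y hy := idx_mkD d hy
  left_inv' w hw := by
    obtain rfl : idx w = k := hw
    exact ext (pt_mkD d (pt_mem w)) (idx_mkD d (pt_mem w))
  right_inv' y hy := pt_mkD d hy
  open_source := isOpen_fibre k
  open_target := (W k).2
  continuousOn_toFun := contMDiff_pt.continuous.continuousOn
  continuousOn_invFun := by
    have : ContMDiffOn I (sheets I W).model ∞ (mkD d k) (W k) :=
      contMDiffOn_of_pt (LocConstOn.of_subset_fibre fun y hy => idx_mkD d hy)
        (contMDiffOn_id.congr fun y hy => pt_mkD d hy)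
    exact this.continuousOn

theorem contMDiffOn_mkD (d : sheets I W) (k : κ) :
    ContMDiffOn I (sheets I W).model ∞ (mkD d k) (W k) :=
  contMDiffOn_of_pt (LocConstOn.of_subset_fibre fun _ hy => idx_mkD d hy)
    (contMDiffOn_id.congr fun _ hy => pt_mkD d hy)

/-- The model vector spaces of `Y` and `∐ W k`. -/
noncomputable def modelEquiv (I : ModelWithCorners ℝ E H) [I.Boundaryless] (W : κ → Opens Y)
    [IsManifold I ∞ Y] : E ≃L[ℝ] (sheets I W).modelVec :=
  (ContinuousLinearEquiv.prodUnique ℝ E PUnit.{1}).symm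

/-- On each sheet `pt` is a diffeomorphism onto an open subset of `Y`, and submersions are stable
under local diffeomorphisms of the source. -/
theorem isSubmersion_comp_pt {f : Y → Z} (hf : IsSubmersion I J ∞ f) :
    IsSubmersion (sheets I W).model J ∞ fun w : sheets I W => f (pt w) := by
  obtain ⟨F, _, _, hF⟩ := hf
  refine ⟨F, ‹_›, ‹_›, fun w => ?_⟩
  exact isSubmersionAtOfComplement_comp_partialDiffeo (sheet w (idx w))
    contMDiff_pt.contMDiffOn (contMDiffOn_mkD w (idx w)) (modelEquiv I W)
    (show idx w = idx w from rfl) (hF _)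

theorem isSubmersion_pt : IsSubmersion (sheets I W).model I ∞ (pt : sheets I W → Y) :=
  isSubmersion_comp_pt IsSubmersion.id

/-- The counterpart for the target; continuity keeps `f` in a single sheet near each point. -/
theorem isSubmersion_of_pt_comp {f : Z → sheets I W}
    (hc : Continuous f) (hf : IsSubmersion J I ∞ fun z => pt (f z)) :
    IsSubmersion J (sheets I W).model ∞ f := by
  obtain ⟨F, _, _, hF⟩ := hf
  refine ⟨F, ‹_›, ‹_›, fun z => ?_⟩
  exact isSubmersionAtOfComplement_of_partialDiffeo_comp hc.continuousAt
    (sheet (f z) (idx (f z))) contMDiff_pt.contMDiffOn (contMDiffOn_mkD (f z) (idx (f z)))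
    (modelEquiv I W) (show idx (f z) = idx (f z) from rfl) (hF z)

end sheets

end Sheets

/-! ### Lie groupoids, division in principal bundles, and the band -/

namespace LieGroupoid

variable {M : SmoothMfd.{u}} (Γ : LieGroupoid M)

theorem mul_mul_inv {x y : Γ.arrows} (h : Γ.tgt x = Γ.src y) :
    Γ.mul (Γ.mul x y) (Γ.inv y) = x := by
  rw [Γ.mul_assoc _ _ _ h (Γ.src_inv y).symm, Γ.mul_inv, ← h, Γ.mul_unit]

theorem mul_inv_mul {x y : Γ.arrows} (h : Γ.tgt x = Γ.tgt y) :
    Γ.mul (Γ.mul x (Γ.inv y)) y = x := by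
  rw [Γ.mul_assoc _ _ _ (by rw [Γ.src_inv, h]) (Γ.tgt_inv y), Γ.inv_mul, ← h, Γ.mul_unit]

theorem mul_right_cancel {x y z : Γ.arrows} (hx : Γ.tgt x = Γ.src z) (hy : Γ.tgt y = Γ.src z)
    (h : Γ.mul x z = Γ.mul y z) : x = y := by
  rw [← Γ.mul_mul_inv hx, h, Γ.mul_mul_inv hy]

theorem inv_unit (m : M) : Γ.inv (Γ.unit m) = Γ.unit m := by
  have h := Γ.mul_inv (Γ.unit m)
  have h1 := Γ.unit_mul (Γ.inv (Γ.unit m))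
  rw [Γ.src_inv, Γ.tgt_unit] at h1
  rw [h1, Γ.src_unit] at h
  exact h

/-- Band elements are only required to be multiplicative; this is what makes them preserve units. -/
theorem eq_unit_of_mul_self {x : Γ.arrows} (h : Γ.tgt x = Γ.src x) (hx : Γ.mul x x = x) :
    x = Γ.unit (Γ.src x) := by
  refine Γ.mul_right_cancel (z := x) h (by rw [Γ.tgt_unit]) ?_
  rw [hx, Γ.unit_mul]

section Smooth

variable {E' H' : Type*} [NormedAddCommGroup E'] [NormedSpace ℝ E'] [TopologicalSpace H']
  {J : ModelWithCorners ℝ E' H'} {Z : Type*} [TopologicalSpace Z] [ChartedSpace H' Z]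

variable {Γ}

theorem contMDiffOn_mul {f g : Z → Γ.arrows} {s : Set Z} (hf : ContMDiffOn J Γ.arrows.model ∞ f s)
    (hg : ContMDiffOn J Γ.arrows.model ∞ g s) (h : ∀ z ∈ s, Γ.tgt (f z) = Γ.src (g z)) :
    ContMDiffOn J Γ.arrows.model ∞ (fun z => Γ.mul (f z) (g z)) s :=
  Γ.mul_smooth.comp (hf.prodMk hg) h

theorem contMDiffOn_inv {f : Z → Γ.arrows} {s : Set Z} (hf : ContMDiffOn J Γ.arrows.model ∞ f s) :
    ContMDiffOn J Γ.arrows.model ∞ (fun z => Γ.inv (f z)) s :=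
  Γ.inv_smooth.comp_contMDiffOn hf

end Smooth

end LieGroupoid

namespace PrincipalBundle

variable {EH HH : Type} [NormedAddCommGroup EH] [NormedSpace ℝ EH] [TopologicalSpace HH]
  {IH : ModelWithCorners ℝ EH HH} {H : Type u} [Group H] [TopologicalSpace H] [ChartedSpace HH H]
  {M : SmoothMfd.{u}} {Γ : LieGroupoid M} (P : PrincipalBundle IH H Γ)
  {E' H' : Type*} [NormedAddCommGroup E'] [NormedSpace ℝ E'] [TopologicalSpace H']
  {J : ModelWithCorners ℝ E' H'} {Z : Type*} [TopologicalSpace Z] [ChartedSpace H' Z]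

/-- Take for `η` the `H`-coordinate of a local trivialisation, in which the action is right
multiplication. Freeness and transitivity on fibres, and the smoothness of division, all follow from
the formula. -/
theorem exists_local_division (m : M) : ∃ (V : Set M) (η : P.total → H), IsOpen V ∧ m ∈ V ∧
    ContMDiffOn P.total.model IH ∞ η (P.proj ⁻¹' V) ∧
    ∀ x y, P.proj x ∈ V → P.proj x = P.proj y → ∀ h, P.act x h = y ↔ h = (η x)⁻¹ * η y := by
  obtain ⟨V, τ, hV, hm, hs, ht, hτ, hτ', hp, ha⟩ := P.locally_trivial m
  refine ⟨V, fun x => (τ.symm x).2, hV, hm, ht ▸ contMDiff_snd.comp_contMDiffOn hτ', ?_⟩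
  intro x y hx hxy h
  have hy : P.proj y ∈ V := hxy ▸ hx
  have key : ∀ z, P.proj z ∈ V → (τ.symm z).1 = P.proj z ∧ τ (τ.symm z) = z := by
    intro z hz
    have hz' : z ∈ τ.target := by rw [ht]; exact hz
    have h1 := τ.right_inv hz'
    have h2 := τ.map_target hz'
    rw [hs] at h2
    exact ⟨by rw [← hp (τ.symm z).1 h2.1 (τ.symm z).2, Prod.mk.eta, h1], h1⟩
  have hx1 : x = τ (P.proj x, (τ.symm x).2) := by
    rw [← (key x hx).1, Prod.mk.eta, (key x hx).2]
  have hy1 : y = τ (P.proj x, (τ.symm y).2) := by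
    rw [hxy, ← (key y hy).1, Prod.mk.eta, (key y hy).2]
  have hact : P.act x h = τ (P.proj x, (τ.symm x).2 * h) := by
    conv_lhs => rw [hx1]
    rw [ha _ hx]
  rw [hact]
  constructor
  · intro e
    rw [hy1] at e
    have := τ.injOn (by rw [hs]; exact ⟨hx, trivial⟩) (by rw [hs]; exact ⟨hx, trivial⟩) e
    exact eq_inv_mul_of_mul_eq (Prod.ext_iff.1 this).2
  · rintro rfl
    rw [mul_inv_cancel_left, ← hy1]

/-- The element of `H` carrying `x` to `y`. -/
noncomputable def div (x y : P.total) : H :=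
  open Classical in if h : ∃ h, P.act x h = y then h.choose else 1

variable {P}

theorem act_eq_iff {x y : P.total} (hxy : P.proj x = P.proj y) {h : H} :
    P.act x h = y ↔ h = P.div x y := by
  obtain ⟨V, η, -, hm, -, hη⟩ := P.exists_local_division (P.proj x)
  have h1 := hη x y hm hxy
  have h2 : ∃ h, P.act x h = y := ⟨_, (h1 _).2 rfl⟩
  have h3 : P.act x (P.div x y) = y := by
    rw [div, dif_pos h2]; exact h2.choose_spec
  rw [h1, (h1 _).1 h3]

theorem act_div {x y : P.total} (hxy : P.proj x = P.proj y) : P.act x (P.div x y) = y :=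
  (act_eq_iff hxy).2 rfl

theorem div_act (x : P.total) (h : H) : P.div x (P.act x h) = h :=
  ((act_eq_iff (P.proj_act x h).symm).1 rfl).symm

theorem act_injective {x : P.total} {h h' : H} (e : P.act x h = P.act x h') : h = h' := by
  rw [← div_act x h, e, div_act]

theorem contMDiffOn_act {f : Z → P.total} {g : Z → H} {s : Set Z}
    (hf : ContMDiffOn J P.total.model ∞ f s) (hg : ContMDiffOn J IH ∞ g s) :
    ContMDiffOn J P.total.model ∞ (fun z => P.act (f z) (g z)) s :=
  P.act_smooth.comp_contMDiffOn (hf.prodMk hg)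

theorem contMDiffOn_smul {f : Z → Γ.arrows} {g : Z → P.total} {s : Set Z}
    (hf : ContMDiffOn J Γ.arrows.model ∞ f s) (hg : ContMDiffOn J P.total.model ∞ g s)
    (h : ∀ z ∈ s, Γ.tgt (f z) = P.proj (g z)) :
    ContMDiffOn J P.total.model ∞ (fun z => P.smul (f z) (g z)) s :=
  P.smul_smooth.comp (hf.prodMk hg) h

/-- Although `div` is defined by choice, uniqueness identifies it locally with the smooth expression
`(η x)⁻¹ * η y`. -/
theorem contMDiffOn_div [LieGroup IH ∞ H] {f g : Z → P.total} {s : Set Z}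
    (hf : ContMDiffOn J P.total.model ∞ f s) (hg : ContMDiffOn J P.total.model ∞ g s)
    (h : ∀ z ∈ s, P.proj (f z) = P.proj (g z)) :
    ContMDiffOn J IH ∞ (fun z => P.div (f z) (g z)) s := by
  intro z hz
  obtain ⟨V, η, hV, hm, hη, hd⟩ := P.exists_local_division (P.proj (f z))
  have hfc : ContinuousOn (fun z => P.proj (f z)) s :=
    P.proj_smooth.continuous.comp_continuousOn hf.continuousOn
  set t := s ∩ (fun z => P.proj (f z)) ⁻¹' V
  have ht : t ∈ 𝓝[s] z := inter_mem self_mem_nhdsWithin (hfc z hz (hV.mem_nhds hm))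
  have h1 : ContMDiffOn J IH ∞ (fun z => η (f z)) t :=
    hη.comp (hf.mono inter_subset_left) fun z hz => hz.2
  have h2 : ContMDiffOn J IH ∞ (fun z => η (g z)) t :=
    hη.comp (hg.mono inter_subset_left) fun z hz => by
      change P.proj (g z) ∈ V
      rw [← h z hz.1]
      exact hz.2
  have h3 : ContMDiffOn J IH ∞ (fun z => P.div (f z) (g z)) t :=
    (h1.inv.mul h2).congr fun z hz => (hd _ _ hz.2 (h z hz.1) _).1 (act_div (h z hz.1))
  exact (h3 z ⟨hz, hm⟩).mono_of_mem_nhdsWithin ht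

end PrincipalBundle

section Groups

variable {EG HG : Type} [NormedAddCommGroup EG] [NormedSpace ℝ EG] [TopologicalSpace HG]
  {IG : ModelWithCorners ℝ EG HG} {G : Type u} [Group G] [TopologicalSpace G] [ChartedSpace HG G]
  {EH HH : Type} [NormedAddCommGroup EH] [NormedSpace ℝ EH] [TopologicalSpace HH]
  {IH : ModelWithCorners ℝ EH HH} {H : Type u} [Group H] [TopologicalSpace H] [ChartedSpace HH H]
  {EN HN : Type} [NormedAddCommGroup EN] [NormedSpace ℝ EN] [TopologicalSpace HN]
  {IN : ModelWithCorners ℝ EN HN} {N : Type u} [TopologicalSpace N] [ChartedSpace HN N]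
  {X : LieCrossedModule IG G IH H}
  {E' H' : Type*} [NormedAddCommGroup E'] [NormedSpace ℝ E'] [TopologicalSpace H']
  {J : ModelWithCorners ℝ E' H'} {Z : Type*} [TopologicalSpace Z] [ChartedSpace H' Z]

theorem LieCrossedModule.contMDiffOn_j {f : Z → H} {g : Z → G} {s : Set Z}
    (hf : ContMDiffOn J IH ∞ f s) (hg : ContMDiffOn J IG ∞ g s) :
    ContMDiffOn J IG ∞ (fun z => X.j (f z) (g z)) s :=
  X.j_smooth.comp_contMDiffOn (hf.prodMk hg)

namespace Extension

variable (E : Extension IN N X)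

theorem src_chi (x : E.P.total) (g : G) : E.R.src (E.chi x g) = E.P.proj x :=
  ((E.chi_mem_band x).mem g).1

theorem tgt_chi (x : E.P.total) (g : G) : E.R.tgt (E.chi x g) = E.P.proj x :=
  ((E.chi_mem_band x).mem g).2

theorem chi_mul (x : E.P.total) (g g' : G) :
    E.chi x (g * g') = E.R.mul (E.chi x g) (E.chi x g') := (E.chi_mem_band x).map_mul g g'

theorem chi_one (x : E.P.total) : E.chi x 1 = E.R.unit (E.P.proj x) := by
  rw [← E.src_chi x 1]
  refine E.R.eq_unit_of_mul_self (by rw [E.src_chi, E.tgt_chi]) ?_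
  rw [← E.chi_mul, mul_one]

theorem chi_injective (x : E.P.total) : Function.Injective (E.chi x) := by
  obtain ⟨k, -, hk, -⟩ := (E.chi_mem_band x).inverse
  exact Function.LeftInverse.injective hk

/-- The inverse of `χ`. -/
noncomputable def chiInv (x : E.P.total) (r : E.R.arrows) : G := E.chi_inv_smooth.choose (x, r)

theorem chiInv_chi (x : E.P.total) (g : G) : E.chiInv x (E.chi x g) = g :=
  E.chi_inv_smooth.choose_spec.2 x g

/-- The field `chi_inv_smooth` provides only a left inverse; surjectivity onto the isotropy group
comes from `chi_mem_band`. -/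
theorem chi_chiInv {x : E.P.total} {r : E.R.arrows} (h : E.R.src r = E.P.proj x)
    (h' : E.R.tgt r = E.P.proj x) : E.chi x (E.chiInv x r) = r := by
  obtain ⟨k, -, -, hk⟩ := (E.chi_mem_band x).inverse
  rw [← hk r h h', chiInv_chi]

theorem chi_act (x : E.P.total) (h : H) (g : G) : E.chi (E.P.act x h) g = E.chi x (X.j h g) := by
  have h1 := E.chi_morphism (E.R.unit (E.P.proj x)) x h g (E.R.tgt_unit _)
  rw [E.P.unit_smul, E.R.inv_unit] at h1
  have h2 := E.R.unit_mul (E.chi x (X.j h g))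
  have h3 := E.R.mul_unit (E.chi x (X.j h g))
  rw [E.src_chi] at h2
  rw [E.tgt_chi] at h3
  rw [h1, h2, h3]

theorem chi_smul {x : E.P.total} {r : E.R.arrows} (h : E.R.tgt r = E.P.proj x) (g : G) :
    E.chi (E.P.smul r x) g = E.R.mul (E.R.mul r (E.chi x g)) (E.R.inv r) := by
  have h1 := E.chi_morphism r x 1 g h
  rwa [E.P.act_one, map_one, MulAut.one_apply] at h1

/-- The commutation rule behind all normal forms: a kernel element crosses the arrow `r` when its
frame `x` is replaced by `r • x`. -/
theorem mul_chi {x : E.P.total} {r : E.R.arrows} (h : E.R.tgt r = E.P.proj x) (g : G) :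
    E.R.mul r (E.chi x g) = E.R.mul (E.chi (E.P.smul r x) g) r := by
  rw [E.chi_smul h, E.R.mul_inv_mul]
  rw [E.R.tgt_mul _ _ (by rw [E.src_chi, h]), E.tgt_chi, h]

variable {E}

theorem contMDiffOn_chi {f : Z → E.P.total} {g : Z → G} {s : Set Z}
    (hf : ContMDiffOn J E.P.total.model ∞ f s) (hg : ContMDiffOn J IG ∞ g s) :
    ContMDiffOn J E.R.arrows.model ∞ (fun z => E.chi (f z) (g z)) s :=
  E.chi_smooth.comp_contMDiffOn (hf.prodMk hg)

theorem contMDiffOn_chiInv {f : Z → E.P.total} {g : Z → E.R.arrows} {s : Set Z}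
    (hf : ContMDiffOn J E.P.total.model ∞ f s) (hg : ContMDiffOn J E.R.arrows.model ∞ g s)
    (h : ∀ z ∈ s, E.R.src (g z) = E.P.proj (f z)) (h' : ∀ z ∈ s, E.R.tgt (g z) = E.P.proj (f z)) :
    ContMDiffOn J IG ∞ (fun z => E.chiInv (f z) (g z)) s :=
  E.chi_inv_smooth.choose_spec.1.comp (hf.prodMk hg) fun z hz => ⟨h z hz, h' z hz⟩

/-- The arrows of `R` lift the pairs of points of the base over the same point of `N`, smoothly
and locally. -/
theorem exists_local_arrow {f g : Z → E.base} {s : Set Z} (hs : IsOpen s)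
    (hf : ContMDiffOn J E.base.model ∞ f s) (hg : ContMDiffOn J E.base.model ∞ g s)
    (h : ∀ z ∈ s, E.q (f z) = E.q (g z)) {z : Z} (hz : z ∈ s) :
    ∃ (V : Set Z) (b : Z → E.R.arrows), IsOpen V ∧ z ∈ V ∧ V ⊆ s ∧
      ContMDiffOn J E.R.arrows.model ∞ b V ∧
      ∀ y ∈ V, E.R.src (b y) = f y ∧ E.R.tgt (b y) = g y := by
  obtain ⟨r, hr, hr'⟩ := E.isGExtension.surjective _ _ (h z hz)
  obtain ⟨W, σ, hW, hrW, -, hσ, hσ'⟩ := E.isGExtension.submersion r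
  rw [hr, hr'] at hrW
  have hfg := hf.prodMk hg
  refine ⟨s ∩ (fun z => (f z, g z)) ⁻¹' W, fun z => σ (f z, g z),
    hfg.continuousOn.isOpen_inter_preimage hs hW, ⟨hz, hrW⟩, inter_subset_left,
    hσ.comp (hfg.mono inter_subset_left) fun y hy => ⟨hy.2, h y hy.1⟩,
    fun y hy => hσ' _ hy.2 (h y hy.1)⟩

end Extension

end Groups

theorem LieGroupoid.conj_mul_conj {M : SmoothMfd.{u}} (Γ : LieGroupoid M)
    {b a b' a' b'' : Γ.arrows} (h1 : Γ.tgt b = Γ.src a) (h2 : Γ.tgt a = Γ.tgt b')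
    (h3 : Γ.tgt b' = Γ.src a') (h4 : Γ.tgt a' = Γ.tgt b'') :
    Γ.mul (Γ.mul (Γ.mul b a) (Γ.inv b')) (Γ.mul (Γ.mul b' a') (Γ.inv b'')) =
      Γ.mul (Γ.mul b (Γ.mul a a')) (Γ.inv b'') := by
  have e1 : Γ.tgt (Γ.mul b a) = Γ.tgt b' := by rw [Γ.tgt_mul _ _ h1, h2]
  have e2 : Γ.tgt (Γ.mul b' a') = Γ.tgt b'' := by rw [Γ.tgt_mul _ _ h3, h4]
  have e3 : Γ.src (Γ.mul b' a') = Γ.src b' := Γ.src_mul _ _ h3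
  have e4 : Γ.tgt (Γ.mul (Γ.mul b a) (Γ.inv b')) = Γ.src b' := by
    rw [Γ.tgt_mul _ _ (by rw [e1, Γ.src_inv]), Γ.tgt_inv]
  have e5 : Γ.tgt (Γ.mul (Γ.mul b a) (Γ.inv b')) = Γ.src (Γ.mul b' a') := by rw [e4, e3]
  rw [← Γ.mul_assoc _ _ _ e5 (by rw [e2, Γ.src_inv]), ← Γ.mul_assoc _ _ _ e4 h3,
    Γ.mul_inv_mul e1, Γ.mul_assoc _ _ _ h1 (h2.trans h3)]

/-! ### Normal forms of arrows relative to points of the principal bundle -/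

section Groups

variable {EG HG : Type} [NormedAddCommGroup EG] [NormedSpace ℝ EG] [TopologicalSpace HG]
  {IG : ModelWithCorners ℝ EG HG} {G : Type u} [Group G] [TopologicalSpace G] [ChartedSpace HG G]
  {EH HH : Type} [NormedAddCommGroup EH] [NormedSpace ℝ EH] [TopologicalSpace HH]
  {IH : ModelWithCorners ℝ EH HH} {H : Type u} [Group H] [TopologicalSpace H] [ChartedSpace HH H]
  {EN HN : Type} [NormedAddCommGroup EN] [NormedSpace ℝ EN] [TopologicalSpace HN]
  {IN : ModelWithCorners ℝ EN HN} {N : Type u} [TopologicalSpace N] [ChartedSpace HN N]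
  {X : LieCrossedModule IG G IH H}
  {E' H' : Type*} [NormedAddCommGroup E'] [NormedSpace ℝ E'] [TopologicalSpace H']
  {J : ModelWithCorners ℝ E' H'} {Z : Type*} [TopologicalSpace Z] [ChartedSpace H' Z]

namespace Extension

variable (E : Extension IN N X)

theorem src_eq_of_smul_eq {x y : E.P.total} {r : E.R.arrows} {l : H} (h : E.R.tgt r = E.P.proj y)
    (hl : E.P.smul r y = E.P.act x l) : E.R.src r = E.P.proj x := by
  rw [← E.P.proj_smul r y h, hl, E.P.proj_act]

theorem src_chi_mul {x : E.P.total} {g : G} {r : E.R.arrows} (h : E.R.src r = E.P.proj x) :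
    E.R.src (E.R.mul (E.chi x g) r) = E.P.proj x := by
  rw [E.R.src_mul _ _ (by rw [E.tgt_chi, h]), E.src_chi]

theorem tgt_chi_mul {x : E.P.total} {g : G} {r : E.R.arrows} (h : E.R.src r = E.P.proj x) :
    E.R.tgt (E.R.mul (E.chi x g) r) = E.R.tgt r := by
  rw [E.R.tgt_mul _ _ (by rw [E.tgt_chi, h])]

theorem chi_mul_chi_mul {x : E.P.total} {g g' : G} {r : E.R.arrows}
    (h : E.R.src r = E.P.proj x) :
    E.R.mul (E.chi x g) (E.R.mul (E.chi x g') r) = E.R.mul (E.chi x (g * g')) r := by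
  rw [E.chi_mul, E.R.mul_assoc]
  · rw [E.src_chi, E.tgt_chi]
  · rw [E.tgt_chi, h]

theorem chi_one_mul {x : E.P.total} {r : E.R.arrows} (h : E.R.src r = E.P.proj x) :
    E.R.mul (E.chi x 1) r = r := by
  rw [E.chi_one, ← h, E.R.unit_mul]

/-- By `act_rho`, the arrow `χ(x)(g)` acts on its own frame `x` as `ρ(g)`. -/
theorem chi_mul_smul {x y : E.P.total} {r : E.R.arrows} {l : H} (h : E.R.tgt r = E.P.proj y)
    (hl : E.P.smul r y = E.P.act x l) (g : G) :
    E.P.smul (E.R.mul (E.chi x g) r) y = E.P.act x (X.ρ g * l) := by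
  have hs := E.src_eq_of_smul_eq h hl
  rw [E.P.mul_smul _ _ _ (by rw [E.tgt_chi, hs]) h, hl, ← E.P.smul_act _ _ _ (E.tgt_chi x g),
    ← E.act_rho, E.P.act_mul]

/-- The central computation. Moving `χ(y)(g₂)` to the left across `a` changes its frame into `a • y
= x • l`, and `χ(x • l)(g₂) = χ(x)(l(g₂))`; then `a b` is replaced by `χ(x)(g) c`. The cocycle
identity for `gg`, the coboundary formula and the product of the adapted extension are all
instances. -/
theorem mul_normal_form {x y : E.P.total} {a b c : E.R.arrows} {l : H} {g : G}
    (ha : E.R.tgt a = E.P.proj y) (hl : E.P.smul a y = E.P.act x l) (hb : E.R.src b = E.P.proj y)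
    (hc : E.R.src c = E.P.proj x) (hab : E.R.mul a b = E.R.mul (E.chi x g) c) (g₁ g₂ : G) :
    E.R.mul (E.R.mul (E.chi x g₁) a) (E.R.mul (E.chi y g₂) b) =
      E.R.mul (E.chi x (g₁ * X.j l g₂ * g)) c := by
  have hs := E.src_eq_of_smul_eq ha hl
  have e1 : E.R.tgt (E.chi x g₁) = E.R.src a := by rw [E.tgt_chi, hs]
  have e2 : E.R.tgt (E.R.mul (E.chi x g₁) a) = E.R.src (E.chi y g₂) := by
    rw [E.R.tgt_mul _ _ e1, ha, E.src_chi]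
  have e3 : E.R.tgt (E.chi y g₂) = E.R.src b := by rw [E.tgt_chi, hb]
  have e4 : E.R.tgt a = E.R.src (E.chi y g₂) := by rw [ha, E.src_chi]
  have e5 : E.R.tgt (E.chi x (X.j l g₂)) = E.R.src a := by rw [E.tgt_chi, hs]
  have e6 : E.R.tgt (E.chi x g₁) = E.R.src (E.chi x (X.j l g₂)) := by rw [E.tgt_chi, E.src_chi]
  rw [← E.R.mul_assoc _ _ _ e2 e3, E.R.mul_assoc _ _ _ e1 e4, E.mul_chi ha, hl, E.chi_act,
    ← E.R.mul_assoc _ _ _ e6 e5, ← E.chi_mul,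
    E.R.mul_assoc _ _ _ (by rw [E.tgt_chi, hs]) (ha.trans hb.symm), hab, E.chi_mul_chi_mul hc]

theorem chi_mul_injective {x : E.P.total} {c : E.R.arrows} (hc : E.R.src c = E.P.proj x)
    {g g' : G} (h : E.R.mul (E.chi x g) c = E.R.mul (E.chi x g') c) : g = g' :=
  E.chi_injective x (E.R.mul_right_cancel (by rw [E.tgt_chi, hc]) (by rw [E.tgt_chi, hc]) h)

/-! Arrows `r a r'⁻¹`, where `a` takes the point under `y` to the point under `x`. -/

section Conj

variable {x y : E.P.total} {a r r' : E.R.arrows} {l : H}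

theorem src_conj (hr : E.R.tgt r = E.P.proj x) (hr' : E.R.tgt r' = E.P.proj y)
    (hs : E.R.src a = E.P.proj x) (ha : E.R.tgt a = E.P.proj y) :
    E.R.src (E.R.mul (E.R.mul r a) (E.R.inv r')) = E.R.src r := by
  have e : E.R.tgt r = E.R.src a := by rw [hr, hs]
  rw [E.R.src_mul, E.R.src_mul _ _ e]
  rw [E.R.tgt_mul _ _ e, E.R.src_inv, ha, hr']

theorem tgt_conj (hr : E.R.tgt r = E.P.proj x) (hr' : E.R.tgt r' = E.P.proj y)
    (hs : E.R.src a = E.P.proj x) (ha : E.R.tgt a = E.P.proj y) :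
    E.R.tgt (E.R.mul (E.R.mul r a) (E.R.inv r')) = E.R.src r' := by
  have e : E.R.tgt r = E.R.src a := by rw [hr, hs]
  rw [E.R.tgt_mul, E.R.tgt_inv]
  rw [E.R.tgt_mul _ _ e, E.R.src_inv, ha, hr']

theorem conj_smul (hr : E.R.tgt r = E.P.proj x) (hr' : E.R.tgt r' = E.P.proj y)
    (hs : E.R.src a = E.P.proj x) (ha : E.R.tgt a = E.P.proj y)
    (hl : E.P.smul a y = E.P.act x l) :
    E.P.smul (E.R.mul (E.R.mul r a) (E.R.inv r')) (E.P.smul r' y) = E.P.act (E.P.smul r x) l := by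
  have e : E.R.tgt r = E.R.src a := by rw [hr, hs]
  have e' : E.R.tgt (E.R.mul r a) = E.R.tgt r' := by rw [E.R.tgt_mul _ _ e, ha, hr']
  rw [← E.P.mul_smul _ _ _ _ hr', E.R.mul_inv_mul e', E.P.mul_smul _ _ _ e ha, hl,
    ← E.P.smul_act _ _ _ hr]
  rw [E.R.tgt_mul _ _ (by rw [e', E.R.src_inv]), E.R.tgt_inv]

theorem conj_mul_eq {z : E.P.total} {a' a'' r'' : E.R.arrows} {g : G}
    (hr : E.R.tgt r = E.P.proj x) (hr' : E.R.tgt r' = E.P.proj y) (hr'' : E.R.tgt r'' = E.P.proj z)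
    (hs : E.R.src a = E.P.proj x) (ha : E.R.tgt a = E.P.proj y)
    (hs' : E.R.src a' = E.P.proj y) (ha' : E.R.tgt a' = E.P.proj z)
    (hs'' : E.R.src a'' = E.P.proj x) (ha'' : E.R.tgt a'' = E.P.proj z)
    (h : E.R.mul a a' = E.R.mul (E.chi x g) a'') :
    E.R.mul (E.R.mul (E.R.mul r a) (E.R.inv r')) (E.R.mul (E.R.mul r' a') (E.R.inv r'')) =
      E.R.mul (E.chi (E.P.smul r x) g) (E.R.mul (E.R.mul r a'') (E.R.inv r'')) := by
  have e1 : E.R.tgt r = E.R.src a'' := by rw [hr, hs'']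
  have e2 : E.R.tgt a'' = E.R.src (E.R.inv r'') := by rw [E.R.src_inv, hr'', ha'']
  rw [E.R.conj_mul_conj (hr.trans hs.symm) (ha.trans hr'.symm) (hr'.trans hs'.symm)
    (ha'.trans hr''.symm), h, ← E.R.mul_assoc r _ _ (by rw [E.src_chi, hr])
    (by rw [E.tgt_chi, hs'']), E.mul_chi hr, E.R.mul_assoc _ _ _ _ e1, E.R.mul_assoc]
  · rw [E.tgt_chi, E.R.src_mul _ _ e1, E.P.proj_smul _ _ hr]
  · rw [E.R.tgt_mul _ _ e1, e2]
  · rw [E.tgt_chi, E.P.proj_smul _ _ hr]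

end Conj

/-- The element `g` of `G` for which `r = χ(x)(g) c`. -/
noncomputable def quot (x : E.P.total) (r c : E.R.arrows) : G := E.chiInv x (E.R.mul r (E.R.inv c))

theorem chi_quot_mul {x : E.P.total} {r c : E.R.arrows} (hr : E.R.src r = E.P.proj x)
    (hc : E.R.src c = E.P.proj x) (h : E.R.tgt r = E.R.tgt c) :
    E.R.mul (E.chi x (E.quot x r c)) c = r := by
  have e : E.R.tgt r = E.R.src (E.R.inv c) := by rw [E.R.src_inv, h]
  rw [quot, E.chi_chiInv, E.R.mul_inv_mul h]
  · rw [E.R.src_mul _ _ e, hr]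
  · rw [E.R.tgt_mul _ _ e, E.R.tgt_inv, hc]

theorem quot_chi_mul {x : E.P.total} {c : E.R.arrows} (hc : E.R.src c = E.P.proj x) (g : G) :
    E.quot x (E.R.mul (E.chi x g) c) c = g :=
  E.chi_mul_injective hc (E.chi_quot_mul (E.src_chi_mul hc) hc (E.tgt_chi_mul hc))

variable {E}

theorem contMDiffOn_quot {f : Z → E.P.total} {g g' : Z → E.R.arrows} {s : Set Z}
    (hf : ContMDiffOn J E.P.total.model ∞ f s) (hg : ContMDiffOn J E.R.arrows.model ∞ g s)
    (hg' : ContMDiffOn J E.R.arrows.model ∞ g' s)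
    (h1 : ∀ z ∈ s, E.R.src (g z) = E.P.proj (f z)) (h2 : ∀ z ∈ s, E.R.src (g' z) = E.P.proj (f z))
    (h : ∀ z ∈ s, E.R.tgt (g z) = E.R.tgt (g' z)) :
    ContMDiffOn J IG ∞ (fun z => E.quot (f z) (g z) (g' z)) s := by
  have e : ∀ z ∈ s, E.R.tgt (g z) = E.R.src (E.R.inv (g' z)) := fun z hz => by
    rw [E.R.src_inv, h z hz]
  refine contMDiffOn_chiInv hf (LieGroupoid.contMDiffOn_mul hg (LieGroupoid.contMDiffOn_inv hg') e)
    (fun z hz => ?_) fun z hz => ?_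
  · rw [E.R.src_mul _ _ (e z hz), h1 z hz]
  · rw [E.R.tgt_mul _ _ (e z hz), E.R.tgt_inv, h2 z hz]

end Extension

/-! ### Local data, and their dependence on choices -/

/-- Local sections of `P` and local arrows between their base points that express the extension `E`
by the cocycle `c`. -/
structure LocalData (E : Extension IN N X) {ι : Type u} {U : ι → Opens N}
    (c : Cocycle IN X U) where
  s : ι → N → E.P.total
  a : ι → ι → N → E.R.arrows
  s_smooth : ∀ i, ContMDiffOn IN E.P.total.model ∞ (s i) (U i)
  a_smooth : ∀ i j, ContMDiffOn IN E.R.arrows.model ∞ (a i j) (U i ∩ U j)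
  q_s : ∀ i, ∀ x ∈ U i, E.q (E.P.proj (s i x)) = x
  src_a : ∀ i j, ∀ x ∈ (U i ∩ U j : Set N), E.R.src (a i j x) = E.P.proj (s i x)
  tgt_a : ∀ i j, ∀ x ∈ (U i ∩ U j : Set N), E.R.tgt (a i j x) = E.P.proj (s j x)
  smul_s : ∀ i j, ∀ x ∈ (U i ∩ U j : Set N),
    E.P.smul (a i j x) (s j x) = E.P.act (s i x) (c.lam i j x)
  mul_a : ∀ i j k, ∀ x ∈ (U i ∩ U j ∩ U k : Set N),
    E.R.mul (a i j x) (a j k x) = E.R.mul (E.chi (s i x) (c.gg i j k x)) (a i k x)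

variable {E : Extension IN N X} {ι κ : Type u} {U : ι → Opens N} {V : κ → Opens N}

/-- Local sections and arrows determine a cocycle. -/
theorem exists_cocycle_of_sections [LieGroup IH ∞ H]
    (s : ι → N → E.P.total) (a : ι → ι → N → E.R.arrows)
    (s_smooth : ∀ i, ContMDiffOn IN E.P.total.model ∞ (s i) (U i))
    (a_smooth : ∀ i j, ContMDiffOn IN E.R.arrows.model ∞ (a i j) (U i ∩ U j))
    (q_s : ∀ i, ∀ x ∈ U i, E.q (E.P.proj (s i x)) = x)
    (src_a : ∀ i j, ∀ x ∈ (U i ∩ U j : Set N), E.R.src (a i j x) = E.P.proj (s i x))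
    (tgt_a : ∀ i j, ∀ x ∈ (U i ∩ U j : Set N), E.R.tgt (a i j x) = E.P.proj (s j x))
    (a_self : ∀ i, ∀ x ∈ U i, a i i x = E.R.unit (E.P.proj (s i x))) :
    ∃ c : Cocycle IN X U, Nonempty (LocalData E c) := by
  -- Both families are forced by `smul_s` and `mul_a`: the first is a quotient in `P`, the second
  -- the normal form coordinate of `a_ij a_jk` relative to `a_ik`.
  set lam : ι → ι → N → H := fun i j x => E.P.div (s i x) (E.P.smul (a i j x) (s j x))
  set gg : ι → ι → ι → N → G := fun i j k x =>
    E.quot (s i x) (E.R.mul (a i j x) (a j k x)) (a i k x)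
  have smul_s : ∀ i j, ∀ x ∈ (U i ∩ U j : Set N),
      E.P.smul (a i j x) (s j x) = E.P.act (s i x) (lam i j x) := fun i j x hx =>
    (PrincipalBundle.act_div (by rw [E.P.proj_smul _ _ (tgt_a i j x hx), src_a i j x hx])).symm
  have comp : ∀ i j k, ∀ x ∈ (U i ∩ U j ∩ U k : Set N), E.R.tgt (a i j x) = E.R.src (a j k x) :=
    fun i j k x hx => by rw [tgt_a i j x hx.1, src_a j k x ⟨hx.1.2, hx.2⟩]
  have src_mul : ∀ i j k, ∀ x ∈ (U i ∩ U j ∩ U k : Set N),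
      E.R.src (E.R.mul (a i j x) (a j k x)) = E.P.proj (s i x) := fun i j k x hx => by
    rw [E.R.src_mul _ _ (comp i j k x hx), src_a i j x hx.1]
  have tgt_mul : ∀ i j k, ∀ x ∈ (U i ∩ U j ∩ U k : Set N),
      E.R.tgt (E.R.mul (a i j x) (a j k x)) = E.R.tgt (a i k x) := fun i j k x hx => by
    rw [E.R.tgt_mul _ _ (comp i j k x hx), tgt_a j k x ⟨hx.1.2, hx.2⟩,
      tgt_a i k x ⟨hx.1.1, hx.2⟩]
  have mul_a : ∀ i j k, ∀ x ∈ (U i ∩ U j ∩ U k : Set N),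
      E.R.mul (a i j x) (a j k x) = E.R.mul (E.chi (s i x) (gg i j k x)) (a i k x) :=
    fun i j k x hx => (E.chi_quot_mul (src_mul i j k x hx) (src_a i k x ⟨hx.1.1, hx.2⟩)
      (tgt_mul i j k x hx)).symm
  refine ⟨⟨lam, gg, fun i j => ?_, fun i j k => ?_, fun i j k x hx => ?_, fun i j k l x hx => ?_,
    fun i j x hx => ?_⟩, ⟨⟨s, a, s_smooth, a_smooth, q_s, src_a, tgt_a, smul_s, mul_a⟩⟩⟩
  · refine PrincipalBundle.contMDiffOn_div ((s_smooth i).mono inter_subset_left)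
      (PrincipalBundle.contMDiffOn_smul (a_smooth i j) ((s_smooth j).mono inter_subset_right)
        (tgt_a i j)) fun x hx => ?_
    rw [E.P.proj_smul _ _ (tgt_a i j x hx), src_a i j x hx]
  · have hik : (U i ∩ U j ∩ U k : Set N) ⊆ U i ∩ U k := fun x hx => ⟨hx.1.1, hx.2⟩
    have hjk : (U i ∩ U j ∩ U k : Set N) ⊆ U j ∩ U k := fun x hx => ⟨hx.1.2, hx.2⟩
    exact Extension.contMDiffOn_quot ((s_smooth i).mono fun x hx => hx.1.1)
      (LieGroupoid.contMDiffOn_mul ((a_smooth i j).mono inter_subset_left)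
        ((a_smooth j k).mono hjk) (comp i j k)) ((a_smooth i k).mono hik) (src_mul i j k)
      (fun x hx => src_a i k x (hik hx)) (tgt_mul i j k)
  · have hik : x ∈ (U i ∩ U k : Set N) := ⟨hx.1.1, hx.2⟩
    have hjk : x ∈ (U j ∩ U k : Set N) := ⟨hx.1.2, hx.2⟩
    -- By freeness it suffices to compare the two sides on `s_i`; both give `a_ij • a_jk • s_k`.
    refine PrincipalBundle.act_injective (x := s i x) ?_
    rw [← E.chi_mul_smul (tgt_a i k x hik) (smul_s i k x hik), ← mul_a i j k x hx,
      E.P.mul_smul _ _ _ (comp i j k x hx) (tgt_a j k x hjk), smul_s j k x hjk,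
      ← E.P.smul_act _ _ _ (tgt_a i j x hx.1), smul_s i j x hx.1, E.P.act_mul]
  · obtain ⟨⟨⟨hi, hj⟩, hk⟩, hl⟩ := hx
    refine E.chi_mul_injective (src_a i l x ⟨hi, hl⟩) ?_
    -- The two bracketings of `a_ij a_jk a_kl`, each brought to the form `χ(s_i)(g) a_il`; the
    -- coordinates agree by associativity.
    have h1 := E.mul_normal_form (tgt_a i k x ⟨hi, hk⟩) (smul_s i k x ⟨hi, hk⟩)
      (src_a k l x ⟨hk, hl⟩) (src_a i l x ⟨hi, hl⟩) (mul_a i k l x ⟨⟨hi, hk⟩, hl⟩) (gg i j k x) 1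
    have h2 := E.mul_normal_form (tgt_a i j x ⟨hi, hj⟩) (smul_s i j x ⟨hi, hj⟩)
      (src_a j l x ⟨hj, hl⟩) (src_a i l x ⟨hi, hl⟩) (mul_a i j l x ⟨⟨hi, hj⟩, hl⟩) 1 (gg j k l x)
    rw [map_one, mul_one, E.chi_one_mul (src_a k l x ⟨hk, hl⟩),
      ← mul_a i j k x ⟨⟨hi, hj⟩, hk⟩] at h1
    rw [one_mul, E.chi_one_mul (src_a i j x ⟨hi, hj⟩), ← mul_a j k l x ⟨⟨hj, hk⟩, hl⟩] at h2
    rw [← h1, ← h2, E.R.mul_assoc _ _ _ (comp i j k x ⟨⟨hi, hj⟩, hk⟩)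
      (comp j k l x ⟨⟨hj, hk⟩, hl⟩)]
  -- The choice of unit arrows for `a_ii` is what gives `𝐠_iij = e`.
  · refine E.chi_mul_injective (src_a i j x hx) ?_
    rw [← mul_a i i j x ⟨⟨hx.1, hx.1⟩, hx.2⟩, E.chi_one, a_self i x hx.1]

namespace LocalData

variable {c c' : Cocycle IN X U}

/-- The restriction of local data to a refinement of the cover. -/
def pullback (d : LocalData E c) (σ : κ → ι) (hσ : ∀ k, V k ≤ U (σ k)) :
    LocalData E (c.pullback σ hσ) where
  s k := d.s (σ k)
  a k l := d.a (σ k) (σ l)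
  s_smooth _ := (d.s_smooth _).mono (hσ _)
  a_smooth _ _ := (d.a_smooth _ _).mono fun _ hx => ⟨hσ _ hx.1, hσ _ hx.2⟩
  q_s _ x hx := d.q_s _ x (hσ _ hx)
  src_a _ _ x hx := d.src_a _ _ x ⟨hσ _ hx.1, hσ _ hx.2⟩
  tgt_a _ _ x hx := d.tgt_a _ _ x ⟨hσ _ hx.1, hσ _ hx.2⟩
  smul_s _ _ x hx := d.smul_s _ _ x ⟨hσ _ hx.1, hσ _ hx.2⟩
  mul_a _ _ _ x hx := d.mul_a _ _ _ x ⟨⟨hσ _ hx.1.1, hσ _ hx.1.2⟩, hσ _ hx.2⟩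

/-- Sections may be moved along arrows with given end points. -/
def move (d : LocalData E c) (b : ι → N → E.R.arrows)
    (hb : ∀ i, ContMDiffOn IN E.R.arrows.model ∞ (b i) (U i))
    (ht : ∀ i, ∀ x ∈ U i, E.R.tgt (b i x) = E.P.proj (d.s i x)) : LocalData E c where
  s i x := E.P.smul (b i x) (d.s i x)
  a i j x := E.R.mul (E.R.mul (b i x) (d.a i j x)) (E.R.inv (b j x))
  s_smooth i := PrincipalBundle.contMDiffOn_smul (hb i) (d.s_smooth i) (ht i)
  a_smooth i j := by
    have e : ∀ x ∈ (U i ∩ U j : Set N), E.R.tgt (b i x) = E.R.src (d.a i j x) := fun x hx => by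
      rw [ht i x hx.1, d.src_a i j x hx]
    refine LieGroupoid.contMDiffOn_mul (LieGroupoid.contMDiffOn_mul
      ((hb i).mono inter_subset_left) (d.a_smooth i j) e)
      (LieGroupoid.contMDiffOn_inv ((hb j).mono inter_subset_right)) fun x hx => ?_
    rw [E.R.tgt_mul _ _ (e x hx), E.R.src_inv, d.tgt_a i j x hx, ht j x hx.2]
  q_s i x hx := by
    rw [E.P.proj_smul _ _ (ht i x hx), E.isGExtension.maps_to, ht i x hx, d.q_s i x hx]
  src_a i j x hx := (E.src_conj (ht i x hx.1) (ht j x hx.2) (d.src_a i j x hx)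
    (d.tgt_a i j x hx)).trans (E.P.proj_smul _ _ (ht i x hx.1)).symm
  tgt_a i j x hx := (E.tgt_conj (ht i x hx.1) (ht j x hx.2) (d.src_a i j x hx)
    (d.tgt_a i j x hx)).trans (E.P.proj_smul _ _ (ht j x hx.2)).symm
  smul_s i j x hx := E.conj_smul (ht i x hx.1) (ht j x hx.2) (d.src_a i j x hx)
    (d.tgt_a i j x hx) (d.smul_s i j x hx)
  mul_a i j k x hx := E.conj_mul_eq (ht i x hx.1.1) (ht j x hx.1.2) (ht k x hx.2)
    (d.src_a i j x hx.1) (d.tgt_a i j x hx.1) (d.src_a j k x ⟨hx.1.2, hx.2⟩)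
    (d.tgt_a j k x ⟨hx.1.2, hx.2⟩) (d.src_a i k x ⟨hx.1.1, hx.2⟩)
    (d.tgt_a i k x ⟨hx.1.1, hx.2⟩) (d.mul_a i j k x hx)

section Act

variable (d : LocalData E c)

/-- The effect on `lam` of replacing the frames `s_i` by `s_i • r_i⁻¹` while keeping the arrows: the
coboundary formula with `v = 1`. -/
theorem smul_act_inv {i j : ι} {x : N} (hx : x ∈ (U i ∩ U j : Set N)) (h h' : H) :
    E.P.smul (d.a i j x) (E.P.act (d.s j x) h'⁻¹) =
      E.P.act (E.P.act (d.s i x) h⁻¹) (h * c.lam i j x * h'⁻¹) := by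
  rw [← E.P.smul_act _ _ _ (d.tgt_a i j x hx), d.smul_s i j x hx, ← E.P.act_mul, ← E.P.act_mul,
    mul_assoc h, inv_mul_cancel_left]

/-- The effect of the same change on `gg`: the frame in which the kernel element is read has been
moved by `h⁻¹`. -/
theorem mul_act_inv {i j k : ι} {x : N} (hx : x ∈ (U i ∩ U j ∩ U k : Set N)) (h : H) :
    E.R.mul (d.a i j x) (d.a j k x) =
      E.R.mul (E.chi (E.P.act (d.s i x) h⁻¹) (X.j h (c.gg i j k x))) (d.a i k x) := by
  rw [d.mul_a i j k x hx, E.chi_act, ← MulAut.mul_apply, ← map_mul, inv_mul_cancel, map_one,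
    MulAut.one_apply]

end Act

/-- Local data for a cohomologous cocycle. -/
theorem exists_of_related [LieGroup IH ∞ H] (d : LocalData E c) (h : c.Related c') :
    Nonempty (LocalData E c') := by
  obtain ⟨r, v, hr, hv, hlam, hgg⟩ := h
  have hs : ∀ i, ContMDiffOn IN E.P.total.model ∞ (fun x => E.P.act (d.s i x) (r i x)⁻¹) (U i) :=
    fun i => PrincipalBundle.contMDiffOn_act (d.s_smooth i) (hr i).inv
  have hsrc : ∀ i j, ∀ x ∈ (U i ∩ U j : Set N),
      E.R.src (d.a i j x) = E.P.proj (E.P.act (d.s i x) (r i x)⁻¹) := fun i j x hx => by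
    rw [E.P.proj_act, d.src_a i j x hx]
  have htgt : ∀ i j, ∀ x ∈ (U i ∩ U j : Set N),
      E.R.tgt (d.a i j x) = E.P.proj (E.P.act (d.s j x) (r j x)⁻¹) := fun i j x hx => by
    rw [E.P.proj_act, d.tgt_a i j x hx]
  -- The coboundary changes frames: `s'_i = s_i • r_i⁻¹` and `a'_ij = χ(s'_i)(v_ij) a_ij`.
  refine ⟨⟨fun i x => E.P.act (d.s i x) (r i x)⁻¹, fun i j x =>
    E.R.mul (E.chi (E.P.act (d.s i x) (r i x)⁻¹) (v i j x)) (d.a i j x), hs, fun i j => ?_,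
    fun i x hx => ?_, fun i j x hx => E.src_chi_mul (hsrc i j x hx), fun i j x hx => ?_,
    fun i j x hx => ?_, fun i j k x hx => ?_⟩⟩
  · exact LieGroupoid.contMDiffOn_mul (Extension.contMDiffOn_chi ((hs i).mono inter_subset_left)
      (hv i j)) (d.a_smooth i j) fun x hx => by rw [E.tgt_chi, hsrc i j x hx]
  · rw [E.P.proj_act, d.q_s i x hx]
  · rw [E.tgt_chi_mul (hsrc i j x hx), htgt i j x hx]
  · rw [E.chi_mul_smul (htgt i j x hx) (d.smul_act_inv hx (r i x) (r j x)), hlam i j x hx]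
    simp only [mul_assoc]
  · have hik : x ∈ (U i ∩ U k : Set N) := ⟨hx.1.1, hx.2⟩
    have hjk : x ∈ (U j ∩ U k : Set N) := ⟨hx.1.2, hx.2⟩
    -- The normal form has `v_ij · (r_i λ_ij r_j⁻¹)(v_jk)` where the coboundary relation has
    -- `λ'_ij(v_jk) · v_ij`; they are equal by the Peiffer identity applied to `ρ(v_ij)`.
    rw [E.mul_normal_form (htgt i j x hx.1) (d.smul_act_inv hx.1 (r i x) (r j x))
      (hsrc j k x hjk) (hsrc i k x hik) (d.mul_act_inv hx (r i x)), E.chi_mul_chi_mul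
      (hsrc i k x hik), hgg i j k x hx, hlam i j x hx.1, mul_assoc (X.ρ _), mul_assoc (X.ρ _),
      map_mul X.j (X.ρ _), MulAut.mul_apply, X.peiffer]
    simp only [mul_assoc, inv_mul_cancel_left]

/-- Cocycles given by local data over the same points of the base are cohomologous. -/
theorem related [LieGroup IH ∞ H] (d : LocalData E c) (d' : LocalData E c')
    (h : ∀ i, ∀ x ∈ U i, E.P.proj (d'.s i x) = E.P.proj (d.s i x)) : c.Related c' := by
  -- The inverse of the change of frames by a coboundary: `r_i` is determined by `s'_i = s_i •
  -- r_i⁻¹` and `v_ij` by `a'_ij = χ(s'_i)(v_ij) a_ij`.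
  set r : ι → N → H := fun i x => E.P.div (d'.s i x) (d.s i x)
  set v : ι → ι → N → G := fun i j x => E.quot (d'.s i x) (d'.a i j x) (d.a i j x)
  have hs : ∀ i, ∀ x ∈ U i, E.P.act (d.s i x) (r i x)⁻¹ = d'.s i x := fun i x hx => by
    rw [← PrincipalBundle.act_div (h i x hx), ← E.P.act_mul, mul_inv_cancel, E.P.act_one]
  have hsrc : ∀ i j, ∀ x ∈ (U i ∩ U j : Set N),
      E.R.src (d.a i j x) = E.P.proj (d'.s i x) := fun i j x hx => by
    rw [h i x hx.1, d.src_a i j x hx]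
  have htgt : ∀ i j, ∀ x ∈ (U i ∩ U j : Set N),
      E.R.tgt (d.a i j x) = E.P.proj (d'.s j x) := fun i j x hx => by
    rw [h j x hx.2, d.tgt_a i j x hx]
  have htt : ∀ i j, ∀ x ∈ (U i ∩ U j : Set N),
      E.R.tgt (d'.a i j x) = E.R.tgt (d.a i j x) := fun i j x hx => by
    rw [htgt i j x hx, d'.tgt_a i j x hx]
  have ha : ∀ i j, ∀ x ∈ (U i ∩ U j : Set N),
      E.R.mul (E.chi (d'.s i x) (v i j x)) (d.a i j x) = d'.a i j x := fun i j x hx =>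
    E.chi_quot_mul (d'.src_a i j x hx) (hsrc i j x hx) (htt i j x hx)
  have hsm : ∀ i j, ∀ x ∈ (U i ∩ U j : Set N), E.P.smul (d.a i j x) (d'.s j x) =
      E.P.act (d'.s i x) (r i x * c.lam i j x * (r j x)⁻¹) := fun i j x hx => by
    rw [← hs i x hx.1, ← hs j x hx.2, d.smul_act_inv hx]
  have hlam : ∀ i j, ∀ x ∈ (U i ∩ U j : Set N),
      c'.lam i j x = X.ρ (v i j x) * r i x * c.lam i j x * (r j x)⁻¹ := fun i j x hx => by
    refine PrincipalBundle.act_injective (x := d'.s i x) ?_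
    rw [← d'.smul_s i j x hx, ← ha i j x hx, E.chi_mul_smul (htgt i j x hx) (hsm i j x hx)]
    simp only [mul_assoc]
  refine ⟨r, v, fun i => PrincipalBundle.contMDiffOn_div (d'.s_smooth i) (d.s_smooth i) (h i),
    fun i j => Extension.contMDiffOn_quot ((d'.s_smooth i).mono inter_subset_left)
      (d'.a_smooth i j) (d.a_smooth i j) (d'.src_a i j) (hsrc i j) (htt i j), hlam,
    fun i j k x hx => ?_⟩
  have hik : x ∈ (U i ∩ U k : Set N) := ⟨hx.1.1, hx.2⟩
  have hjk : x ∈ (U j ∩ U k : Set N) := ⟨hx.1.2, hx.2⟩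
  refine E.chi_mul_injective (hsrc i k x hik) ?_
  have h1 := d.mul_act_inv hx (r i x)
  rw [hs i x hx.1.1] at h1
  rw [← E.chi_mul_chi_mul (hsrc i k x hik), ha i k x hik, ← d'.mul_a i j k x hx,
    ← ha i j x hx.1, ← ha j k x hjk, E.mul_normal_form (htgt i j x hx.1) (hsm i j x hx.1)
      (hsrc j k x hjk) (hsrc i k x hik) h1, hlam i j x hx.1, mul_assoc (X.ρ _), mul_assoc (X.ρ _),
      map_mul X.j (X.ρ _), MulAut.mul_apply, X.peiffer]
  simp only [mul_assoc, inv_mul_cancel_left]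

end LocalData

end Groups

/-! ### Existence, uniqueness and Morita invariance of the cocycle of an extension -/

section Groups

variable {EG HG : Type} [NormedAddCommGroup EG] [NormedSpace ℝ EG] [TopologicalSpace HG]
  {IG : ModelWithCorners ℝ EG HG} {G : Type u} [Group G] [TopologicalSpace G] [ChartedSpace HG G]
  {EH HH : Type} [NormedAddCommGroup EH] [NormedSpace ℝ EH] [TopologicalSpace HH]
  {IH : ModelWithCorners ℝ EH HH} {H : Type u} [Group H] [TopologicalSpace H] [ChartedSpace HH H]
  {EN HN : Type} [NormedAddCommGroup EN] [NormedSpace ℝ EN] [TopologicalSpace HN]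
  {IN : ModelWithCorners ℝ EN HN} {N : Type u} [TopologicalSpace N] [ChartedSpace HN N]
  {X : LieCrossedModule IG G IH H}

theorem PrincipalBundle.exists_local_section {M : SmoothMfd.{u}} {Γ : LieGroupoid M}
    (P : PrincipalBundle IH H Γ) (m : M) : ∃ (V : Set M) (t : M → P.total), IsOpen V ∧ m ∈ V ∧
      ContMDiffOn M.model P.total.model ∞ t V ∧ ∀ x ∈ V, P.proj (t x) = x := by
  obtain ⟨V, τ, hV, hm, hs, -, hτ, -, hp, -⟩ := P.locally_trivial m
  exact ⟨V, fun x => τ (x, 1), hV, hm, hτ.comp (contMDiffOn_id.prodMk contMDiffOn_const)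
    fun x hx => by rw [hs]; exact ⟨hx, trivial⟩, fun x hx => hp x hx 1⟩

namespace Extension

variable (E : Extension IN N X)

/-- Over a neighbourhood of every point of `N` there is a smooth section of `P`. -/
theorem exists_local_section (x : N) : ∃ (V : Opens N) (s : N → E.P.total), x ∈ V ∧
      ContMDiffOn IN E.P.total.model ∞ s V ∧ ∀ y ∈ V, E.q (E.P.proj (s y)) = y := by
  obtain ⟨m, rfl⟩ := E.q_surjective x
  obtain ⟨V, s, hV, hm, hsm, hs, hqs⟩ :=
    exists_local_section_of_isSubmersionAt (E.q_submersion.isSubmersionAt m)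
  obtain ⟨W, t, hW, hmW, ht, hpt⟩ := E.P.exists_local_section m
  refine ⟨⟨V ∩ s ⁻¹' W, hs.continuousOn.isOpen_inter_preimage hV hW⟩, fun y => t (s y),
    ⟨hm, by rwa [mem_preimage, hsm]⟩, ht.comp (hs.mono inter_subset_left) fun y hy => hy.2,
    fun y hy => by rw [hpt _ hy.2, hqs y hy.1]⟩

/-- Every extension is given by a cocycle. -/
theorem exists_localData [LieGroup IH ∞ H] [T2Space N] [ParacompactSpace N] :
    ∃ c : CoverCocycle IN N X, Nonempty (LocalData E c.cocycle) := by
  choose U s hxU hs hqs using E.exists_local_section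
  have hU : IsOpenCover U := IsOpenCover.of_sets (fun x => (U x).2)
    (iUnion_eq_univ_iff.2 fun x => ⟨x, hxU x⟩)
  -- A set is good for `i, j` when a single smooth family of arrows joins the points under `s i` and
  -- `s j` over all of it. The submersion `R → N[q]` ensures this only locally on `U i ∩ U j`.
  obtain ⟨V, σ, hxV, hVU, hgood⟩ := exists_refinement_of_local_on_inter hU
    (fun i j W => ∃ a : N → E.R.arrows, ContMDiffOn IN E.R.arrows.model ∞ a W ∧
      ∀ x ∈ W, E.R.src (a x) = E.P.proj (s i x) ∧ E.R.tgt (a x) = E.P.proj (s j x))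
    (fun i j W W' hW ⟨a, ha, ha'⟩ => ⟨a, ha.mono hW, fun x hx => ha' x (hW hx)⟩)
    (fun i j x hx => by
      obtain ⟨W, a, hW, hxW, -, ha, ha'⟩ := E.exists_local_arrow
        ((U i).2.inter (U j).2)
        (E.P.proj_smooth.comp_contMDiffOn ((hs i).mono inter_subset_left))
        (E.P.proj_smooth.comp_contMDiffOn ((hs j).mono inter_subset_right))
        (fun y hy => by
          change E.q (E.P.proj (s i y)) = E.q (E.P.proj (s j y))
          rw [hqs i y hy.1, hqs j y hy.2]) hx
      exact ⟨W, hW, hxW, a, ha, ha'⟩)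
  have ha : ∀ x y, ∃ a : N → E.R.arrows,
      ContMDiffOn IN E.R.arrows.model ∞ a (V x ∩ V y) ∧
      (∀ z ∈ (V x ∩ V y : Set N), E.R.src (a z) = E.P.proj (s (σ x) z) ∧
        E.R.tgt (a z) = E.P.proj (s (σ y) z)) ∧
      (x = y → ∀ z, a z = E.R.unit (E.P.proj (s (σ x) z))) := by
    intro x y
    -- Units are imposed on the diagonal for the normalisation `𝐠_iij = e`; on an empty intersection
    -- any function will do.
    by_cases hxy : x = y
    · subst hxy
      refine ⟨fun z => E.R.unit (E.P.proj (s (σ x) z)), ?_, fun z _ =>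
        ⟨E.R.src_unit _, E.R.tgt_unit _⟩, fun _ _ => rfl⟩
      exact (E.R.unit_smooth.comp E.P.proj_smooth).comp_contMDiffOn
        ((hs (σ x)).mono fun z hz => hVU x hz.1)
    · by_cases hne : (V x ∩ V y : Set N).Nonempty
      · obtain ⟨a, h1, h2⟩ := hgood x y hne
        exact ⟨a, h1, h2, fun h => absurd h hxy⟩
      · rw [not_nonempty_iff_eq_empty] at hne
        rw [hne]
        exact ⟨fun z => E.R.unit (E.P.proj (s (σ x) z)), fun z hz => hz.elim,
          fun z hz => hz.elim, fun h => absurd h hxy⟩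
  choose a ha hst haa using ha
  obtain ⟨c, hc⟩ := exists_cocycle_of_sections (X := X) (E := E) (U := V) (fun x => s (σ x)) a
    (fun x => (hs (σ x)).mono (hVU x)) ha (fun x z hz => hqs _ z (hVU x hz))
    (fun x y z hz => (hst x y z hz).1) (fun x y z hz => (hst x y z hz).2)
    (fun x z _ => haa x x rfl z)
  exact ⟨⟨N, V, IsOpenCover.of_sets (fun x => (V x).2)
    (iUnion_eq_univ_iff.2 fun x => ⟨x, hxV x⟩), c⟩, hc⟩

end Extension

theorem Cocycle.related_refl {ι : Type u} {U : ι → Opens N} (c : Cocycle IN X U) :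
    c.Related c :=
  ⟨fun _ _ => 1, fun _ _ _ => 1, fun _ => contMDiffOn_const, fun _ _ => contMDiffOn_const,
    fun _ _ _ _ => by simp, fun _ _ _ _ _ => by simp⟩

namespace CoverCocycle

/-- The restriction of a cocycle to a refinement of its cover. -/
def refine (c : CoverCocycle IN N X) {κ : Type u} (V : κ → Opens N) (hV : IsOpenCover V)
    (σ : κ → c.ι) (hσ : ∀ k, V k ≤ c.U (σ k)) : CoverCocycle IN N X :=
  ⟨κ, V, hV, c.cocycle.pullback σ hσ⟩

theorem cohomologous_refine (c : CoverCocycle IN N X) {κ : Type u} (V : κ → Opens N)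
    (hV : IsOpenCover V) (σ : κ → c.ι) (hσ : ∀ k, V k ≤ c.U (σ k)) :
    c.Cohomologous (c.refine V hV σ hσ) :=
  ⟨κ, V, σ, id, hσ, fun _ => le_rfl, hV, Cocycle.related_refl (c.cocycle.pullback σ hσ)⟩

/-- Cocycles defining the same extension are cohomologous. -/
theorem cohomologous_of_localData [LieGroup IH ∞ H] {E : Extension IN N X}
    {c c' : CoverCocycle IN N X} (d : LocalData E c.cocycle) (d' : LocalData E c'.cocycle) :
    c.Cohomologous c' := by
  -- On small sets, arrows `b` join the point under `s'` to the point under `s`. Moving the first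
  -- data along `b` keeps its cocycle and puts both data over the same points. Each `b` involves a
  -- single set of the cover, so no control of double intersections is needed.
  have key : ∀ x, ∃ (V : Opens N) (i : c.ι) (i' : c'.ι) (b : N → E.R.arrows), x ∈ V ∧
      V ≤ c.U i ∧ V ≤ c'.U i' ∧ ContMDiffOn IN E.R.arrows.model ∞ b V ∧
      ∀ y ∈ V, E.R.src (b y) = E.P.proj (d'.s i' y) ∧ E.R.tgt (b y) = E.P.proj (d.s i y) := by
    intro x
    obtain ⟨i, hi⟩ := c.isOpenCover.exists_mem x
    obtain ⟨i', hi'⟩ := c'.isOpenCover.exists_mem x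
    obtain ⟨V, b, hV, hxV, hVU, hb, hb'⟩ := E.exists_local_arrow
      ((c'.U i').2.inter (c.U i).2)
      (E.P.proj_smooth.comp_contMDiffOn ((d'.s_smooth i').mono inter_subset_left))
      (E.P.proj_smooth.comp_contMDiffOn ((d.s_smooth i).mono inter_subset_right))
      (fun y hy => by
        change E.q (E.P.proj (d'.s i' y)) = E.q (E.P.proj (d.s i y))
        rw [d'.q_s i' y hy.1, d.q_s i y hy.2]) ⟨hi', hi⟩
    exact ⟨⟨V, hV⟩, i, i', b, hxV, fun y hy => (hVU hy).2, fun y hy => (hVU hy).1, hb, hb'⟩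
  choose V σ σ' b hxV hσ hσ' hb hst using key
  refine ⟨N, V, σ, σ', hσ, hσ', IsOpenCover.of_sets (fun x => (V x).2)
    (iUnion_eq_univ_iff.2 fun x => ⟨x, hxV x⟩), ?_⟩
  have ht : ∀ i, ∀ x ∈ V i, E.R.tgt (b i x) = E.P.proj ((d.pullback σ hσ).s i x) :=
    fun i x hx => (hst i x hx).2
  refine LocalData.related ((d.pullback σ hσ).move b hb ht) (d'.pullback σ' hσ') fun i x hx => ?_
  exact ((E.P.proj_smul _ _ (ht i x hx)).trans (hst i x hx).1).symm

end CoverCocycle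

/-- Local data for `E` lifted to `M'` give local data for any extension `E'` with an isomorphic
pull-back to `M'`. -/
theorem LocalData.exists_of_pullbackIsomorphic {E E' : Extension IN N X} {M' : SmoothMfd.{u}}
    {p : M' → E.base} {p' : M' → E'.base} (hq : ∀ x, E.q (p x) = E'.q (p' x))
    (h : E.PullbackIsomorphic E' p p') {ι : Type u} {U : ι → Opens N} {c : Cocycle IN X U}
    (d : LocalData E c) (t : ι → N → M') (ht : ∀ i, ContMDiffOn IN M'.model ∞ (t i) (U i))
    (hpt : ∀ i, ∀ x ∈ U i, p (t i x) = E.P.proj (d.s i x)) : Nonempty (LocalData E' c) := by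
  obtain ⟨Φ, Ψ, hΦs, hΦt, hΦ, -, hΦ1, hΦmul, hΨs, hΨt, hΨ, -, hΨ1, hΨact, hchi⟩ := h
  have memS : ∀ i, ∀ x ∈ U i, ∀ h, (E.P.act (d.s i x) h, t i x) ∈ Ψ.source := fun i x hx h => by
    rw [hΨs]
    change E.P.proj _ = p _
    rw [E.P.proj_act, hpt i x hx]
  have memS1 : ∀ i, ∀ x ∈ U i, (d.s i x, t i x) ∈ Ψ.source := fun i x hx => by
    simpa [E.P.act_one] using memS i x hx 1
  have memA : ∀ i j, ∀ x ∈ (U i ∩ U j : Set N), (t i x, d.a i j x, t j x) ∈ Φ.source :=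
    fun i j x hx => by
      rw [hΦs]
      exact ⟨(d.src_a i j x hx).trans (hpt i x hx.1).symm,
        (d.tgt_a i j x hx).trans (hpt j x hx.2).symm⟩
  have memC : ∀ i, ∀ x ∈ U i, ∀ g, (t i x, E.chi (d.s i x) g, t i x) ∈ Φ.source :=
    fun i x hx g => by
      rw [hΦs]
      exact ⟨(E.src_chi _ _).trans (hpt i x hx).symm, (E.tgt_chi _ _).trans (hpt i x hx).symm⟩
  have projS : ∀ i, ∀ x ∈ U i, E'.P.proj (Ψ (d.s i x, t i x)).1 = p' (t i x) := fun i x hx => by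
    have := Ψ.map_source (memS1 i x hx)
    rw [hΨt] at this
    exact this.trans (congrArg p' (hΨ1 _ (memS1 i x hx)))
  have stA : ∀ i j, ∀ x ∈ (U i ∩ U j : Set N),
      E'.R.src (Φ (t i x, d.a i j x, t j x)).2.1 = p' (t i x) ∧
      E'.R.tgt (Φ (t i x, d.a i j x, t j x)).2.1 = p' (t j x) := fun i j x hx => by
    have := Φ.map_source (memA i j x hx)
    rw [hΦt] at this
    exact ⟨this.1.trans (congrArg p' (hΦ1 _ (memA i j x hx)).1),
      this.2.trans (congrArg p' (hΦ1 _ (memA i j x hx)).2)⟩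
  -- The lifts `(s_i, t_i)` in `p^*P` and `(t_i, a_ij, t_j)` in `R[p]` are carried over by `Ψ` and
  -- `Φ`, then projected to `E'`.
  refine ⟨⟨fun i x => (Ψ (d.s i x, t i x)).1, fun i j x => (Φ (t i x, d.a i j x, t j x)).2.1,
    fun i => ?_, fun i j => ?_, fun i x hx => ?_, fun i j x hx => ?_, fun i j x hx => ?_,
    fun i j x hx => ?_, fun i j k x hx => ?_⟩⟩
  · exact contMDiff_fst.comp_contMDiffOn (hΨ.comp ((d.s_smooth i).prodMk (ht i)) (memS1 i))
  · refine (contMDiff_fst.comp contMDiff_snd).comp_contMDiffOn (hΦ.comp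
      (((ht i).mono inter_subset_left).prodMk ((d.a_smooth i j).prodMk
        ((ht j).mono inter_subset_right))) (memA i j))
  · rw [projS i x hx, ← hq, hpt i x hx, d.q_s i x hx]
  · rw [(stA i j x hx).1, projS i x hx.1]
  · rw [(stA i j x hx).2, projS j x hx.2]
  -- The equivariance of `Ψ` is used on `a_ij • s_j • λ_ij⁻¹ = s_i`.
  · have h1 := hΨact _ (memA i j x hx) _ (memS1 j x hx.2) (c.lam i j x)⁻¹ rfl
    have h2 : E.pullAct (E.pullSmul (t i x, d.a i j x, t j x) (d.s j x, t j x)) (c.lam i j x)⁻¹ =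
        (d.s i x, t i x) := by
      change (E.P.act (E.P.smul (d.a i j x) (d.s j x)) (c.lam i j x)⁻¹, t i x) = _
      rw [d.smul_s i j x hx, ← E.P.act_mul, mul_inv_cancel, E.P.act_one]
    rw [h2] at h1
    change _ = E'.P.act (Ψ (d.s i x, t i x)).1 _
    rw [h1]
    change _ = E'.P.act (E'.P.act (E'.P.smul _ _) _) _
    rw [← E'.P.act_mul, inv_mul_cancel, E'.P.act_one]
  · have hik : x ∈ (U i ∩ U k : Set N) := ⟨hx.1.1, hx.2⟩
    have hjk : x ∈ (U j ∩ U k : Set N) := ⟨hx.1.2, hx.2⟩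
    have h1 := hΦmul _ (memA i j x hx.1) _ (memA j k x hjk) rfl
    have h2 := hΦmul _ (memC i x hx.1.1 (c.gg i j k x)) _ (memA i k x hik) rfl
    have h3 : E.pullMul (t i x, d.a i j x, t j x) (t j x, d.a j k x, t k x) =
        E.pullMul (t i x, E.chi (d.s i x) (c.gg i j k x), t i x) (t i x, d.a i k x, t k x) := by
      simp only [Extension.pullMul, d.mul_a i j k x hx]
    rw [h3, h2] at h1
    have h4 := hchi _ (memS1 i x hx.1.1) (c.gg i j k x)
    have h5 : E.pullChi (d.s i x, t i x) (c.gg i j k x) =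
      (t i x, E.chi (d.s i x) (c.gg i j k x), t i x) := rfl
    rw [← h5, ← h4] at h1
    exact (congrArg (fun z => z.2.1) h1).symm

/-- Morita equivalent extensions are given by cohomologous cocycles. -/
theorem LocalData.exists_of_moritaEquivalent {E E' : Extension IN N X}
    (h : E.MoritaEquivalent E') {c : CoverCocycle IN N X} (d : LocalData E c.cocycle) :
    ∃ c' : CoverCocycle IN N X, c.Cohomologous c' ∧ Nonempty (LocalData E' c'.cocycle) := by
  obtain ⟨M', p, p', hps, hp, -, -, hq, hiso⟩ := h
  -- Local sections of the surjective submersion `p` lift the points under `s i` to `M'`, on a finer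
  -- cover.
  have key : ∀ x, ∃ (V : Opens N) (i : c.ι) (t : N → M'), x ∈ V ∧ V ≤ c.U i ∧
      ContMDiffOn IN M'.model ∞ t V ∧ ∀ y ∈ V, p (t y) = E.P.proj (d.s i y) := by
    intro x
    obtain ⟨i, hi⟩ := c.isOpenCover.exists_mem x
    obtain ⟨y, hy⟩ := hps (E.P.proj (d.s i x))
    obtain ⟨W, t, hW, hyW, -, ht, hpt⟩ :=
      exists_local_section_of_isSubmersionAt (hp.isSubmersionAt y)
    have hs := E.P.proj_smooth.comp_contMDiffOn (d.s_smooth i)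
    refine ⟨⟨c.U i ∩ (fun z => E.P.proj (d.s i z)) ⁻¹' W,
      hs.continuousOn.isOpen_inter_preimage (c.U i).2 hW⟩, i, fun z => t (E.P.proj (d.s i z)),
      ⟨hi, by rw [mem_preimage, ← hy]; exact hyW⟩, fun z hz => hz.1, ?_, fun z hz => hpt _ hz.2⟩
    exact ht.comp (hs.mono inter_subset_left) fun z hz => hz.2
  choose V σ t hxV hσ ht hpt using key
  have hV : IsOpenCover V := IsOpenCover.of_sets (fun x => (V x).2)
    (iUnion_eq_univ_iff.2 fun x => ⟨x, hxV x⟩)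
  exact ⟨c.refine V hV σ hσ, c.cohomologous_refine V hV σ hσ,
    LocalData.exists_of_pullbackIsomorphic hq hiso (d.pullback σ hσ) t ht hpt⟩

end Groups

/-! ### The groupoid of the adapted extension -/

/-- The product of two manifolds. -/
noncomputable def prodMfd {E H : Type} [NormedAddCommGroup E] [NormedSpace ℝ E]
    [FiniteDimensional ℝ E] [TopologicalSpace H] (M : SmoothMfd.{u}) (I : ModelWithCorners ℝ E H)
    [I.Boundaryless] (Y : Type u) [TopologicalSpace Y] [ChartedSpace H Y] [IsManifold I ∞ Y]
    [T2Space Y] : SmoothMfd.{u} where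
  carrier := M × Y
  modelVec := M.modelVec × E
  modelSpace := ModelProd M.modelSpace H
  model := M.model.prod I

section Groups

variable {EG HG : Type} [NormedAddCommGroup EG] [NormedSpace ℝ EG] [TopologicalSpace HG]
  {IG : ModelWithCorners ℝ EG HG} {G : Type u} [Group G] [TopologicalSpace G] [ChartedSpace HG G]
  {EH HH : Type} [NormedAddCommGroup EH] [NormedSpace ℝ EH] [TopologicalSpace HH]
  {IH : ModelWithCorners ℝ EH HH} {H : Type u} [Group H] [TopologicalSpace H] [ChartedSpace HH H]
  {EN HN : Type} [NormedAddCommGroup EN] [NormedSpace ℝ EN] [TopologicalSpace HN]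
  {IN : ModelWithCorners ℝ EN HN} {N : Type u} [TopologicalSpace N] [ChartedSpace HN N]
  {X : LieCrossedModule IG G IH H}

namespace Cocycle

variable {ι : Type u} {U : ι → Opens N} (c : Cocycle IN X U) {i j k l : ι} {x : N}

theorem lam_self (hi : x ∈ U i) : c.lam i i x = 1 := by
  have h := c.rho_gg i i i x ⟨⟨hi, hi⟩, hi⟩
  rw [c.gg_self i i x ⟨hi, hi⟩, map_one, one_mul] at h
  exact (left_eq_mul.1 h)

theorem gg_self_right (hi : x ∈ U i) (hj : x ∈ U j) : c.gg i j j x = 1 := by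
  have h := c.gg_gg i j j j x ⟨⟨⟨hi, hj⟩, hj⟩, hj⟩
  rw [c.gg_self j j x ⟨hj, hj⟩, map_one, one_mul] at h
  exact mul_eq_left.1 h

/-- By `rho_gg` and the Peiffer identity, `λ_ij λ_jk` acts on `G` as `λ_ik` followed by conjugation
by `𝐠_ijk`. With `gg_gg` this is the associativity of the product of arrows. -/
theorem gg_mul_j (hi : x ∈ U i) (hj : x ∈ U j) (hk : x ∈ U k) (g : G) :
    c.gg i j k x * X.j (c.lam i k x) g =
      X.j (c.lam i j x) (X.j (c.lam j k x) g) * c.gg i j k x := by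
  rw [← MulAut.mul_apply, ← map_mul, ← c.rho_gg i j k x ⟨⟨hi, hj⟩, hk⟩, map_mul,
    MulAut.mul_apply, X.peiffer, inv_mul_cancel_right]

/-- The cocycle identity for the indices `i, j, i, j`; it makes the right inverse of an arrow a left
inverse. -/
theorem gg_eq (hi : x ∈ U i) (hj : x ∈ U j) :
    c.gg i j i x = X.j (c.lam i j x) (c.gg j i j x) := by
  have h := c.gg_gg i j i j x ⟨⟨⟨hi, hj⟩, hi⟩, hj⟩
  rwa [c.gg_self i j x ⟨hi, hj⟩, c.gg_self_right hi hj, mul_one, mul_one] at h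

theorem mul_assoc_aux (hi : x ∈ U i) (hj : x ∈ U j) (hk : x ∈ U k) (hl : x ∈ U l) (a b d : G) :
    a * X.j (c.lam i j x) b * c.gg i j k x * X.j (c.lam i k x) d * c.gg i k l x =
      a * X.j (c.lam i j x) (b * X.j (c.lam j k x) d * c.gg j k l x) * c.gg i j l x := by
  rw [map_mul, map_mul]
  simp only [mul_assoc]
  rw [← c.gg_gg i j k l x ⟨⟨⟨hi, hj⟩, hk⟩, hl⟩, ← mul_assoc (c.gg i j k x) (X.j _ _),
    c.gg_mul_j hi hj hk]
  simp only [mul_assoc]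

end Cocycle

namespace CoverCocycle

variable (c : CoverCocycle IN N X)

/-- The domain `U i ∩ U j × G` of a coordinate of the arrows of the adapted extension. -/
def arrowOpens (k : c.ι × c.ι) : Opens (N × G) :=
  ⟨(c.U k.1 ∩ c.U k.2 : Set N) ×ˢ univ, ((c.U k.1).2.inter (c.U k.2).2).prod isOpen_univ⟩

variable [FiniteDimensional ℝ EN] [IN.Boundaryless] [IsManifold IN ∞ N] [T2Space N]

/-- The base `∐ U i` of the adapted extension. -/
noncomputable def adaptedBase : SmoothMfd.{u} := sheets IN c.U

theorem contMDiffOn_adaptedBase {E' H' : Type*} [NormedAddCommGroup E'] [NormedSpace ℝ E']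
    [TopologicalSpace H'] {J : ModelWithCorners ℝ E' H'} {Z : Type*} [TopologicalSpace Z]
    [ChartedSpace H' Z] {c : CoverCocycle IN N X} {f : Z → c.adaptedBase} {s : Set Z}
    (hidx : LocConstOn (fun z => sheets.idx (I := IN) (W := c.U) (f z)) s)
    (hpt : ContMDiffOn J IN ∞ (fun z => sheets.pt (I := IN) (W := c.U) (f z)) s) :
    ContMDiffOn J c.adaptedBase.model ∞ f s :=
  sheets.contMDiffOn_of_pt (I := IN) (W := c.U) hidx hpt

variable [FiniteDimensional ℝ EG] [IG.Boundaryless] [LieGroup IG ∞ G] [T2Space G]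

/-- The arrows `∐ U i ∩ U j × G` of the adapted extension. -/
noncomputable def adaptedArrows : SmoothMfd.{u} := sheets (IN.prod IG) c.arrowOpens

variable {c}

/-- The arrow `(g, x_ij)`. -/
noncomputable def arrowMk (i j : c.ι) (x : N) (g : G) (hi : x ∈ c.U i) (hj : x ∈ c.U j) :
    c.adaptedArrows :=
  sheets.mk (I := IN.prod IG) (W := c.arrowOpens) (i, j) (x, g) ⟨⟨hi, hj⟩, trivial⟩

/-- The first component `g` of `(g, x_ij)`. -/
noncomputable def arrowVal (r : c.adaptedArrows) : G :=
  (sheets.pt (I := IN.prod IG) (W := c.arrowOpens) r).2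

/-- The point `x` of `(g, x_ij)`. -/
noncomputable def arrowPt (r : c.adaptedArrows) : N :=
  (sheets.pt (I := IN.prod IG) (W := c.arrowOpens) r).1

/-- The indices `(i, j)` of `(g, x_ij)`. -/
noncomputable def arrowIdx (r : c.adaptedArrows) : c.ι × c.ι :=
  sheets.idx (I := IN.prod IG) (W := c.arrowOpens) r

theorem arrowPt_mem_left (r : c.adaptedArrows) : arrowPt r ∈ c.U (arrowIdx r).1 :=
  (sheets.pt_mem (I := IN.prod IG) (W := c.arrowOpens) r).1.1

theorem arrowPt_mem_right (r : c.adaptedArrows) : arrowPt r ∈ c.U (arrowIdx r).2 :=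
  (sheets.pt_mem (I := IN.prod IG) (W := c.arrowOpens) r).1.2

theorem arrowMk_eta (r : c.adaptedArrows) :
    arrowMk (arrowIdx r).1 (arrowIdx r).2 (arrowPt r) (arrowVal r) (arrowPt_mem_left r)
      (arrowPt_mem_right r) = r := rfl

theorem arrow_ext {r r' : c.adaptedArrows} (h : arrowIdx r = arrowIdx r')
    (h' : arrowPt r = arrowPt r') (h'' : arrowVal r = arrowVal r') : r = r' :=
  sheets.ext (I := IN.prod IG) (W := c.arrowOpens) (Prod.ext h' h'') h

/-- The source `x_i` of `(g, x_ij)`. -/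
noncomputable def arrowSrc (r : c.adaptedArrows) : c.adaptedBase :=
  sheets.mk (arrowIdx r).1 (arrowPt r) (arrowPt_mem_left r)

/-- The target `x_j` of `(g, x_ij)`. -/
noncomputable def arrowTgt (r : c.adaptedArrows) : c.adaptedBase :=
  sheets.mk (arrowIdx r).2 (arrowPt r) (arrowPt_mem_right r)

theorem arrow_comp {r r' : c.adaptedArrows} (h : arrowTgt r = arrowSrc r') :
    (arrowIdx r).2 = (arrowIdx r').1 ∧ arrowPt r = arrowPt r' :=
  ⟨congrArg (sheets.idx (I := IN) (W := c.U)) h, congrArg (sheets.pt (I := IN) (W := c.U)) h⟩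

/-- The unit `(1, x_ii)`. -/
noncomputable def arrowUnit (m : c.adaptedBase) : c.adaptedArrows :=
  arrowMk (sheets.idx (I := IN) (W := c.U) m) (sheets.idx (I := IN) (W := c.U) m)
    (sheets.pt (I := IN) (W := c.U) m) 1 (sheets.pt_mem m) (sheets.pt_mem m)

/-- The product `(g, x_ij) • (g', x_jk) = (g λ_ij(g') g_ijk, x_ik)`. -/
noncomputable def arrowMul (r r' : c.adaptedArrows) : c.adaptedArrows :=
  -- The default value `r` is never taken on composable arrows.
  sheets.mkD (I := IN.prod IG) (W := c.arrowOpens) r ((arrowIdx r).1, (arrowIdx r').2)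
    (arrowPt r, arrowVal r * X.j (c.cocycle.lam (arrowIdx r).1 (arrowIdx r).2 (arrowPt r))
      (arrowVal r') * c.cocycle.gg (arrowIdx r).1 (arrowIdx r).2 (arrowIdx r').2 (arrowPt r))

theorem arrowMul_mk (i j k : c.ι) (x : N) (g g' : G) (hi : x ∈ c.U i) (hj : x ∈ c.U j)
    (hk : x ∈ c.U k) : arrowMul (arrowMk i j x g hi hj) (arrowMk j k x g' hj hk) =
      arrowMk i k x (g * X.j (c.cocycle.lam i j x) g' * c.cocycle.gg i j k x) hi hk :=
  sheets.mkD_eq (I := IN.prod IG) (W := c.arrowOpens) _ ⟨⟨hi, hk⟩, trivial⟩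

/-- The inverse of `(g, x_ij)`. -/
noncomputable def arrowInv (r : c.adaptedArrows) : c.adaptedArrows :=
  -- The `G`-component is the solution `g'` of `g λ_ij(g') 𝐠_iji = e`.
  arrowMk (arrowIdx r).2 (arrowIdx r).1 (arrowPt r)
    (X.j (c.cocycle.lam (arrowIdx r).1 (arrowIdx r).2 (arrowPt r))⁻¹ ((arrowVal r)⁻¹ *
      (c.cocycle.gg (arrowIdx r).1 (arrowIdx r).2 (arrowIdx r).1 (arrowPt r))⁻¹))
    (arrowPt_mem_right r) (arrowPt_mem_left r)

theorem exists_arrow_eq (r : c.adaptedArrows) : ∃ (i j : c.ι) (x : N) (g : G) (hi : x ∈ c.U i)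
    (hj : x ∈ c.U j), r = arrowMk i j x g hi hj := ⟨_, _, _, _, _, _, (arrowMk_eta r).symm⟩

theorem exists_arrow_eq_of_src_eq {j : c.ι} {x : N} (hj : x ∈ c.U j) (r : c.adaptedArrows)
    (h : sheets.mk j x hj = arrowSrc r) : ∃ (k : c.ι) (g : G) (hk : x ∈ c.U k),
      r = arrowMk j k x g hj hk := by
  have h1 : j = (arrowIdx r).1 := congrArg (sheets.idx (I := IN) (W := c.U)) h
  have h2 : x = arrowPt r := congrArg (sheets.pt (I := IN) (W := c.U)) h
  subst h1 h2
  exact ⟨_, _, _, (arrowMk_eta r).symm⟩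

theorem arrowMk_congr {i j : c.ι} {x : N} {g g' : G} {hi : x ∈ c.U i} {hj : x ∈ c.U j}
    (h : g = g') : arrowMk i j x g hi hj = arrowMk i j x g' hi hj := by subst h; rfl

section Smooth

variable {E' H' : Type*} [NormedAddCommGroup E'] [NormedSpace ℝ E'] [TopologicalSpace H']
  {J : ModelWithCorners ℝ E' H'} {Z : Type*} [TopologicalSpace Z] [ChartedSpace H' Z]

theorem contMDiff_arrowPt : ContMDiff c.adaptedArrows.model IN ∞ (arrowPt (c := c)) :=
  contMDiff_fst.comp (sheets.contMDiff_pt (I := IN.prod IG) (W := c.arrowOpens))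

theorem contMDiff_arrowVal : ContMDiff c.adaptedArrows.model IG ∞ (arrowVal (c := c)) :=
  contMDiff_snd.comp (sheets.contMDiff_pt (I := IN.prod IG) (W := c.arrowOpens))

theorem locConst_arrowIdx : LocConstOn (arrowIdx (c := c)) univ :=
  sheets.locConst_idx (I := IN.prod IG) (W := c.arrowOpens)

theorem contMDiffOn_adaptedArrows {f : Z → c.adaptedArrows} {s : Set Z}
    (hidx : LocConstOn (fun z => arrowIdx (f z)) s)
    (hpt : ContMDiffOn J IN ∞ (fun z => arrowPt (f z)) s)
    (hval : ContMDiffOn J IG ∞ (fun z => arrowVal (f z)) s) :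
    ContMDiffOn J c.adaptedArrows.model ∞ f s :=
  sheets.contMDiffOn_of_pt (I := IN.prod IG) (W := c.arrowOpens) hidx (hpt.prodMk hval)

theorem contMDiff_arrowSrc :
    ContMDiff c.adaptedArrows.model c.adaptedBase.model ∞ (arrowSrc (c := c)) :=
  contMDiffOn_univ.1 (contMDiffOn_adaptedBase (locConst_arrowIdx.map Prod.fst)
    contMDiff_arrowPt.contMDiffOn)

theorem contMDiff_arrowTgt :
    ContMDiff c.adaptedArrows.model c.adaptedBase.model ∞ (arrowTgt (c := c)) :=
  contMDiffOn_univ.1 (contMDiffOn_adaptedBase (locConst_arrowIdx.map Prod.snd)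
    contMDiff_arrowPt.contMDiffOn)

theorem contMDiff_arrowUnit :
    ContMDiff c.adaptedBase.model c.adaptedArrows.model ∞ (arrowUnit (c := c)) :=
  contMDiffOn_univ.1 (contMDiffOn_adaptedArrows
    ((sheets.locConst_idx (I := IN) (W := c.U)).map fun i => (i, i))
    (sheets.contMDiff_pt (I := IN) (W := c.U)).contMDiffOn contMDiffOn_const)

theorem isSubmersion_arrowSrc :
    IsSubmersion c.adaptedArrows.model c.adaptedBase.model ∞ (arrowSrc (c := c)) :=
  sheets.isSubmersion_of_pt_comp (I := IN) (W := c.U) contMDiff_arrowSrc.continuous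
    (sheets.isSubmersion_comp_pt (I := IN.prod IG) (W := c.arrowOpens)
      isSubmersionOfComplement_fst.isSubmersion)

theorem isSubmersion_arrowTgt :
    IsSubmersion c.adaptedArrows.model c.adaptedBase.model ∞ (arrowTgt (c := c)) :=
  sheets.isSubmersion_of_pt_comp (I := IN) (W := c.U) contMDiff_arrowTgt.continuous
    (sheets.isSubmersion_comp_pt (I := IN.prod IG) (W := c.arrowOpens)
      isSubmersionOfComplement_fst.isSubmersion)

theorem contMDiff_arrowLam : ContMDiff c.adaptedArrows.model IH ∞ fun r : c.adaptedArrows =>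
    c.cocycle.lam (arrowIdx r).1 (arrowIdx r).2 (arrowPt r) :=
  contMDiffOn_univ.1 (locConst_arrowIdx.contMDiffOn fun k =>
    ((c.cocycle.lam_smooth k.1 k.2).comp contMDiff_arrowPt.contMDiffOn (fun r hr => by
      obtain rfl : arrowIdx r = k := hr.2
      exact ⟨arrowPt_mem_left r, arrowPt_mem_right r⟩)).congr fun r hr => by
        obtain rfl : arrowIdx r = k := hr.2
        rfl)

/-- The maps `lam` and `gg` are smooth for fixed indices only, but the indices of a pair of arrows
are locally constant. -/
theorem contMDiffOn_arrowMul : ContMDiffOn (c.adaptedArrows.model.prod c.adaptedArrows.model)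
    c.adaptedArrows.model ∞ (fun z : c.adaptedArrows × c.adaptedArrows => arrowMul z.1 z.2)
    {z | arrowTgt z.1 = arrowSrc z.2} := by
  set S := {z : c.adaptedArrows × c.adaptedArrows | arrowTgt z.1 = arrowSrc z.2}
  have hmem : ∀ z ∈ S, arrowPt z.1 ∈ c.U (arrowIdx z.2).2 := fun z hz => by
    rw [(arrow_comp hz).2]; exact arrowPt_mem_right z.2
  have hmul : ∀ z ∈ S, ∃ h, arrowMul z.1 z.2 =
      arrowMk (arrowIdx z.1).1 (arrowIdx z.2).2 (arrowPt z.1)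
      (arrowVal z.1 * X.j (c.cocycle.lam (arrowIdx z.1).1 (arrowIdx z.1).2 (arrowPt z.1))
        (arrowVal z.2) * c.cocycle.gg (arrowIdx z.1).1 (arrowIdx z.1).2 (arrowIdx z.2).2
          (arrowPt z.1)) (arrowPt_mem_left z.1) h :=
    fun z hz => by
      have h : ∀ g, (arrowPt z.1, g) ∈ c.arrowOpens ((arrowIdx z.1).1, (arrowIdx z.2).2) :=
        fun g => ⟨⟨arrowPt_mem_left z.1, hmem z hz⟩, trivial⟩
      exact ⟨hmem z hz, sheets.mkD_eq (I := IN.prod IG) (W := c.arrowOpens) _ (h _)⟩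
  have hidx : LocConstOn (fun z : c.adaptedArrows × c.adaptedArrows =>
      (arrowIdx z.1, arrowIdx z.2)) S :=
    (locConst_arrowIdx.comp continuous_fst.continuousOn (mapsTo_univ _ _)).prodMk
      (locConst_arrowIdx.comp continuous_snd.continuousOn (mapsTo_univ _ _))
  have hgg : ContMDiffOn (c.adaptedArrows.model.prod c.adaptedArrows.model) IG ∞
      (fun z : c.adaptedArrows × c.adaptedArrows =>
        c.cocycle.gg (arrowIdx z.1).1 (arrowIdx z.1).2 (arrowIdx z.2).2 (arrowPt z.1)) S :=
    hidx.contMDiffOn fun k =>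
      ((c.cocycle.gg_smooth k.1.1 k.1.2 k.2.2).comp
        (contMDiff_arrowPt.comp contMDiff_fst).contMDiffOn (fun z hz => by
          obtain rfl : (arrowIdx z.1, arrowIdx z.2) = k := hz.2
          exact ⟨⟨arrowPt_mem_left z.1, arrowPt_mem_right z.1⟩, hmem z hz.1⟩)).congr
        fun z hz => by
          obtain rfl : (arrowIdx z.1, arrowIdx z.2) = k := hz.2
          rfl
  refine contMDiffOn_adaptedArrows ?_ ?_ ?_
  · exact (hidx.map fun k => (k.1.1, k.2.2)).congr fun z hz => by
      obtain ⟨h, e⟩ := hmul z hz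
      exact congrArg arrowIdx e
  · exact (contMDiff_arrowPt.comp contMDiff_fst).contMDiffOn.congr fun z hz => by
      obtain ⟨h, e⟩ := hmul z hz
      exact (congrArg arrowPt e :)
  · refine (((contMDiff_arrowVal.comp contMDiff_fst).contMDiffOn.mul
      (LieCrossedModule.contMDiffOn_j (contMDiff_arrowLam.comp contMDiff_fst).contMDiffOn
        (contMDiff_arrowVal.comp contMDiff_snd).contMDiffOn)).mul hgg).congr fun z hz => by
      obtain ⟨h, e⟩ := hmul z hz
      exact (congrArg arrowVal e :)

theorem contMDiff_arrowInv [LieGroup IH ∞ H] :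
    ContMDiff c.adaptedArrows.model c.adaptedArrows.model ∞ (arrowInv (c := c)) := by
  have hgg : ContMDiff c.adaptedArrows.model IG ∞ fun r : c.adaptedArrows =>
      c.cocycle.gg (arrowIdx r).1 (arrowIdx r).2 (arrowIdx r).1 (arrowPt r) :=
    contMDiffOn_univ.1 (locConst_arrowIdx.contMDiffOn fun k =>
      ((c.cocycle.gg_smooth k.1 k.2 k.1).comp contMDiff_arrowPt.contMDiffOn (fun r hr => by
        obtain rfl : arrowIdx r = k := hr.2
        exact ⟨⟨arrowPt_mem_left r, arrowPt_mem_right r⟩, arrowPt_mem_left r⟩)).congr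
          fun r hr => by
            obtain rfl : arrowIdx r = k := hr.2
            rfl)
  exact contMDiffOn_univ.1 (contMDiffOn_adaptedArrows (locConst_arrowIdx.map Prod.swap)
    contMDiff_arrowPt.contMDiffOn (LieCrossedModule.contMDiffOn_j contMDiff_arrowLam.inv.contMDiffOn
      (contMDiff_arrowVal.inv.mul hgg.inv).contMDiffOn))

end Smooth

variable [LieGroup IH ∞ H]

variable (c) in
/-- The groupoid of the adapted extension. -/
noncomputable def adaptedGroupoid : LieGroupoid c.adaptedBase where
  arrows := c.adaptedArrows
  src := arrowSrc
  tgt := arrowTgt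
  unit := arrowUnit
  mul := arrowMul
  inv := arrowInv
  src_submersion := isSubmersion_arrowSrc
  tgt_submersion := isSubmersion_arrowTgt
  unit_smooth := contMDiff_arrowUnit
  mul_smooth := contMDiffOn_arrowMul
  inv_smooth := contMDiff_arrowInv
  src_unit _ := rfl
  tgt_unit _ := rfl
  src_mul r r' h := by
    obtain ⟨i, j, x, g, hi, hj, rfl⟩ := exists_arrow_eq r
    obtain ⟨k, g', hk, rfl⟩ := exists_arrow_eq_of_src_eq hj r' h
    rw [arrowMul_mk]; rfl
  tgt_mul r r' h := by
    obtain ⟨i, j, x, g, hi, hj, rfl⟩ := exists_arrow_eq r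
    obtain ⟨k, g', hk, rfl⟩ := exists_arrow_eq_of_src_eq hj r' h
    rw [arrowMul_mk]; rfl
  mul_assoc r r' r'' h h' := by
    obtain ⟨i, j, x, g, hi, hj, rfl⟩ := exists_arrow_eq r
    obtain ⟨k, g', hk, rfl⟩ := exists_arrow_eq_of_src_eq hj r' h
    obtain ⟨l, g'', hl, rfl⟩ := exists_arrow_eq_of_src_eq hk r'' h'
    simp only [arrowMul_mk]
    exact arrowMk_congr (c.cocycle.mul_assoc_aux hi hj hk hl g g' g'')
  unit_mul r := by
    obtain ⟨i, j, x, g, hi, hj, rfl⟩ := exists_arrow_eq r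
    refine (arrowMul_mk i i j x 1 g hi hi hj).trans (arrowMk_congr ?_)
    rw [c.cocycle.lam_self hi, c.cocycle.gg_self i j x ⟨hi, hj⟩, map_one, MulAut.one_apply,
      one_mul, mul_one]
  mul_unit r := by
    obtain ⟨i, j, x, g, hi, hj, rfl⟩ := exists_arrow_eq r
    refine (arrowMul_mk i j j x g 1 hi hj hj).trans (arrowMk_congr ?_)
    rw [c.cocycle.gg_self_right hi hj, map_one, mul_one, mul_one]
  src_inv _ := rfl
  tgt_inv _ := rfl
  mul_inv r := by
    obtain ⟨i, j, x, g, hi, hj, rfl⟩ := exists_arrow_eq r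
    refine (arrowMul_mk i j i x g _ hi hj hi).trans (arrowMk_congr ?_)
    change g * X.j (c.cocycle.lam i j x) (X.j (c.cocycle.lam i j x)⁻¹ (g⁻¹ * _)) * _ = 1
    rw [← MulAut.mul_apply, ← map_mul, mul_inv_cancel, map_one, MulAut.one_apply,
      mul_inv_cancel_left]
    exact inv_mul_cancel _
  inv_mul r := by
    obtain ⟨i, j, x, g, hi, hj, rfl⟩ := exists_arrow_eq r
    refine (arrowMul_mk j i j x _ g hj hi hj).trans (arrowMk_congr ?_)
    change X.j (c.cocycle.lam i j x)⁻¹ (g⁻¹ * (c.cocycle.gg i j i x)⁻¹) *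
      X.j (c.cocycle.lam j i x) g * c.cocycle.gg j i j x = 1
    -- After applying `λ_ij`, the last factor becomes `𝐠_iji` by `gg_eq`, and `λ_ij(λ_ji(g)) 𝐠_iji =
    -- 𝐠_iji g` by `gg_mul_j` and `λ_ii = 1`.
    apply (X.j (c.cocycle.lam i j x)).injective
    rw [map_mul, map_mul, ← MulAut.mul_apply, ← map_mul, mul_inv_cancel, map_one,
      MulAut.one_apply, ← c.cocycle.gg_eq hi hj, map_one, mul_assoc, ← c.cocycle.gg_mul_j hi hj hi,
      c.cocycle.lam_self hi, map_one, MulAut.one_apply, mul_assoc, inv_mul_cancel_left,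
      inv_mul_cancel]

theorem isGExtension_adaptedGroupoid : IsGExtension IG G
    (sheets.pt (I := IN) (W := c.U) : c.adaptedBase → N) c.adaptedGroupoid where
  maps_to _ := rfl
  surjective m m' h := by
    have hm : sheets.pt (I := IN) (W := c.U) m ∈ c.U (sheets.idx (I := IN) (W := c.U) m') :=
      h ▸ sheets.pt_mem (I := IN) (W := c.U) m'
    exact ⟨arrowMk _ _ _ 1 (sheets.pt_mem (I := IN) (W := c.U) m) hm, rfl,
      sheets.ext (I := IN) (W := c.U) h rfl⟩
  submersion r := by
    obtain ⟨i, j, x, g, hi, hj, rfl⟩ := exists_arrow_eq r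
    set r := arrowMk i j x g hi hj
    set W : Set (c.adaptedBase × c.adaptedBase) :=
      {m | sheets.idx (I := IN) (W := c.U) m = i} ×ˢ {m | sheets.idx (I := IN) (W := c.U) m = j}
    -- Over the sheets `i` and `j`, the local section through `(g, x_ij)` keeps the component `g`
    -- constant.
    set σ : c.adaptedBase × c.adaptedBase → c.adaptedArrows := fun z =>
      sheets.mkD (I := IN.prod IG) (W := c.arrowOpens) r (i, j)
        (sheets.pt (I := IN) (W := c.U) z.1, g)
    have key : ∀ z ∈ W, sheets.pt (I := IN) (W := c.U) z.1 = sheets.pt (I := IN) (W := c.U) z.2 →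
        ∃ h h', σ z = arrowMk i j (sheets.pt (I := IN) (W := c.U) z.1) g h h' := by
      rintro z ⟨h1, h2⟩ h
      have hi' : sheets.pt (I := IN) (W := c.U) z.1 ∈ c.U i :=
        (show sheets.idx (I := IN) (W := c.U) z.1 = i from h1) ▸ sheets.pt_mem z.1
      have hj' : sheets.pt (I := IN) (W := c.U) z.1 ∈ c.U j := by
        rw [h]
        exact (show sheets.idx (I := IN) (W := c.U) z.2 = j from h2) ▸ sheets.pt_mem z.2
      exact ⟨hi', hj', sheets.mkD_eq (I := IN.prod IG) (W := c.arrowOpens) r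
        ⟨⟨hi', hj'⟩, trivial⟩⟩
    refine ⟨W, σ, (sheets.isOpen_fibre i).prod (sheets.isOpen_fibre j), ⟨rfl, rfl⟩, ?_, ?_, ?_⟩
    · exact sheets.mkD_eq (I := IN.prod IG) (W := c.arrowOpens) r ⟨⟨hi, hj⟩, trivial⟩
    · refine contMDiffOn_adaptedArrows (LocConstOn.of_subset_fibre (k := (i, j)) fun z hz => ?_)
        (((sheets.contMDiff_pt (I := IN) (W := c.U)).comp contMDiff_fst).contMDiffOn.congr
          fun z hz => ?_) ((contMDiffOn_const (c := g)).congr fun z hz => ?_)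
      all_goals
        obtain ⟨h, h', e⟩ := key z hz.1 hz.2
        rw [e]; rfl
    · intro z hz h
      obtain ⟨h1, h2, e⟩ := key z hz h
      change arrowSrc (σ z) = _ ∧ arrowTgt (σ z) = _
      rw [e]
      exact ⟨sheets.ext (I := IN) (W := c.U) rfl hz.1.symm,
        sheets.ext (I := IN) (W := c.U) h hz.2.symm⟩
  kernel_locally_trivial m := by
    -- The kernel is globally trivial by `(x_i, g) ↦ (g, x_ii)`, which is multiplicative because
    -- `λ_ii` and `𝐠_iii` are trivial.
    refine ⟨univ, ⟨fun z => arrowMk (sheets.idx (I := IN) (W := c.U) z.1)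
      (sheets.idx (I := IN) (W := c.U) z.1) (sheets.pt (I := IN) (W := c.U) z.1) z.2
      (sheets.pt_mem z.1) (sheets.pt_mem z.1), fun r => (arrowSrc r, arrowVal r), univ,
      {r | arrowSrc r = arrowTgt r}, fun _ _ => rfl, fun _ _ => trivial, fun _ _ => rfl,
      fun r hr => ?_⟩, isOpen_univ, trivial, univ_prod_univ.symm, ?_, ?_, ?_, fun _ _ _ => rfl,
      fun x _ g g' => ?_⟩
    · have h1 : (arrowIdx r).1 = (arrowIdx r).2 := congrArg (sheets.idx (I := IN) (W := c.U)) hr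
      exact arrow_ext (Prod.ext rfl h1) rfl rfl
    · exact Set.ext fun r => (and_iff_left trivial).symm
    · exact contMDiffOn_adaptedArrows
        (((sheets.locConst_idx (I := IN) (W := c.U)).comp continuous_fst.continuousOn
          (mapsTo_univ _ _)).map fun i => (i, i))
        ((sheets.contMDiff_pt (I := IN) (W := c.U)).comp contMDiff_fst).contMDiffOn
        contMDiff_snd.contMDiffOn
    · exact (contMDiff_arrowSrc.prodMk contMDiff_arrowVal).contMDiffOn
    · refine (arrowMk_congr ?_).trans (arrowMul_mk _ _ _ _ g g' (sheets.pt_mem x) (sheets.pt_mem x)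
        (sheets.pt_mem x)).symm
      rw [c.cocycle.lam_self (sheets.pt_mem x),
        c.cocycle.gg_self _ _ _ ⟨sheets.pt_mem x, sheets.pt_mem x⟩, map_one, MulAut.one_apply,
        mul_one]

end CoverCocycle

end Groups

/-! ### The principal bundle and the band of the adapted extension -/

section Groups

variable {EG HG : Type} [NormedAddCommGroup EG] [NormedSpace ℝ EG] [TopologicalSpace HG]
  {IG : ModelWithCorners ℝ EG HG} {G : Type u} [Group G] [TopologicalSpace G] [ChartedSpace HG G]
  {EH HH : Type} [NormedAddCommGroup EH] [NormedSpace ℝ EH] [TopologicalSpace HH]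
  {IH : ModelWithCorners ℝ EH HH} {H : Type u} [Group H] [TopologicalSpace H] [ChartedSpace HH H]
  {EN HN : Type} [NormedAddCommGroup EN] [NormedSpace ℝ EN] [TopologicalSpace HN]
  {IN : ModelWithCorners ℝ EN HN} {N : Type u} [TopologicalSpace N] [ChartedSpace HN N]
  {X : LieCrossedModule IG G IH H}

theorem LieCrossedModule.j_inv_j (h : H) (g : G) : X.j h⁻¹ (X.j h g) = g := by
  rw [← MulAut.mul_apply, ← map_mul, inv_mul_cancel, map_one, MulAut.one_apply]

theorem LieCrossedModule.j_j_inv (h : H) (g : G) : X.j h (X.j h⁻¹ g) = g := by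
  rw [← MulAut.mul_apply, ← map_mul, mul_inv_cancel, map_one, MulAut.one_apply]

namespace CoverCocycle

variable {c : CoverCocycle IN N X}
  [FiniteDimensional ℝ EN] [IN.Boundaryless] [IsManifold IN ∞ N] [T2Space N]
  [FiniteDimensional ℝ EG] [IG.Boundaryless] [LieGroup IG ∞ G] [T2Space G]

theorem arrowMk_self_mul {i j : c.ι} {x : N} (g g' : G) (hi : x ∈ c.U i) (hj : x ∈ c.U j) :
    arrowMul (arrowMk i i x g hi hi) (arrowMk i j x g' hi hj) = arrowMk i j x (g * g') hi hj := by
  rw [arrowMul_mk]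
  refine arrowMk_congr ?_
  rw [c.cocycle.lam_self hi, c.cocycle.gg_self i j x ⟨hi, hj⟩, map_one, MulAut.one_apply, mul_one]

variable [FiniteDimensional ℝ EH] [IH.Boundaryless] [LieGroup IH ∞ H] [T2Space H]

variable (c) in
/-- The total space `∐ U i × H` of the principal bundle of the adapted extension. -/
noncomputable def adaptedTotal : SmoothMfd.{u} := prodMfd c.adaptedBase IH H

/-- The point `x_i` of `(x_i, h)`. -/
noncomputable def totalBase (z : c.adaptedTotal) : c.adaptedBase := z.1

/-- The component `h` of `(x_i, h)`. -/
noncomputable def totalVal (z : c.adaptedTotal) : H := z.2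

/-- The point `(x_i, h)`. -/
noncomputable def totalMk (m : c.adaptedBase) (h : H) : c.adaptedTotal := (m, h)

theorem total_ext {z z' : c.adaptedTotal} (h : totalBase z = totalBase z')
    (h' : totalVal z = totalVal z') : z = z' := Prod.ext h h'

theorem contMDiff_totalBase :
    ContMDiff c.adaptedTotal.model c.adaptedBase.model ∞ (totalBase (c := c) (IH := IH)) :=
  contMDiff_fst (I := c.adaptedBase.model) (J := IH) (M := c.adaptedBase) (N := H)

theorem contMDiff_totalVal :
    ContMDiff c.adaptedTotal.model IH ∞ (totalVal (c := c) (IH := IH)) :=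
  contMDiff_snd (I := c.adaptedBase.model) (J := IH) (M := c.adaptedBase) (N := H)

theorem contMDiffOn_totalMk {E' H' : Type*} [NormedAddCommGroup E'] [NormedSpace ℝ E']
    [TopologicalSpace H'] {J : ModelWithCorners ℝ E' H'} {Z : Type*} [TopologicalSpace Z]
    [ChartedSpace H' Z] {f : Z → c.adaptedBase} {g : Z → H} {s : Set Z}
    (hf : ContMDiffOn J c.adaptedBase.model ∞ f s) (hg : ContMDiffOn J IH ∞ g s) :
    ContMDiffOn J c.adaptedTotal.model ∞ (fun z => totalMk (f z) (g z)) s := hf.prodMk hg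

variable (c) in
/-- The principal bundle of the adapted extension. -/
noncomputable def adaptedBundle : PrincipalBundle IH H c.adaptedGroupoid where
  total := c.adaptedTotal
  proj := totalBase
  act z h := totalMk (totalBase z) (totalVal z * h)
  smul r z := totalMk (arrowSrc r) (X.ρ (arrowVal r) *
    c.cocycle.lam (arrowIdx r).1 (arrowIdx r).2 (arrowPt r) * totalVal z)
  proj_smooth := contMDiff_totalBase
  act_smooth := contMDiffOn_univ.1 (contMDiffOn_totalMk
    (contMDiff_totalBase.comp contMDiff_fst).contMDiffOn
    ((contMDiff_totalVal.comp contMDiff_fst).mul contMDiff_snd).contMDiffOn)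
  proj_act _ _ := rfl
  act_one z := total_ext rfl (mul_one _)
  act_mul z h h' := total_ext rfl (mul_assoc _ _ _).symm
  locally_trivial m := ⟨univ, PartialEquiv.refl _, isOpen_univ, trivial, univ_prod_univ.symm,
    rfl, contMDiffOn_id, contMDiffOn_id, fun _ _ _ => rfl, fun _ _ _ _ => rfl⟩
  smul_smooth := contMDiffOn_totalMk (contMDiff_arrowSrc.comp contMDiff_fst).contMDiffOn
    ((((X.ρ_smooth.comp contMDiff_arrowVal).mul contMDiff_arrowLam).comp contMDiff_fst).mul
      (contMDiff_totalVal.comp contMDiff_snd)).contMDiffOn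
  proj_smul _ _ _ := rfl
  mul_smul r r' z h h' := by
    obtain ⟨i, j, x, g, hi, hj, rfl⟩ := exists_arrow_eq r
    obtain ⟨k, g', hk, rfl⟩ := exists_arrow_eq_of_src_eq hj r' h
    change totalMk (arrowSrc (arrowMul _ _)) (X.ρ (arrowVal (arrowMul _ _)) * c.cocycle.lam
      (arrowIdx (arrowMul _ _)).1 (arrowIdx (arrowMul _ _)).2 (arrowPt (arrowMul _ _)) *
        totalVal z) = _
    rw [arrowMul_mk]
    refine total_ext rfl ?_
    change X.ρ (g * X.j (c.cocycle.lam i j x) g' * c.cocycle.gg i j k x) *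
        c.cocycle.lam i k x * totalVal z
      = X.ρ g * c.cocycle.lam i j x * (X.ρ g' * c.cocycle.lam j k x * totalVal z)
    rw [map_mul, map_mul, X.equivariance, mul_assoc _ (X.ρ (c.cocycle.gg i j k x)),
      c.cocycle.rho_gg i j k x ⟨⟨hi, hj⟩, hk⟩]
    simp only [mul_assoc, inv_mul_cancel_left]
  unit_smul z := total_ext rfl ((congrArg (fun l => X.ρ 1 * l * totalVal z)
    (c.cocycle.lam_self (sheets.pt_mem (totalBase z)))).trans
      (by rw [map_one, one_mul, one_mul]))
  smul_act _ _ _ _ := total_ext rfl (mul_assoc _ _ _)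

/-- The map `χ(x_i, h)(g) = (h(g), x_ii)`. -/
noncomputable def adaptedChi (z : c.adaptedTotal) (g : G) : c.adaptedArrows :=
  arrowMk (sheets.idx (I := IN) (W := c.U) (totalBase z))
    (sheets.idx (I := IN) (W := c.U) (totalBase z))
    (sheets.pt (I := IN) (W := c.U) (totalBase z)) (X.j (totalVal z) g)
    (sheets.pt_mem (totalBase z)) (sheets.pt_mem (totalBase z))

theorem isBandElement_adaptedChi (z : c.adaptedTotal) :
    IsBandElement IG G c.adaptedGroupoid (totalBase z) (adaptedChi z) where
  mem _ := ⟨rfl, rfl⟩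
  map_mul g g' := ((arrowMk_self_mul _ _ _ _).trans (arrowMk_congr (map_mul _ g g').symm)).symm
  smooth := contMDiffOn_univ.1 (contMDiffOn_adaptedArrows
    (LocConstOn.of_subset_fibre fun _ _ => rfl) contMDiffOn_const
    (LieCrossedModule.contMDiffOn_j contMDiffOn_const contMDiffOn_id))
  inverse := ⟨fun r => X.j (totalVal z)⁻¹ (arrowVal r),
    LieCrossedModule.contMDiffOn_j contMDiffOn_const contMDiff_arrowVal.contMDiffOn,
    fun g => LieCrossedModule.j_inv_j (totalVal z) g, fun r h h' => by
      have h1 : (arrowIdx r).1 = _ := congrArg (sheets.idx (I := IN) (W := c.U)) h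
      have h2 : (arrowIdx r).2 = _ := congrArg (sheets.idx (I := IN) (W := c.U)) h'
      have h3 : arrowPt r = _ := congrArg (sheets.pt (I := IN) (W := c.U)) h
      exact arrow_ext (Prod.ext h1.symm h2.symm) h3.symm
        (LieCrossedModule.j_j_inv (totalVal z) _)⟩

theorem contMDiff_adaptedChi : ContMDiff (c.adaptedTotal.model.prod IG) c.adaptedArrows.model ∞
    fun z : c.adaptedTotal × G => adaptedChi z.1 z.2 :=
  contMDiffOn_univ.1 (contMDiffOn_adaptedArrows
    (((sheets.locConst_idx (I := IN) (W := c.U)).comp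
      (contMDiff_totalBase.continuous.comp continuous_fst).continuousOn
        (mapsTo_univ _ _)).map fun i => (i, i))
    (((sheets.contMDiff_pt (I := IN) (W := c.U)).comp contMDiff_totalBase).comp
      contMDiff_fst).contMDiffOn
    (LieCrossedModule.contMDiffOn_j (contMDiff_totalVal.comp contMDiff_fst).contMDiffOn
      contMDiff_snd.contMDiffOn))

/-- The morphism property of `χ` multiplied by `r` on the right, which avoids the formula for the
inverse. It holds because `ρ(a)` acts on `G` as conjugation by `a`. -/
theorem adaptedChi_smul_mul (r : c.adaptedArrows) (z : c.adaptedTotal) (h : H) (g : G)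
    (hr : arrowTgt r = totalBase z) :
    arrowMul (adaptedChi (c.adaptedBundle.act (c.adaptedBundle.smul r z) h) g) r =
      arrowMul r (adaptedChi z (X.j h g)) := by
  obtain ⟨i, j, x, a, hi, hj, rfl⟩ := exists_arrow_eq r
  obtain ⟨m, h₀⟩ := z
  obtain rfl : arrowTgt (arrowMk i j x a hi hj) = m := hr
  refine (arrowMk_self_mul _ _ _ _).trans
    ((arrowMk_congr ?_).trans (arrowMul_mk i j j x a _ hi hj hj).symm)
  change X.j (X.ρ a * c.cocycle.lam i j x * h₀ * h) g * a = a * X.j (c.cocycle.lam i j x)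
    (X.j h₀ (X.j h g)) * c.cocycle.gg i j j x
  rw [c.cocycle.gg_self_right hi hj, mul_one]
  simp only [map_mul, MulAut.mul_apply, X.peiffer, inv_mul_cancel_right]

variable (c) in
/-- The extension adapted to a cocycle. -/
noncomputable def adaptedExtension : Extension IN N X where
  base := c.adaptedBase
  q := sheets.pt (I := IN) (W := c.U)
  q_surjective x := by
    obtain ⟨i, hi⟩ := c.isOpenCover.exists_mem x
    exact ⟨sheets.mk i x hi, rfl⟩
  q_submersion := sheets.isSubmersion_pt (I := IN) (W := c.U)
  R := c.adaptedGroupoid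
  isGExtension := isGExtension_adaptedGroupoid
  P := c.adaptedBundle
  chi := adaptedChi
  chi_mem_band := isBandElement_adaptedChi
  chi_smooth := contMDiff_adaptedChi
  chi_inv_smooth := ⟨fun w => X.j (totalVal w.1)⁻¹ (arrowVal w.2),
    LieCrossedModule.contMDiffOn_j (contMDiff_totalVal.comp contMDiff_fst).inv.contMDiffOn
      (contMDiff_arrowVal.comp contMDiff_snd).contMDiffOn,
    fun z g => LieCrossedModule.j_inv_j (totalVal z) g⟩
  chi_morphism r z h g hr := by
    have e : c.adaptedGroupoid.tgt (adaptedChi (c.adaptedBundle.act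
      (c.adaptedBundle.smul r z) h) g) = c.adaptedGroupoid.src r := rfl
    refine (c.adaptedGroupoid.mul_mul_inv e).symm.trans ?_
    exact congrArg (fun w => c.adaptedGroupoid.mul w (c.adaptedGroupoid.inv r))
      (adaptedChi_smul_mul r z h g hr)
  act_rho z g := total_ext rfl (Eq.symm
    ((congrArg (fun l => X.ρ (X.j (totalVal z) g) * l * totalVal z)
      (c.cocycle.lam_self (sheets.pt_mem (totalBase z)))).trans
        (by rw [X.equivariance, mul_one, inv_mul_cancel_right]; rfl)))

variable (c) in
/-- Some point of `∐ U i` over a point of `N`. -/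
noncomputable def somePt (x : N) : c.adaptedBase :=
  sheets.mk (c.isOpenCover.exists_mem x).choose x (c.isOpenCover.exists_mem x).choose_spec

variable (c) in
/-- The inclusion of `U i` in `∐ U i`. -/
noncomputable def basePt (i : c.ι) (x : N) : c.adaptedBase :=
  sheets.mkD (I := IN) (W := c.U) (c.somePt x) i x

theorem basePt_eq {i : c.ι} {x : N} (hi : x ∈ c.U i) : c.basePt i x = sheets.mk i x hi :=
  sheets.mkD_eq (I := IN) (W := c.U) _ hi

theorem contMDiffOn_basePt (i : c.ι) : ContMDiffOn IN c.adaptedBase.model ∞ (c.basePt i) (c.U i) :=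
  contMDiffOn_adaptedBase (LocConstOn.of_subset_fibre (k := i) fun x hx => by
    rw [basePt_eq hx]; rfl) (contMDiffOn_id.congr fun x hx => by rw [basePt_eq hx]; rfl)

variable (c) in
/-- The coordinates `(g, x_ij)` of the adapted extension. -/
noncomputable def arrowCoord (i j : c.ι) (z : G × N) : c.adaptedArrows :=
  sheets.mkD (I := IN.prod IG) (W := c.arrowOpens) (arrowUnit (c.somePt z.2)) (i, j) (z.2, z.1)

theorem arrowCoord_eq {i j : c.ι} {x : N} (g : G) (hi : x ∈ c.U i) (hj : x ∈ c.U j) :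
    c.arrowCoord i j (g, x) = arrowMk i j x g hi hj :=
  sheets.mkD_eq (I := IN.prod IG) (W := c.arrowOpens) _ ⟨⟨hi, hj⟩, trivial⟩

theorem contMDiffOn_arrowCoord (i j : c.ι) :
    ContMDiffOn (IG.prod IN) c.adaptedArrows.model ∞ (c.arrowCoord i j)
      (univ ×ˢ (c.U i ∩ c.U j : Set N)) :=
  contMDiffOn_adaptedArrows (LocConstOn.of_subset_fibre (k := (i, j)) fun z hz => by
      rw [arrowCoord_eq z.1 hz.2.1 hz.2.2]; rfl)
    (contMDiff_snd.contMDiffOn.congr fun z hz => by rw [arrowCoord_eq z.1 hz.2.1 hz.2.2]; rfl)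
    (contMDiff_fst.contMDiffOn.congr fun z hz => by rw [arrowCoord_eq z.1 hz.2.1 hz.2.2]; rfl)

theorem eq_basePt {i : c.ι} {m : c.adaptedBase} (h : sheets.idx (I := IN) (W := c.U) m = i) :
    c.basePt i (sheets.pt (I := IN) (W := c.U) m) = m := by
  subst h
  exact basePt_eq (sheets.pt_mem m)

variable (c) in
/-- The identification of the adapted extension with itself. -/
noncomputable def adaptedIdentification : AdaptedIdentification c c.adaptedExtension where
  pt i :=
    { toFun := c.basePt i
      invFun := sheets.pt (I := IN) (W := c.U)
      source := c.U i
      target := {m | sheets.idx (I := IN) (W := c.U) m = i}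
      map_source' := fun x hx => by
        change sheets.idx (I := IN) (W := c.U) (c.basePt i x) = i
        rw [basePt_eq hx]; rfl
      map_target' := fun m hm => hm ▸ sheets.pt_mem (I := IN) (W := c.U) m
      left_inv' := fun x hx => by rw [basePt_eq hx]; rfl
      right_inv' := fun m hm => eq_basePt hm }
  arr i j :=
    { toFun := c.arrowCoord i j
      invFun := fun r => (arrowVal r, arrowPt r)
      source := univ ×ˢ (c.U i ∩ c.U j : Set N)
      target := {r | (arrowIdx r).1 = i ∧ (arrowIdx r).2 = j}
      map_source' := fun z hz => by
        rw [arrowCoord_eq z.1 hz.2.1 hz.2.2]; exact ⟨rfl, rfl⟩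
      map_target' := fun r hr => ⟨trivial, hr.1 ▸ arrowPt_mem_left r, hr.2 ▸ arrowPt_mem_right r⟩
      left_inv' := fun z hz => by rw [arrowCoord_eq z.1 hz.2.1 hz.2.2]; rfl
      right_inv' := fun r hr => by
        obtain ⟨rfl, rfl⟩ := hr
        exact arrowCoord_eq _ (arrowPt_mem_left r) (arrowPt_mem_right r) }
  tot i :=
    { toFun := fun z => totalMk (c.basePt i z.1) z.2
      invFun := fun w => (sheets.pt (I := IN) (W := c.U) (totalBase w), totalVal w)
      source := (c.U i : Set N) ×ˢ univ
      target := {w | sheets.idx (I := IN) (W := c.U) (totalBase w) = i}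
      map_source' := fun z hz => by
        change sheets.idx (I := IN) (W := c.U) (c.basePt i z.1) = i
        rw [basePt_eq hz.1]; rfl
      map_target' := fun w hw => ⟨hw ▸ sheets.pt_mem (I := IN) (W := c.U) (totalBase w), trivial⟩
      left_inv' := fun z hz => Prod.ext (by rw [basePt_eq hz.1]; rfl) rfl
      right_inv' := fun w hw => total_ext (eq_basePt hw) rfl }
  pt_source _ := rfl
  pt_target_open i := sheets.isOpen_fibre (I := IN) (W := c.U) i
  pt_target_partition m := ⟨sheets.idx (I := IN) (W := c.U) m, rfl, fun _ h => h.symm⟩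
  pt_smooth := contMDiffOn_basePt
  pt_symm_smooth _ := (sheets.contMDiff_pt (I := IN) (W := c.U)).contMDiffOn
  q_pt i x hx := by
    change sheets.pt (I := IN) (W := c.U) (c.basePt i x) = x
    rw [basePt_eq hx]; rfl
  arr_source _ _ := rfl
  arr_target _ _ := rfl
  arr_smooth := contMDiffOn_arrowCoord
  arr_symm_smooth _ _ := (contMDiff_arrowVal.prodMk contMDiff_arrowPt).contMDiffOn
  src_arr i j g x hx := by
    change arrowSrc (c.arrowCoord i j (g, x)) = c.basePt i x
    rw [arrowCoord_eq g hx.1 hx.2, basePt_eq hx.1]; rfl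
  tgt_arr i j g x hx := by
    change arrowTgt (c.arrowCoord i j (g, x)) = c.basePt j x
    rw [arrowCoord_eq g hx.1 hx.2, basePt_eq hx.2]; rfl
  arr_mul i j k g g' x hx := by
    change arrowMul (c.arrowCoord i j (g, x)) (c.arrowCoord j k (g', x)) = c.arrowCoord i k (_, x)
    rw [arrowCoord_eq _ hx.1.1 hx.1.2, arrowCoord_eq _ hx.1.2 hx.2, arrowCoord_eq _ hx.1.1 hx.2,
      arrowMul_mk]
  tot_source _ := rfl
  tot_target _ := rfl
  tot_smooth i := contMDiffOn_totalMk
    ((contMDiffOn_basePt i).comp contMDiff_fst.contMDiffOn fun _ hz => hz.1)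
    contMDiff_snd.contMDiffOn
  tot_symm_smooth _ := (((sheets.contMDiff_pt (I := IN) (W := c.U)).comp contMDiff_totalBase).prodMk
    contMDiff_totalVal).contMDiffOn
  proj_tot _ _ _ _ := rfl
  tot_act _ _ _ _ _ := rfl
  arr_smul i j g h x hx := by
    change c.adaptedBundle.smul (c.arrowCoord i j (g, x)) (totalMk (c.basePt j x) h) =
      totalMk (c.basePt i x) _
    rw [arrowCoord_eq g hx.1 hx.2, basePt_eq hx.1]
    rfl
  chi_tot i h g x hx := by
    change adaptedChi (totalMk (c.basePt i x) h) g = c.arrowCoord i i (X.j h g, x)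
    rw [arrowCoord_eq _ hx hx, basePt_eq hx]
    rfl

end CoverCocycle

variable {c : CoverCocycle IN N X} {E : Extension IN N X}

/-- The local data of an adapted extension. -/
def AdaptedIdentification.localData (A : AdaptedIdentification c E) : LocalData E c.cocycle where
  s i x := A.tot i (x, 1)
  a i j x := A.arr i j (1, x)
  s_smooth i := (A.tot_smooth i).comp (contMDiffOn_id.prodMk contMDiffOn_const) fun x hx => by
    rw [A.tot_source]; exact ⟨hx, trivial⟩
  a_smooth i j := (A.arr_smooth i j).comp (contMDiffOn_const.prodMk contMDiffOn_id) fun x hx => by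
    rw [A.arr_source]; exact ⟨trivial, hx⟩
  q_s i x hx := by rw [A.proj_tot i 1 x hx, A.q_pt i x hx]
  src_a i j x hx := by rw [A.src_arr i j 1 x hx, A.proj_tot i 1 x hx.1]
  tgt_a i j x hx := by rw [A.tgt_arr i j 1 x hx, A.proj_tot j 1 x hx.2]
  smul_s i j x hx := by
    rw [A.arr_smul i j 1 1 x hx, A.tot_act i 1 _ x hx.1, map_one, one_mul, mul_one]
  mul_a i j k x hx := by
    -- Both sides are `(𝐠_ijk, x_ik)`; on the right, the extra factor `𝐠_iik` is trivial.
    rw [A.arr_mul i j k 1 1 x hx, A.chi_tot i 1 _ x hx.1.1,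
      A.arr_mul i i k _ 1 x ⟨⟨hx.1.1, hx.1.1⟩, hx.2⟩, c.cocycle.gg_self i k x ⟨hx.1.1, hx.2⟩]
    simp

theorem AdaptedIdentification.proj_localData (A : AdaptedIdentification c E) {i : c.ι} {x : N}
    (hx : x ∈ c.U i) : E.P.proj (A.localData.s i x) = A.pt i x := A.proj_tot i 1 x hx

end Groups

/-! ### Pull-backs trivialised by the same cocycle are isomorphic -/

section Groups

variable {EG HG : Type} [NormedAddCommGroup EG] [NormedSpace ℝ EG] [TopologicalSpace HG]
  {IG : ModelWithCorners ℝ EG HG} {G : Type u} [Group G] [TopologicalSpace G] [ChartedSpace HG G]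
  {EH HH : Type} [NormedAddCommGroup EH] [NormedSpace ℝ EH] [TopologicalSpace HH]
  {IH : ModelWithCorners ℝ EH HH} {H : Type u} [Group H] [TopologicalSpace H] [ChartedSpace HH H]
  {EN HN : Type} [NormedAddCommGroup EN] [NormedSpace ℝ EN] [TopologicalSpace HN]
  {IN : ModelWithCorners ℝ EN HN} {N : Type u} [TopologicalSpace N] [ChartedSpace HN N]
  {X : LieCrossedModule IG G IH H}

/-- A trivialisation of the pull-back of the extension `E` along `p : M' → M`: a section of the
principal bundle and arrows between its values, which obey the cocycle relations for
`lam` and `gg`. -/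
structure PullbackTrivialization (E : Extension IN N X) {M' : SmoothMfd.{u}} (p : M' → E.base)
    (lam : M' → M' → H) (gg : M' → M' → M' → G) where
  s : M' → E.P.total
  a : M' → M' → E.R.arrows
  s_smooth : ContMDiff M'.model E.P.total.model ∞ s
  a_smooth : ContMDiffOn (M'.model.prod M'.model) E.R.arrows.model ∞ (fun z => a z.1 z.2)
    {z : M' × M' | E.q (p z.1) = E.q (p z.2)}
  proj_s : ∀ x, E.P.proj (s x) = p x
  src_a : ∀ x y, E.q (p x) = E.q (p y) → E.R.src (a x y) = p x
  tgt_a : ∀ x y, E.q (p x) = E.q (p y) → E.R.tgt (a x y) = p y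
  smul_s : ∀ x y, E.q (p x) = E.q (p y) → E.P.smul (a x y) (s y) = E.P.act (s x) (lam x y)
  mul_a : ∀ x y z, E.q (p x) = E.q (p y) → E.q (p y) = E.q (p z) →
    E.R.mul (a x y) (a y z) = E.R.mul (E.chi (s x) (gg x y z)) (a x z)

namespace PullbackTrivialization

variable {E E' : Extension IN N X} {M' : SmoothMfd.{u}} {p : M' → E.base} {p' : M' → E'.base}
  {lam : M' → M' → H} {gg : M' → M' → M' → G}

section Coordinates

variable (D : PullbackTrivialization E p lam gg)

theorem src_a_eq {x y : M'} (h : E.q (p x) = E.q (p y)) :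
    E.R.src (D.a x y) = E.P.proj (D.s x) := by rw [D.src_a x y h, D.proj_s]

theorem tgt_a_eq {x y : M'} (h : E.q (p x) = E.q (p y)) :
    E.R.tgt (D.a x y) = E.P.proj (D.s y) := by rw [D.tgt_a x y h, D.proj_s]

theorem src_of_mem {z : M' × E.R.arrows × M'} (hz : z ∈ E.pullArrows p) :
    E.R.src z.2.1 = E.P.proj (D.s z.1) := by rw [D.proj_s]; exact hz.1

theorem q_eq_of_mem {z : M' × E.R.arrows × M'} (hz : z ∈ E.pullArrows p) :
    E.q (p z.1) = E.q (p z.2.2) := by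
  rw [← hz.1, ← hz.2, E.isGExtension.maps_to]

theorem tgt_of_mem {z : M' × E.R.arrows × M'} (hz : z ∈ E.pullArrows p) :
    E.R.tgt z.2.1 = E.R.tgt (D.a z.1 z.2.2) := by
  rw [D.tgt_a _ _ (q_eq_of_mem hz)]; exact hz.2

/-- The coordinates `(x, g, y) ↦ (x, χ(s x)(g) a(x, y), y)` of the arrows of the pull-back. -/
noncomputable def arrowEquiv : PartialEquiv (M' × G × M') (M' × E.R.arrows × M') where
  toFun z := (z.1, E.R.mul (E.chi (D.s z.1) z.2.1) (D.a z.1 z.2.2), z.2.2)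
  invFun z := (z.1, E.quot (D.s z.1) z.2.1 (D.a z.1 z.2.2), z.2.2)
  source := {z | E.q (p z.1) = E.q (p z.2.2)}
  target := E.pullArrows p
  map_source' z hz := by
    refine ⟨?_, ?_⟩
    · exact (E.src_chi_mul (D.src_a_eq hz)).trans (D.proj_s _)
    · exact (E.tgt_chi_mul (D.src_a_eq hz)).trans (D.tgt_a _ _ hz)
  map_target' z hz := q_eq_of_mem hz
  left_inv' z hz := by
    simp only
    rw [E.quot_chi_mul (D.src_a_eq hz)]
  right_inv' z hz := by
    simp only
    rw [E.chi_quot_mul (D.src_of_mem hz) (D.src_a_eq (q_eq_of_mem hz)) (D.tgt_of_mem hz)]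

theorem contMDiffOn_a : ContMDiffOn (M'.model.prod (IG.prod M'.model)) E.R.arrows.model ∞
    (fun z : M' × G × M' => D.a z.1 z.2.2) D.arrowEquiv.source :=
  D.a_smooth.comp (contMDiff_fst.prodMk (contMDiff_snd.comp contMDiff_snd)).contMDiffOn
    fun _ hz => hz

theorem contMDiffOn_arrowEquiv : ContMDiffOn (M'.model.prod (IG.prod M'.model))
    (M'.model.prod (E.R.arrows.model.prod M'.model)) ∞ D.arrowEquiv D.arrowEquiv.source := by
  refine contMDiff_fst.contMDiffOn.prodMk (ContMDiffOn.prodMk ?_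
    (contMDiff_snd.comp contMDiff_snd).contMDiffOn)
  exact LieGroupoid.contMDiffOn_mul (Extension.contMDiffOn_chi
    (D.s_smooth.comp contMDiff_fst).contMDiffOn (contMDiff_fst.comp contMDiff_snd).contMDiffOn)
    D.contMDiffOn_a fun z hz => (E.tgt_chi _ _).trans (D.src_a_eq hz).symm

theorem contMDiffOn_arrowEquiv_symm : ContMDiffOn (M'.model.prod (E.R.arrows.model.prod M'.model))
    (M'.model.prod (IG.prod M'.model)) ∞ D.arrowEquiv.symm D.arrowEquiv.target := by
  refine contMDiff_fst.contMDiffOn.prodMk (ContMDiffOn.prodMk ?_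
    (contMDiff_snd.comp contMDiff_snd).contMDiffOn)
  exact Extension.contMDiffOn_quot (D.s_smooth.comp contMDiff_fst).contMDiffOn
    (contMDiff_fst.comp contMDiff_snd).contMDiffOn
    (D.a_smooth.comp (contMDiff_fst.prodMk (contMDiff_snd.comp contMDiff_snd)).contMDiffOn
      fun _ hz => q_eq_of_mem hz)
    (fun z hz => D.src_of_mem hz) (fun z hz => D.src_a_eq (q_eq_of_mem hz))
    fun z hz => D.tgt_of_mem hz

/-- The coordinates `(x, h) ↦ (s x • h, x)` of the principal bundle of the pull-back. -/
noncomputable def totalEquiv : PartialEquiv (M' × H) (E.P.total × M') where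
  toFun z := (E.P.act (D.s z.1) z.2, z.1)
  invFun w := (w.2, E.P.div (D.s w.2) w.1)
  source := univ
  target := E.pullTotal p
  map_source' z _ := (E.P.proj_act _ _).trans (D.proj_s _)
  map_target' _ _ := trivial
  left_inv' z _ := by
    simp only
    rw [PrincipalBundle.div_act]
  right_inv' w hw := by
    simp only
    rw [PrincipalBundle.act_div ((D.proj_s _).trans hw.symm)]

theorem contMDiffOn_totalEquiv : ContMDiffOn (M'.model.prod IH)
    (E.P.total.model.prod M'.model) ∞ D.totalEquiv D.totalEquiv.source :=
  ContMDiffOn.prodMk (PrincipalBundle.contMDiffOn_act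
    (D.s_smooth.comp contMDiff_fst).contMDiffOn contMDiff_snd.contMDiffOn)
    contMDiff_fst.contMDiffOn

theorem contMDiffOn_totalEquiv_symm [LieGroup IH ∞ H] :
    ContMDiffOn (E.P.total.model.prod M'.model) (M'.model.prod IH) ∞ D.totalEquiv.symm
      D.totalEquiv.target :=
  contMDiff_snd.contMDiffOn.prodMk (PrincipalBundle.contMDiffOn_div
    (D.s_smooth.comp contMDiff_snd).contMDiffOn contMDiff_fst.contMDiffOn
    fun _ hw => (D.proj_s _).trans hw.symm)

/-- In these coordinates the product involves only `lam` and `gg`, no longer the extension; with the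
similar formulas for the action and for `χ`, this makes the change of coordinates between two
pull-backs an isomorphism. -/
theorem pullMul_arrowEquiv {x y z : M'} (hxy : E.q (p x) = E.q (p y))
    (hyz : E.q (p y) = E.q (p z)) (g g' : G) :
    E.pullMul (D.arrowEquiv (x, g, y)) (D.arrowEquiv (y, g', z)) =
      D.arrowEquiv (x, g * X.j (lam x y) g' * gg x y z, z) := by
  simp only [Extension.pullMul, arrowEquiv]
  rw [E.mul_normal_form (D.tgt_a_eq hxy) (D.smul_s x y hxy) (D.src_a_eq hyz)
    (D.src_a_eq (hxy.trans hyz)) (D.mul_a x y z hxy hyz)]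

theorem pullAct_pullSmul_arrowEquiv {x y : M'} (hxy : E.q (p x) = E.q (p y)) (g : G) (h h' : H) :
    E.pullAct (E.pullSmul (D.arrowEquiv (x, g, y)) (D.totalEquiv (y, h))) h' =
      D.totalEquiv (x, X.ρ g * lam x y * (h * h')) := by
  simp only [Extension.pullAct, Extension.pullSmul, arrowEquiv, totalEquiv]
  rw [← E.P.smul_act _ _ _ ((E.tgt_chi_mul (D.src_a_eq hxy)).trans (D.tgt_a_eq hxy)),
    E.chi_mul_smul (D.tgt_a_eq hxy) (D.smul_s x y hxy), ← E.P.act_mul, ← E.P.act_mul, mul_assoc]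

theorem a_self (x : M') : D.a x x = E.chi (D.s x) (gg x x x) := by
  refine E.R.mul_right_cancel (z := D.a x x) ?_ ?_ (D.mul_a x x x rfl rfl)
  · rw [D.tgt_a_eq rfl, D.src_a_eq rfl]
  · rw [E.tgt_chi, D.src_a_eq rfl]

/-- No normalisation of `gg` is assumed here, so `a x x` may differ from a unit; the factor `(gg x x
x)⁻¹` compensates for it. -/
theorem pullChi_totalEquiv (x : M') (h : H) (g : G) :
    E.pullChi (D.totalEquiv (x, h)) g = D.arrowEquiv (x, X.j h g * (gg x x x)⁻¹, x) := by
  simp only [Extension.pullChi, arrowEquiv, totalEquiv]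
  rw [D.a_self, ← E.chi_mul, inv_mul_cancel_right, E.chi_act]

end Coordinates

/-- Pull-backs with trivialisations that obey the same relations are isomorphic. -/
theorem pullbackIsomorphic [LieGroup IH ∞ H] (D : PullbackTrivialization E p lam gg)
    (D' : PullbackTrivialization E' p' lam gg) (hq : ∀ x, E.q (p x) = E'.q (p' x)) :
    E.PullbackIsomorphic E' p p' := by
  have hs : D.arrowEquiv.source = D'.arrowEquiv.source := by
    ext z
    change E.q (p z.1) = E.q (p z.2.2) ↔ E'.q (p' z.1) = E'.q (p' z.2.2)
    rw [hq, hq]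
  have hA : ∀ z ∈ E.pullArrows p, ∃ x g y, E.q (p x) = E.q (p y) ∧ D.arrowEquiv (x, g, y) = z :=
    fun z hz => ⟨_, _, _, q_eq_of_mem hz, D.arrowEquiv.right_inv hz⟩
  have hT : ∀ w ∈ E.pullTotal p, ∃ x h, D.totalEquiv (x, h) = w := fun w hw =>
    ⟨_, _, D.totalEquiv.right_inv hw⟩
  have eA : ∀ x g y, E.q (p x) = E.q (p y) →
      (D.arrowEquiv.symm.trans' D'.arrowEquiv hs) (D.arrowEquiv (x, g, y)) =
        D'.arrowEquiv (x, g, y) := fun x g y h =>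
    congrArg D'.arrowEquiv (D.arrowEquiv.left_inv h)
  have eT : ∀ x h, (D.totalEquiv.symm.trans' D'.totalEquiv rfl) (D.totalEquiv (x, h)) =
        D'.totalEquiv (x, h) := fun x h =>
    congrArg D'.totalEquiv (D.totalEquiv.left_inv trivial)
  refine ⟨D.arrowEquiv.symm.trans' D'.arrowEquiv hs, D.totalEquiv.symm.trans' D'.totalEquiv rfl,
    rfl, rfl, ?_, ?_, fun _ _ => ⟨rfl, rfl⟩, fun z hz w hw hzw => ?_, rfl, rfl, ?_, ?_,
    fun _ _ => rfl, fun z hz w hw h hzw => ?_, fun w hw g => ?_⟩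
  · exact D'.contMDiffOn_arrowEquiv.comp D.contMDiffOn_arrowEquiv_symm
      fun z hz => hs ▸ D.arrowEquiv.map_target hz
  · exact D.contMDiffOn_arrowEquiv.comp D'.contMDiffOn_arrowEquiv_symm
      fun z hz => hs ▸ D'.arrowEquiv.map_target hz
  · obtain ⟨x, g, y, h1, rfl⟩ := hA z hz
    obtain ⟨y', g', t, h2, rfl⟩ := hA w hw
    obtain rfl : y = y' := hzw
    rw [D.pullMul_arrowEquiv h1 h2, eA _ _ _ (h1.trans h2), eA _ _ _ h1, eA _ _ _ h2,
      D'.pullMul_arrowEquiv (by rw [← hq, ← hq, h1]) (by rw [← hq, ← hq, h2])]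
  · exact D'.contMDiffOn_totalEquiv.comp D.contMDiffOn_totalEquiv_symm fun _ _ => trivial
  · exact D.contMDiffOn_totalEquiv.comp D'.contMDiffOn_totalEquiv_symm fun _ _ => trivial
  · obtain ⟨x, g, y, h1, rfl⟩ := hA z hz
    obtain ⟨y', h', rfl⟩ := hT w hw
    obtain rfl : y = y' := hzw
    rw [D.pullAct_pullSmul_arrowEquiv h1, eT, eT, eA _ _ _ h1,
      D'.pullAct_pullSmul_arrowEquiv (by rw [← hq, ← hq, h1])]
  · obtain ⟨x, h, rfl⟩ := hT w hw
    rw [eT, D.pullChi_totalEquiv, D'.pullChi_totalEquiv, eA _ _ _ rfl]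

end PullbackTrivialization

end Groups

/-! ### Morita equivalence with the adapted extension -/

section Groups

variable {EG HG : Type} [NormedAddCommGroup EG] [NormedSpace ℝ EG] [TopologicalSpace HG]
  {IG : ModelWithCorners ℝ EG HG} {G : Type u} [Group G] [TopologicalSpace G] [ChartedSpace HG G]
  {EH HH : Type} [NormedAddCommGroup EH] [NormedSpace ℝ EH] [TopologicalSpace HH]
  {IH : ModelWithCorners ℝ EH HH} {H : Type u} [Group H] [TopologicalSpace H] [ChartedSpace HH H]
  {EN HN : Type} [NormedAddCommGroup EN] [NormedSpace ℝ EN] [TopologicalSpace HN]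
  {IN : ModelWithCorners ℝ EN HN} {N : Type u} [TopologicalSpace N] [ChartedSpace HN N]
  {X : LieCrossedModule IG G IH H}

namespace LocalData

section Trivialization

variable {E : Extension IN N X} {ι : Type u} {U : ι → Opens N} {c : Cocycle IN X U}
  (d : LocalData E c) {M' : SmoothMfd.{u}} {n : M' → N} {σ : M' → ι}

theorem contMDiff_s_comp (hn : ContMDiff M'.model IN ∞ n) (hσ : LocConstOn σ univ)
    (hU : ∀ y, n y ∈ U (σ y)) :
    ContMDiff M'.model E.P.total.model ∞ fun y => d.s (σ y) (n y) := by
  refine contMDiffOn_univ.1 (hσ.contMDiffOn fun k => ?_)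
  refine ((d.s_smooth k).comp hn.contMDiffOn ?_).congr ?_
  · rintro y ⟨-, rfl⟩
    exact hU y
  · rintro y ⟨-, rfl⟩
    rfl

theorem contMDiffOn_a_comp (hn : ContMDiff M'.model IN ∞ n) (hσ : LocConstOn σ univ)
    (hU : ∀ y, n y ∈ U (σ y)) :
    ContMDiffOn (M'.model.prod M'.model) E.R.arrows.model ∞
      (fun z => d.a (σ z.1) (σ z.2) (n z.1)) {z : M' × M' | n z.1 = n z.2} := by
  have hl : LocConstOn (fun z : M' × M' => (σ z.1, σ z.2)) {z : M' × M' | n z.1 = n z.2} :=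
    (hσ.comp continuousOn_fst (mapsTo_univ _ _)).prodMk
      (hσ.comp continuousOn_snd (mapsTo_univ _ _))
  refine hl.contMDiffOn fun k => ?_
  refine ((d.a_smooth k.1 k.2).comp (hn.comp contMDiff_fst).contMDiffOn ?_).congr ?_
  · rintro z ⟨hz, rfl⟩
    have h := hU z.2
    rw [← show n z.1 = n z.2 from hz] at h
    exact ⟨hU _, h⟩
  · rintro z ⟨-, rfl⟩
    rfl

/-- Local data trivialise the pull-back of `E` along `p`, if a smooth arrow connects each `p y` to
the base point of the section of some locally constant index `σ y`. -/
def trivialization {p : M' → E.base} (hq : ∀ y, E.q (p y) = n y)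
    (hn : ContMDiff M'.model IN ∞ n) (hσ : LocConstOn σ univ) (hU : ∀ y, n y ∈ U (σ y))
    {b : M' → E.R.arrows} (hb : ContMDiff M'.model E.R.arrows.model ∞ b)
    (hsrc : ∀ y, E.R.src (b y) = p y)
    (htgt : ∀ y, E.R.tgt (b y) = E.P.proj (d.s (σ y) (n y))) :
    PullbackTrivialization E p (fun y z => c.lam (σ y) (σ z) (n y))
      (fun x y z => c.gg (σ x) (σ y) (σ z) (n x)) :=
  have key : ∀ y z, E.q (p y) = E.q (p z) → n y = n z ∧ n y ∈ (U (σ y) ∩ U (σ z) : Set N) ∧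
      E.R.tgt (b z) = E.P.proj (d.s (σ z) (n y)) := fun y z h => by
    rw [hq, hq] at h
    exact ⟨h, ⟨hU y, h ▸ hU z⟩, by rw [htgt, h]⟩
  -- The frames of index `σ y` are brought to the point `p y` along `b`, which leaves `lam` and `gg`
  -- unchanged.
  { s := fun y => E.P.smul (b y) (d.s (σ y) (n y))
    a := fun y z => E.R.mul (E.R.mul (b y) (d.a (σ y) (σ z) (n y))) (E.R.inv (b z))
    s_smooth := contMDiffOn_univ.1 (PrincipalBundle.contMDiffOn_smul hb.contMDiffOn
      (d.contMDiff_s_comp hn hσ hU).contMDiffOn fun y _ => htgt y)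
    a_smooth := by
      have e : ∀ z ∈ {z : M' × M' | E.q (p z.1) = E.q (p z.2)},
          E.R.tgt (b z.1) = E.R.src (d.a (σ z.1) (σ z.2) (n z.1)) := fun z hz => by
        rw [htgt, d.src_a _ _ _ (key _ _ hz).2.1]
      refine LieGroupoid.contMDiffOn_mul (LieGroupoid.contMDiffOn_mul
        (hb.comp contMDiff_fst).contMDiffOn
        ((d.contMDiffOn_a_comp hn hσ hU).mono fun z hz => (key _ _ hz).1) e)
        (LieGroupoid.contMDiffOn_inv (hb.comp contMDiff_snd).contMDiffOn) fun z hz => ?_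
      rw [E.R.tgt_mul _ _ (e z hz), E.R.src_inv, d.tgt_a _ _ _ (key _ _ hz).2.1]
      exact (key _ _ hz).2.2.symm
    proj_s := fun y => (E.P.proj_smul _ _ (htgt y)).trans (hsrc y)
    src_a := fun y z h => by
      obtain ⟨-, h2, h3⟩ := key y z h
      rw [E.src_conj (htgt y) h3 (d.src_a _ _ _ h2) (d.tgt_a _ _ _ h2), hsrc]
    tgt_a := fun y z h => by
      obtain ⟨-, h2, h3⟩ := key y z h
      rw [E.tgt_conj (htgt y) h3 (d.src_a _ _ _ h2) (d.tgt_a _ _ _ h2), hsrc]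
    smul_s := fun y z h => by
      obtain ⟨h1, h2, h3⟩ := key y z h
      rw [← h1]
      exact E.conj_smul (htgt y) h3 (d.src_a _ _ _ h2) (d.tgt_a _ _ _ h2) (d.smul_s _ _ _ h2)
    mul_a := fun x y z h h' => by
      obtain ⟨h1, h2, h3⟩ := key x y h
      obtain ⟨-, h5, h6⟩ := key y z h'
      obtain ⟨-, h8, h9⟩ := key x z (h.trans h')
      rw [← h1] at h5 ⊢
      exact E.conj_mul_eq (htgt x) h3 h9 (d.src_a _ _ _ h2) (d.tgt_a _ _ _ h2) (d.src_a _ _ _ h5)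
        (d.tgt_a _ _ _ h5) (d.src_a _ _ _ h8) (d.tgt_a _ _ _ h8)
        (d.mul_a _ _ _ _ ⟨h2, h5.2⟩) }

end Trivialization

section Morita

variable [FiniteDimensional ℝ EN] [IN.Boundaryless] [IsManifold IN ∞ N] [T2Space N]
  [FiniteDimensional ℝ EG] [IG.Boundaryless] [LieGroup IG ∞ G] [T2Space G]
  [FiniteDimensional ℝ EH] [IH.Boundaryless] [LieGroup IH ∞ H] [T2Space H]
  {E : Extension IN N X} {c : CoverCocycle IN N X}

/-- An extension given by the cocycle `c` is Morita equivalent to the extension adapted to `c`. -/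
theorem moritaEquivalent (d : LocalData E c.cocycle) :
    E.MoritaEquivalent c.adaptedExtension := by
  have hqs : ContMDiff E.base.model IN ∞ E.q := E.q_submersion.contMDiff
  -- The common pull-back is made of one sheet for each pair `(i, m)`: a neighbourhood of `m` in
  -- `q⁻¹(U i)` on which arrows `b` lead to the points under `s i`.
  have key : ∀ k : c.ι × E.base, ∃ (W : Opens E.base) (b : E.base → E.R.arrows),
      (E.q k.2 ∈ c.U k.1 → k.2 ∈ W) ∧ (∀ m ∈ W, E.q m ∈ c.U k.1) ∧
      ContMDiffOn E.base.model E.R.arrows.model ∞ b W ∧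
      ∀ m ∈ W, E.R.src (b m) = m ∧ E.R.tgt (b m) = E.P.proj (d.s k.1 (E.q m)) := by
    rintro ⟨i, m⟩
    by_cases hm : E.q m ∈ c.U i
    · obtain ⟨V, b, hV, hmV, hVU, hb, hb'⟩ := E.exists_local_arrow
        ((c.U i).2.preimage hqs.continuous) contMDiffOn_id
        (E.P.proj_smooth.comp_contMDiffOn ((d.s_smooth i).comp hqs.contMDiffOn fun _ h => h))
        (fun y hy => (d.q_s i _ hy).symm) hm
      exact ⟨⟨V, hV⟩, b, fun _ => hmV, fun y hy => hVU hy, hb, hb'⟩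
    -- Pairs with `q m ∉ U i` contribute an empty sheet.
    · exact ⟨⊥, fun m => E.R.unit m, fun h => (hm h).elim, fun _ h => h.elim,
        fun _ h => h.elim, fun _ h => h.elim⟩
  choose W b hW hWU hb hst using key
  let M' : SmoothMfd.{u} := sheets E.base.model W
  let p : M' → E.base := sheets.pt
  let n : M' → N := fun w => E.q (p w)
  let k : M' → c.ι × E.base := sheets.idx (I := E.base.model) (W := W)
  let σ : M' → c.ι := fun w => (k w).1
  have hk : LocConstOn k univ := sheets.locConst_idx
  have hσ : LocConstOn σ univ := hk.map Prod.fst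
  have hkW : ∀ w, p w ∈ W (k w) := fun w => sheets.pt_mem w
  have hU : ∀ w, n w ∈ c.U (σ w) := fun w => hWU _ _ (hkW w)
  have hp : ContMDiff M'.model E.base.model ∞ p := sheets.contMDiff_pt
  have hn : ContMDiff M'.model IN ∞ n := hqs.comp hp
  let p' : M' → c.adaptedExtension.base := fun w =>
    sheets.mk (I := IN) (W := c.U) (σ w) (n w) (hU w)
  have hp' : ContMDiff M'.model c.adaptedExtension.base.model ∞ p' :=
    contMDiffOn_univ.1 (sheets.contMDiffOn_of_pt (I := IN) (W := c.U) hσ hn.contMDiffOn)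
  have hbs : ContMDiff M'.model E.R.arrows.model ∞ fun w => b (k w) (p w) := by
    refine contMDiffOn_univ.1 (hk.contMDiffOn fun l => ?_)
    refine ((hb l).comp hp.contMDiffOn ?_).congr ?_
    · rintro w ⟨-, rfl⟩
      exact hkW w
    · rintro w ⟨-, rfl⟩
      rfl
  let D := d.trivialization (p := p) (fun _ => rfl) hn hσ hU hbs
    (fun w => (hst _ _ (hkW w)).1) fun w => (hst _ _ (hkW w)).2
  let d' := c.adaptedIdentification.localData
  have hproj : ∀ w, p' w = c.adaptedExtension.P.proj (d'.s (σ w) (n w)) := fun w =>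
    ((c.adaptedIdentification.proj_localData (hU w)).trans (CoverCocycle.basePt_eq (hU w))).symm
  -- The map `p'` already lands on the points under the frames of the adapted extension, so unit
  -- arrows suffice. Both trivialisations now have the same `lam` and `gg`.
  let D' := d'.trivialization (p := p') (fun _ => rfl) hn hσ hU
    (c.adaptedExtension.R.unit_smooth.comp hp')
    (fun w => c.adaptedExtension.R.src_unit _)
    fun w => (c.adaptedExtension.R.tgt_unit _).trans (hproj w)
  -- Every admissible pair `(i, m)` is reached, not merely one `i` for each `m`; this is needed for
  -- the surjectivity of `p'`.
  have hex : ∀ i m, E.q m ∈ c.U i → ∃ w : M', p w = m ∧ σ w = i := fun i m h =>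
    ⟨sheets.mk (i, m) m (hW (i, m) h), rfl, rfl⟩
  refine ⟨M', p, p', fun m => ?_, sheets.isSubmersion_pt, fun m => ?_,
    sheets.isSubmersion_of_pt_comp (I := IN) (W := c.U) hp'.continuous
      (sheets.isSubmersion_comp_pt E.q_submersion), fun _ => rfl,
    D.pullbackIsomorphic D' fun _ => rfl⟩
  · obtain ⟨i, hi⟩ := c.isOpenCover.exists_mem (E.q m)
    obtain ⟨w, hw, -⟩ := hex i m hi
    exact ⟨w, hw⟩
  · obtain ⟨m₀, hm₀⟩ := E.q_surjective (sheets.pt (I := IN) (W := c.U) m)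
    obtain ⟨w, hw, hw'⟩ := hex (sheets.idx (I := IN) (W := c.U) m) m₀
      (hm₀ ▸ sheets.pt_mem (I := IN) (W := c.U) m)
    refine ⟨w, sheets.ext (I := IN) (W := c.U) ?_ hw'⟩
    change E.q (p w) = _
    rw [hw, hm₀]

end Morita

end LocalData

end Groups

/-! ### The correspondence between cohomology classes and gerbes -/

section Groups

variable {EG HG : Type} [NormedAddCommGroup EG] [NormedSpace ℝ EG] [TopologicalSpace HG]
  {IG : ModelWithCorners ℝ EG HG} {G : Type u} [Group G] [TopologicalSpace G] [ChartedSpace HG G]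
  {EH HH : Type} [NormedAddCommGroup EH] [NormedSpace ℝ EH] [TopologicalSpace HH]
  {IH : ModelWithCorners ℝ EH HH} {H : Type u} [Group H] [TopologicalSpace H] [ChartedSpace HH H]
  {EN HN : Type} [NormedAddCommGroup EN] [NormedSpace ℝ EN] [TopologicalSpace HN]
  {IN : ModelWithCorners ℝ EN HN} {N : Type u} [TopologicalSpace N] [ChartedSpace HN N]
  {X : LieCrossedModule IG G IH H}
  [FiniteDimensional ℝ EN] [IN.Boundaryless] [IsManifold IN ∞ N] [T2Space N]
  [FiniteDimensional ℝ EG] [IG.Boundaryless] [LieGroup IG ∞ G] [T2Space G]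
  [FiniteDimensional ℝ EH] [IH.Boundaryless] [LieGroup IH ∞ H] [T2Space H]

theorem LocalData.gerbe_eq {E : Extension IN N X} {c : CoverCocycle IN N X}
    (d : LocalData E c.cocycle) : E.gerbe = c.adaptedExtension.gerbe :=
  Quot.sound d.moritaEquivalent

/-- On the common refinement both adapted extensions have local data for the restriction of `c'`:
the first after a change of frames by the coboundary, the second by restriction. Both therefore
define the gerbe of that restriction. -/
theorem CoverCocycle.Cohomologous.gerbe_adaptedExtension_eq {c c' : CoverCocycle IN N X}
    (h : c.Cohomologous c') : c.adaptedExtension.gerbe = c'.adaptedExtension.gerbe := by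
  obtain ⟨κ, V, σ, σ', hσ, hσ', hV, h⟩ := h
  obtain ⟨d⟩ := (c.adaptedIdentification.localData.pullback σ hσ).exists_of_related h
  have d' := c'.adaptedIdentification.localData.pullback σ' hσ'
  exact (LocalData.gerbe_eq (c := c'.refine V hV σ' hσ') d).trans
    (LocalData.gerbe_eq (c := c'.refine V hV σ' hσ') d').symm

variable [ParacompactSpace N]

variable (X) in
/-- The correspondence between non-Abelian cohomology classes and gerbes. -/
noncomputable def gerbeEquiv : NonabelianH1 IN N X ≃ Gerbe IN N X where
  -- Both sides are quotients by generated equivalence relations. Invariance under the generating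
  -- relations suffices, so neither need be shown transitive.
  toFun := Quot.lift (fun c => c.adaptedExtension.gerbe)
    fun _ _ h => h.gerbe_adaptedExtension_eq
  invFun := Quot.lift (fun E => E.exists_localData.choose.cohomologyClass) fun E E' h => by
    obtain ⟨d⟩ := E.exists_localData.choose_spec
    obtain ⟨d₁⟩ := E'.exists_localData.choose_spec
    obtain ⟨c', hc', ⟨d'⟩⟩ := LocalData.exists_of_moritaEquivalent h d
    exact (Quot.sound hc').trans (Quot.sound (CoverCocycle.cohomologous_of_localData d' d₁))
  left_inv := by
    rintro ⟨c⟩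
    obtain ⟨d⟩ := c.adaptedExtension.exists_localData.choose_spec
    exact Quot.sound
      (CoverCocycle.cohomologous_of_localData d c.adaptedIdentification.localData)
  right_inv := by
    rintro ⟨E⟩
    obtain ⟨d⟩ := E.exists_localData.choose_spec
    exact d.gerbe_eq.symm

theorem gerbeEquiv_cohomologyClass (c : CoverCocycle IN N X) :
    gerbeEquiv X c.cohomologyClass = c.adaptedExtension.gerbe := rfl

end Groups

end CrossedGerbe

theorem mainTheorem6
    {EN HN : Type} [NormedAddCommGroup EN] [NormedSpace ℝ EN] [FiniteDimensional ℝ EN]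
    [TopologicalSpace HN] (IN : ModelWithCorners ℝ EN HN) [IN.Boundaryless]
    (N : Type u) [TopologicalSpace N] [ChartedSpace HN N] [IsManifold IN ∞ N]
    [T2Space N] [ParacompactSpace N]
    {EG HG : Type} [NormedAddCommGroup EG] [NormedSpace ℝ EG] [FiniteDimensional ℝ EG]
    [TopologicalSpace HG] (IG : ModelWithCorners ℝ EG HG) [IG.Boundaryless]
    (G : Type u) [Group G] [TopologicalSpace G] [ChartedSpace HG G] [LieGroup IG ∞ G] [T2Space G]
    {EH HH : Type} [NormedAddCommGroup EH] [NormedSpace ℝ EH] [FiniteDimensional ℝ EH]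
    [TopologicalSpace HH] (IH : ModelWithCorners ℝ EH HH) [IH.Boundaryless]
    (H : Type u) [Group H] [TopologicalSpace H] [ChartedSpace HH H] [LieGroup IH ∞ H] [T2Space H]
    (X : CrossedGerbe.LieCrossedModule IG G IH H) :
    ∃ Ξ : CrossedGerbe.NonabelianH1 IN N X ≃ CrossedGerbe.Gerbe IN N X,
      ∀ c : CrossedGerbe.CoverCocycle IN N X,
        (∃ E : CrossedGerbe.Extension IN N X, E.IsAdaptedTo c) ∧
        ∀ E : CrossedGerbe.Extension IN N X, E.IsAdaptedTo c →
          Ξ c.cohomologyClass = E.gerbe := by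
  -- Any copy `E` of the adapted extension has local data for `c`, so it defines the same gerbe as
  -- the chosen one.
  exact ⟨CrossedGerbe.gerbeEquiv X, fun c => ⟨⟨c.adaptedExtension, ⟨c.adaptedIdentification⟩⟩,
    fun E ⟨A⟩ => (CrossedGerbe.gerbeEquiv_cohomologyClass c).trans A.localData.gerbe_eq.symm⟩⟩
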